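/- Let $k$ be an algebraically closed field and let $K_0(\mathrm{Var}_k)$ be the Grothendieck ring of varieties over $k$: the commutative ring generated by the classes $[Y]$ of separated $k$-schemes $Y$ of finite type, with the relations $[Y]=[Y']$ if $Y\cong Y'$ over $k$, $[Y]=[Z]+[Y\setminus Z]$ for $Z\subset Y$ a closed subscheme, $[Y\times_k Y']=[Y][Y']$ and $[\operatorname{Spec}k]=1$. Let $X$ be a reduced curve over $k$ and $0\in X$ a closed point, or more generally let $X$ be a reduced scheme locally of finite type over $k$ and $0\in X$ a closed point with $\dim\mathcal O_{X,0}=1$. Let $s$ be the number of branches of $X$ at $0$, that is, the number of maximal ideals of the integral closure of $\mathcal O_{X,0}$ in its total ring of fractions. For $d\ge 0$ let $\operatorname{Hilb}^d(X,0)$ be the punctual Hilbert scheme, which parametrizes the closed subschemes of $X$ of length $d$ supported at $0$; with its reduced structure it is the projective variety of ideals of colength $d$ in $\mathcal O_{X,0}$ (equivalently in $\mathcal O_{X,0}/\mathfrak m^d$), a closed subvariety of the Grassmannian of $d$-dimensional quotients of the vector space $\mathcal O_{X,0}/\mathfrak m^d$. Then the punctual Hilbert zeta function $$Z^{\mathrm{Hilb}}_{0\subset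 X}(t)=\sum_{d\ge 0}[\operatorname{Hilb}^d(X,0)]\,t^d\in K_0(\mathrm{Var}_k)[[t]]$$ is a rational function of $t$ with denominator $(1-t)^s$: there is a polynomial $P\in K_0(\mathrm{Var}_k)[t]$ such that $(1-t)^s\,Z^{\mathrm{Hilb}}_{0\subset X}(t)=P(t)$. -/

import Mathlib

universe u

open CategoryTheory AlgebraicGeometry

noncomputable section

namespace HilbZeta

/-! ### The Grothendieck ring of varieties -/

/-- Varieties over `k`: separated schemes of finite type over `Spec k`. Non-reduced schemes are
allowed; the scissor relation below identifies the class of `X` with that of `X_red`. -/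
structure Variety (k : Type u) [Field k] where
  /-- the underlying scheme with its structure morphism -/
  toOver : Over (Spec (CommRingCat.of k))
  locallyOfFiniteType : LocallyOfFiniteType toOver.hom
  quasiCompact : QuasiCompact toOver.hom
  isSeparated : IsSeparated toOver.hom

/-- The relators of the Grothendieck ring, in the polynomial ring on one variable for every
variety. -/
inductive K0Relator (k : Type u) [Field k] : MvPolynomial (Variety k) ℤ → Prop
  /-- isomorphic varieties have the same class -/
  | iso (X Y : Variety k) (e : X.toOver ≅ Y.toOver) :
      K0Relator k (MvPolynomial.X X - MvPolynomial.X Y)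
  /-- `[X] = [Z] + [U]` for a closed subscheme `Z` with open complement `U` -/
  | scissor (X Z U : Variety k) (i : Z.toOver ⟶ X.toOver) (j : U.toOver ⟶ X.toOver)
      (hi : IsClosedImmersion i.left) (hj : IsOpenImmersion j.left)
      (hij : IsCompl (Set.range i.left) (Set.range j.left)) :
      K0Relator k (MvPolynomial.X X - (MvPolynomial.X Z + MvPolynomial.X U))
  /-- `[X ×ₖ Y] = [X] [Y]` -/
  | prod (P X Y : Variety k) (p : P.toOver.left ⟶ X.toOver.left) (q : P.toOver.left ⟶ Y.toOver.left)
      (hp : p ≫ X.toOver.hom = P.toOver.hom) (hq : q ≫ Y.toOver.hom = P.toOver.hom)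
      (h : IsPullback p q X.toOver.hom Y.toOver.hom) :
      K0Relator k (MvPolynomial.X P - MvPolynomial.X X * MvPolynomial.X Y)
  /-- `[Spec k] = 1` -/
  | point (X : Variety k) (h : IsIso X.toOver.hom) :
      K0Relator k (MvPolynomial.X X - 1)

/-- The Grothendieck ring of varieties `K₀(Var_k)`, presented by generators and relations. -/
abbrev K0 (k : Type u) [Field k] : Type (u + 1) :=
  MvPolynomial (Variety k) ℤ ⧸ Ideal.span {r | K0Relator k r}

/-- The class `[X]` of a variety in `K₀(Var_k)`. -/
def Variety.cls {k : Type u} [Field k] (X : Variety k) : K0 k :=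
  Ideal.Quotient.mk _ (MvPolynomial.X X)

/-! ### The variety of ideals of colength `d` in a finite-dimensional algebra -/

section Ideals

attribute [local instance] MvPolynomial.gradedAlgebra

/-- Projective space over `k` with homogeneous coordinates indexed by `ι`. -/
abbrev projSpace (k : Type u) [Field k] (ι : Type) : Scheme.{u} :=
  Proj (MvPolynomial.homogeneousSubmodule ι k)

/-- The structure morphism of projective space. -/
def projSpaceHom (k : Type u) [Field k] (ι : Type) : projSpace k ι ⟶ Spec (CommRingCat.of k) :=
  Proj.toSpecZero (MvPolynomial.homogeneousSubmodule ι k) ≫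
    Spec.map (CommRingCat.ofHom (algebraMap k (MvPolynomial.homogeneousSubmodule ι k 0)))

lemma finiteType_zero (k : Type u) [Field k] (ι : Type) :
    (algebraMap k (MvPolynomial.homogeneousSubmodule ι k 0)).FiniteType := by
  refine RingHom.FiniteType.of_surjective _ ?_
  rintro ⟨p, hp⟩
  have hp' : p.IsHomogeneous 0 := hp
  obtain ⟨c, hc⟩ : ∃ c, p = MvPolynomial.C c :=
    ⟨_, MvPolynomial.totalDegree_eq_zero_iff_eq_C.mp (Nat.le_zero.mp hp'.totalDegree_le)⟩
  exact ⟨c, Subtype.ext hc.symm⟩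

instance (k : Type u) [Field k] (ι : Type) : IsSeparated (projSpaceHom k ι) := by
  unfold projSpaceHom; infer_instance

instance (k : Type u) [Field k] (ι : Type) [Finite ι] :
    Algebra.FiniteType (MvPolynomial.homogeneousSubmodule ι k 0) (MvPolynomial ι k) :=
  haveI : IsScalarTower k (MvPolynomial.homogeneousSubmodule ι k 0) (MvPolynomial ι k) :=
    ⟨fun a b c => smul_mul_assoc a (b : MvPolynomial ι k) c⟩
  Algebra.FiniteType.of_restrictScalars_finiteType k _ _

instance (k : Type u) [Field k] (ι : Type) [Finite ι] : QuasiCompact (projSpaceHom k ι) := by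
  unfold projSpaceHom; infer_instance

instance (k : Type u) [Field k] (ι : Type) [Finite ι] :
    LocallyOfFiniteType (projSpaceHom k ι) := by
  have : LocallyOfFiniteType
      (Spec.map (CommRingCat.ofHom (algebraMap k (MvPolynomial.homogeneousSubmodule ι k 0)))) := by
    rw [HasRingHomProperty.Spec_iff (P := @LocallyOfFiniteType)]
    exact finiteType_zero k ι
  unfold projSpaceHom; infer_instance

variable (k : Type u) [Field k] (A : Type u) [CommRing A] [Algebra k A] [Module.Finite k A]

/-- Indices of the Plücker coordinates of `d`-dimensional quotients of `A`. -/
abbrev PluckerIndex (d : ℕ) : Type := Fin d → Fin (Module.finrank k A)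

/-- The Plücker vectors of all ideals `J` of `A` with `dim A ⧸ J = d`: the coordinates, in a basis
of `A`, of the alternating `d`-forms on `A` that factor through `A ⧸ J`. For a given `J` these
forms are a line, which is the point of the quotient `A → A ⧸ J` in the Plücker embedding of the
Grassmannian of `d`-dimensional quotients of `A`. The set is thus the affine cone over the set of
ideals of colength `d`. -/
def pluckerCone (d : ℕ) : Set (PluckerIndex k A d → k) :=
  {p | ∃ J : Ideal A, Module.finrank k (A ⧸ J) = d ∧
    ∃ ω : A [⋀^Fin d]→ₗ[k] k, (∀ v : Fin d → A, (∃ i, v i ∈ J) → ω v = 0) ∧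
      p = fun σ => ω fun i => Module.finBasis k A (σ i)}

/-- The closed subset of projective space cut out by all polynomials that vanish on the Plücker
vectors of the ideals of colength `d`. -/
def idealLocus (d : ℕ) : TopologicalSpace.Closeds (projSpace k (PluckerIndex k A d)) :=
  ⟨ProjectiveSpectrum.zeroLocus (MvPolynomial.homogeneousSubmodule (PluckerIndex k A d) k)
      {F | ∀ p ∈ pluckerCone k A d, MvPolynomial.eval p F = 0},
    ProjectiveSpectrum.isClosed_zeroLocus _ _⟩

/-- The projective variety, with its reduced structure, that parametrizes the ideals of colength
`d` of the finite-dimensional algebra `A` over an algebraically closed field. -/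
def idealVariety (d : ℕ) : Variety k where
  toOver := Over.mk
    ((Scheme.IdealSheafData.vanishingIdeal (idealLocus k A d)).subschemeι ≫ projSpaceHom k _)
  locallyOfFiniteType := by dsimp; infer_instance
  quasiCompact := by dsimp; infer_instance
  isSeparated := by dsimp; infer_instance

end Ideals

/-! ### Punctual Hilbert schemes -/

section Germ

variable {k : Type u} [Field k] {X : Scheme.{u}} (f : X ⟶ Spec (CommRingCat.of k)) (x : X)

/-- The local ring `𝒪_{X,x}` of a `k`-scheme `f : X ⟶ Spec k`, as a `k`-algebra. -/
def LocalRingAt {k : Type u} [Field k] {X : Scheme.{u}} (_f : X ⟶ Spec (CommRingCat.of k))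
    (x : X) : Type u :=
  X.presheaf.stalk x

instance : CommRing (LocalRingAt f x) := inferInstanceAs (CommRing (X.presheaf.stalk x))

instance : IsLocalRing (LocalRingAt f x) := inferInstanceAs (IsLocalRing (X.presheaf.stalk x))

/-- The structure of `k`-algebra given by `Spec 𝒪_{X,x} ⟶ X ⟶ Spec k`. -/
instance : Algebra k (LocalRingAt f x) :=
  RingHom.toAlgebra (S := LocalRingAt f x) (Spec.preimage (X.fromSpecStalk x ≫ f)).hom

/-- The ring `𝒪_{X,x} ⧸ 𝔪 ^ d` of the `d`-th infinitesimal neighbourhood of `x`. -/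
abbrev Neighbourhood (d : ℕ) : Type u :=
  LocalRingAt f x ⧸ IsLocalRing.maximalIdeal (LocalRingAt f x) ^ d

lemma algebraMap_localRingAt_residue_surjective [IsAlgClosed k] [LocallyOfFiniteType f]
    (hx : IsClosed {x}) :
    Function.Surjective fun c : k =>
      IsLocalRing.residue (LocalRingAt f x) (algebraMap k (LocalRingAt f x) c) := by
  have h : (residueFieldIsoBase f x hx).inv =
      Spec.preimage (X.fromSpecStalk x ≫ f) ≫ X.residue x := by
    apply Spec.map_injective
    rw [SpecMap_residueFieldIsoBase_inv, Spec.map_comp, Spec.map_preimage, ← Category.assoc]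
    rfl
  have hs : Function.Surjective (residueFieldIsoBase f x hx).inv.hom :=
    ((ConcreteCategory.isIso_iff_bijective _).mp inferInstance).2
  rw [h] at hs
  exact hs

lemma finite_neighbourhood [IsAlgClosed k] [LocallyOfFiniteType f] (hx : IsClosed {x}) (d : ℕ) :
    Module.Finite k (Neighbourhood f x d) := by
  have : IsLocallyNoetherian X := LocallyOfFiniteType.isLocallyNoetherian f
  have : IsNoetherianRing (LocalRingAt f x) :=
    inferInstanceAs (IsNoetherianRing (X.presheaf.stalk x))
  set m := IsLocalRing.maximalIdeal (LocalRingAt f x) with hm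
  rcases Nat.eq_zero_or_pos d with rfl | hd
  · have : Subsingleton (Neighbourhood f x 0) :=
      Ideal.Quotient.subsingleton_iff.mpr (by simp [Ideal.one_eq_top])
    infer_instance
  have hfin : Module.Finite k (LocalRingAt f x ⧸ m) := by
    refine Module.Finite.of_surjective (Algebra.linearMap k (LocalRingAt f x ⧸ m)) ?_
    exact algebraMap_localRingAt_residue_surjective f x hx
  have hle : m ^ d ≤ m := Ideal.pow_le_self hd.ne'
  refine Module.finite_of_surjective_of_ker_le_nilradical
    (T := LocalRingAt f x ⧸ m) ((Ideal.Quotient.factorₐ k hle))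
    (Ideal.Quotient.factor_surjective hle) ?_ (IsNoetherian.noetherian _)
  intro y hy
  obtain ⟨y, rfl⟩ := Ideal.Quotient.mk_surjective y
  have hy' : y ∈ m := Ideal.Quotient.eq_zero_iff_mem.mp hy
  refine ⟨d, ?_⟩
  rw [← map_pow]
  exact Ideal.Quotient.eq_zero_iff_mem.mpr (Ideal.pow_mem_pow hy' d)

/-- The punctual Hilbert scheme `Hilb^d(X, x)` at a closed point `x`, with its reduced structure.
A closed subscheme of length `d` supported at `x` is given by an ideal of colength `d` of
`𝒪_{X,x}`; such an ideal contains `𝔪 ^ d`, so it is an ideal of colength `d` of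
`𝒪_{X,x} ⧸ 𝔪 ^ d`. -/
def punctualHilb [IsAlgClosed k] [LocallyOfFiniteType f] (hx : IsClosed {x}) (d : ℕ) :
    Variety k :=
  haveI := finite_neighbourhood f x hx d
  idealVariety k (Neighbourhood f x d) d

/-- The punctual Hilbert zeta function `∑ [Hilb^d(X, x)] t^d`. -/
def punctualHilbertZeta [IsAlgClosed k] [LocallyOfFiniteType f] (hx : IsClosed {x}) :
    PowerSeries (K0 k) :=
  PowerSeries.mk fun d => (punctualHilb f x hx d).cls

/-- The number of branches of `X` at `x`: the number of maximal ideals of the normalization of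
`𝒪_{X,x}` (its integral closure in its total ring of fractions), that is, of points of the
normalization of `X` over `x`. -/
def numBranches {X : Scheme.{u}} (x : X) : ℕ :=
  Nat.card (MaximalSpectrum
    (integralClosure (X.presheaf.stalk x) (FractionRing (X.presheaf.stalk x))))

end Germ

end HilbZeta

end

/-!
Let `A = 𝒪_{X,0}` and let `B` be its normalization: `B` is finite over `A`, and its maximal ideals
are generated by regular elements `t₁, …, tₛ`. Stratify the ideals `I` of finite colength by the
exponent `a` of the ideal `I B = (t₁ ^ a₁ ⋯ tₛ ^ aₛ)`. On the `a`-stratum the colength differs from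
`|a|` by a bounded amount, since `I` contains `∏ tᵢ ^ aᵢ` times the conductor. Once `aᵢ` is large,
multiplication by `tᵢ` is a bijection from the `a`-stratum of colength `d` onto the stratum of
`a + eᵢ` of colength `d + 1`; it is given by a linear map, so it preserves classes. Hence the
classes of the strata form an array in `ℕˢ` that is eventually invariant under each of the `s` unit
shifts, and multiplying its generating function by `(1 - t) ^ s` leaves a polynomial.

The strata are constructible rather than closed. Adjoining a pointwise inverse `g⁻¹` (zero where
`g` vanishes) to the algebra of regular functions cuts a variety into the pieces `g ≠ 0` and
`g = 0` and preserves the sum of their classes, so a constructible set has a class that depends on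
the algebra of functions only up to such steps. The Plücker coordinates of a linear image of a
family of ideals are obtained from those of the family by field operations, and therefore define
the same algebra up to such steps.
-/

noncomputable section

namespace HilbZeta

/-! ### Classes of affine varieties -/

section AffineVariety

variable {k : Type u} [Field k]

lemma cls_eq_of_iso {X Y : Variety k} (e : X.toOver ≅ Y.toOver) : X.cls = Y.cls :=
  Ideal.Quotient.eq.mpr (Ideal.subset_span (K0Relator.iso X Y e))

lemma cls_eq_add_of_isCompl {X Z U : Variety k} (i : Z.toOver ⟶ X.toOver)
    (j : U.toOver ⟶ X.toOver) (hi : IsClosedImmersion i.left) (hj : IsOpenImmersion j.left)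
    (hij : IsCompl (Set.range i.left) (Set.range j.left)) : X.cls = Z.cls + U.cls := by
  rw [Variety.cls, Variety.cls, Variety.cls, ← map_add]
  exact Ideal.Quotient.eq.mpr (Ideal.subset_span (K0Relator.scissor X Z U i j hi hj hij))

lemma cls_eq_zero_of_isEmpty {X : Variety k} (h : IsEmpty X.toOver.left) : X.cls = 0 := by
  have hcompl : IsCompl (Set.range (𝟙 X.toOver : X.toOver ⟶ X.toOver).left)
      (Set.range (𝟙 X.toOver : X.toOver ⟶ X.toOver).left) := by
    rw [Set.range_eq_empty]
    exact ⟨disjoint_bot_left, codisjoint_iff_le_sup.mpr fun x => h.elim x⟩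
  have hadd : X.cls = X.cls + X.cls := cls_eq_add_of_isCompl _ _
    (by dsimp; infer_instance) (by dsimp; infer_instance) hcompl
  simpa using hadd

/-- The spectrum of a finitely generated `k`-algebra, as a variety. -/
def affineVariety (k : Type u) [Field k] (S : Type u) [CommRing S] [Algebra k S]
    [Algebra.FiniteType k S] : Variety k where
  toOver := Over.mk (Spec.map (CommRingCat.ofHom (algebraMap k S)))
  locallyOfFiniteType := by
    dsimp
    rw [HasRingHomProperty.Spec_iff (P := @LocallyOfFiniteType)]
    exact RingHom.finiteType_algebraMap.mpr inferInstance
  quasiCompact := by dsimp; infer_instance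
  isSeparated := by dsimp; infer_instance

variable {S T U : Type u} [CommRing S] [Algebra k S] [Algebra.FiniteType k S]
  [CommRing T] [Algebra k T] [Algebra.FiniteType k T]
  [CommRing U] [Algebra k U] [Algebra.FiniteType k U]

/-- The morphism of affine varieties given by a homomorphism of coordinate rings. -/
def affineVarietyMap (φ : S →ₐ[k] T) : (affineVariety k T).toOver ⟶ (affineVariety k S).toOver :=
  Over.homMk (Spec.map (CommRingCat.ofHom φ.toRingHom)) <| by
    dsimp [affineVariety]
    rw [← Spec.map_comp]
    congr 1
    ext x
    simp

lemma affineVariety_cls_congr (e : S ≃ₐ[k] T) :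
    (affineVariety k S).cls = (affineVariety k T).cls := by
  refine cls_eq_of_iso
    (Over.isoMk (Scheme.Spec.mapIso e.symm.toRingEquiv.toCommRingCatIso.op) ?_)
  dsimp [affineVariety]
  rw [← Spec.map_comp]
  congr 1
  ext x
  exact e.symm.commutes x

lemma affineVariety_cls_of_subsingleton [Subsingleton S] : (affineVariety k S).cls = 0 :=
  cls_eq_zero_of_isEmpty (inferInstanceAs (IsEmpty (PrimeSpectrum S)))

lemma affineVariety_cls_eq_add_of_away (g : S) (φ : S →ₐ[k] T) (hφ : Function.Surjective φ)
    (hker : RingHom.ker φ = (Ideal.span {g}).radical)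
    (ψ : S →ₐ[k] U) (hψ : @IsLocalization.Away S _ g U _ ψ.toRingHom.toAlgebra) :
    (affineVariety k S).cls = (affineVariety k T).cls + (affineVariety k U).cls := by
  let := ψ.toRingHom.toAlgebra
  have hclosed : Set.range (PrimeSpectrum.comap φ.toRingHom) = PrimeSpectrum.zeroLocus {g} := by
    rw [range_comap_of_surjective _ _ hφ]
    change PrimeSpectrum.zeroLocus (RingHom.ker φ : Set S) = _
    rw [hker, PrimeSpectrum.zeroLocus_radical, PrimeSpectrum.zeroLocus_span]
  have hopen : Set.range (PrimeSpectrum.comap ψ.toRingHom) = PrimeSpectrum.basicOpen g :=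
    PrimeSpectrum.localization_away_comap_range U g
  refine cls_eq_add_of_isCompl (affineVarietyMap φ) (affineVarietyMap ψ)
    (IsClosedImmersion.spec_of_surjective _ hφ) (IsOpenImmersion.of_isLocalization g) ?_
  change IsCompl (Set.range (PrimeSpectrum.comap φ.toRingHom))
    (Set.range (PrimeSpectrum.comap ψ.toRingHom))
  rw [hclosed, hopen, PrimeSpectrum.basicOpen_eq_zeroLocus_compl]
  exact isCompl_compl

end AffineVariety

/-! ### Algebras of functions and pointwise inversion -/

section Functions

variable {k : Type*} [Field k] {Ω Ω' : Type*}

/-- Pullback of `k`-valued functions along a map of sets. -/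
def pullbackFun (i : Ω' → Ω) : (Ω → k) →ₐ[k] (Ω' → k) :=
  AlgHom.pi fun x => Pi.evalAlgHom k _ (i x)

lemma pullbackFun_inv (i : Ω' → Ω) (f : Ω → k) : pullbackFun i f⁻¹ = (pullbackFun i f)⁻¹ := rfl

lemma pullbackFun_injective {i : Ω' → Ω} (hi : Function.Surjective i) :
    Function.Injective (pullbackFun (k := k) i) :=
  hi.injective_comp_right

/-- The set `P` is open and closed for the algebra of functions `R`: its indicator function, an
idempotent, lies in `R`. When `R` is closed under pointwise inversion, these sets play the role of
the constructible sets. -/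
def IsClopenFor (R : Subalgebra k (Ω → k)) (P : Set Ω) : Prop :=
  P.indicator 1 ∈ R

namespace IsClopenFor

variable {R R' : Subalgebra k (Ω → k)} {P Q : Set Ω}

lemma mono (hR : R ≤ R') (hP : IsClopenFor R P) : IsClopenFor R' P := hR hP

lemma inter (hP : IsClopenFor R P) (hQ : IsClopenFor R Q) : IsClopenFor R (P ∩ Q) := by
  rw [IsClopenFor, Set.inter_indicator_one]
  exact mul_mem hP hQ

lemma compl (hP : IsClopenFor R P) : IsClopenFor R Pᶜ := by
  rw [IsClopenFor, Set.indicator_compl]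
  exact sub_mem (one_mem R) hP

lemma sdiff (hP : IsClopenFor R P) (hQ : IsClopenFor R Q) : IsClopenFor R (P \ Q) := by
  rw [Set.sdiff_eq]
  exact hP.inter hQ.compl

lemma ne_zero {g : Ω → k} (hg : g ∈ R) (hg' : g⁻¹ ∈ R) : IsClopenFor R {x | g x ≠ 0} := by
  have : ({x | g x ≠ 0} : Set Ω).indicator 1 = g * g⁻¹ := by
    ext x; by_cases h : g x = 0 <;> simp [h]
  rw [IsClopenFor, this]
  exact mul_mem hg hg'

lemma eq_zero {g : Ω → k} (hg : g ∈ R) (hg' : g⁻¹ ∈ R) : IsClopenFor R {x | g x = 0} := by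
  simpa only [Set.compl_ofPred, not_not] using (ne_zero hg hg').compl

lemma biInter {α : Type*} (s : Finset α) {E : α → Set Ω} (hE : ∀ a ∈ s, IsClopenFor R (E a)) :
    IsClopenFor R (⋂ a ∈ s, E a) := by
  classical
  induction s using Finset.induction_on with
  | empty => simp [IsClopenFor]
  | insert a s _ ih =>
    rw [Finset.set_biInter_insert]
    exact (hE a (Finset.mem_insert_self a s)).inter
      (ih fun b hb => hE b (Finset.mem_insert_of_mem hb))

end IsClopenFor

/-- The smallest subalgebra that contains `R` and is closed under pointwise inversion, with
`0⁻¹ = 0`. Its elements are the piecewise regular functions on the variety with functions `R`. -/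
def invClosure (R : Subalgebra k (Ω → k)) : Subalgebra k (Ω → k) :=
  sInf {T | R ≤ T ∧ ∀ f ∈ T, f⁻¹ ∈ T}

variable {R R' R₁ R₂ S T : Subalgebra k (Ω → k)}

lemma le_invClosure (R : Subalgebra k (Ω → k)) : R ≤ invClosure R :=
  le_sInf fun _ h => h.1

lemma inv_mem_invClosure {f : Ω → k} (hf : f ∈ invClosure R) : f⁻¹ ∈ invClosure R := by
  rw [invClosure, Algebra.mem_sInf] at hf ⊢
  exact fun T hT => hT.2 _ (hf T hT)

lemma invClosure_le (h : R ≤ T) (hinv : ∀ f ∈ T, f⁻¹ ∈ T) : invClosure R ≤ T :=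
  sInf_le ⟨h, hinv⟩

/-- The algebra of functions `R[g⁻¹]`, where `g⁻¹` is the pointwise inverse with `0⁻¹ = 0`. -/
abbrev adjoinInv (R : Subalgebra k (Ω → k)) (g : Ω → k) : Subalgebra k (Ω → k) :=
  R ⊔ Algebra.adjoin k {g⁻¹}

lemma inv_mem_adjoinInv (R : Subalgebra k (Ω → k)) (g : Ω → k) : g⁻¹ ∈ adjoinInv R g :=
  Algebra.mem_sup_right (Algebra.self_mem_adjoin_singleton k _)

lemma map_adjoinInv (i : Ω' → Ω) (R : Subalgebra k (Ω → k)) (g : Ω → k) :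
    (adjoinInv R g).map (pullbackFun i) = adjoinInv (R.map (pullbackFun i)) (pullbackFun i g) := by
  rw [Algebra.map_sup, AlgHom.map_adjoin, Set.image_singleton, pullbackFun_inv]

/-- `R'` arises from `R` by finitely many steps that adjoin the pointwise inverse of an element. -/
def InvExtension : Subalgebra k (Ω → k) → Subalgebra k (Ω → k) → Prop :=
  Relation.ReflTransGen fun R R' => ∃ g ∈ R, R' = adjoinInv R g

namespace InvExtension

lemma adjoinInv {g : Ω → k} (hg : g ∈ R) : InvExtension R (adjoinInv R g) :=
  .single ⟨g, hg, rfl⟩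

lemma le (h : InvExtension R R') : R ≤ R' := by
  induction h with
  | refl => exact le_rfl
  | tail _ h ih => obtain ⟨g, -, rfl⟩ := h; exact ih.trans le_sup_left

lemma sup_right (h : InvExtension R R') (S : Subalgebra k (Ω → k)) :
    InvExtension (R ⊔ S) (R' ⊔ S) := by
  induction h with
  | refl => exact .refl
  | tail _ h ih =>
    obtain ⟨g, hg, rfl⟩ := h
    exact ih.tail ⟨g, Algebra.mem_sup_left hg, by rw [sup_right_comm]⟩

lemma left_sup (h₁ : InvExtension R R₁) (h₂ : InvExtension R R₂) : InvExtension R₁ (R₁ ⊔ R₂) := by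
  have h := h₂.sup_right R₁
  rwa [sup_eq_right.mpr h₁.le, sup_comm] at h

lemma right_sup (h₁ : InvExtension R R₁) (h₂ : InvExtension R R₂) :
    InvExtension R₂ (R₁ ⊔ R₂) :=
  sup_comm R₂ R₁ ▸ h₂.left_sup h₁

lemma sup (h₁ : InvExtension R R₁) (h₂ : InvExtension R R₂) : InvExtension R (R₁ ⊔ R₂) :=
  h₁.trans (h₁.left_sup h₂)

lemma map_pullbackFun (i : Ω' → Ω) (h : InvExtension R R') :
    InvExtension (R.map (pullbackFun i)) (R'.map (pullbackFun i)) := by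
  induction h with
  | refl => exact .refl
  | tail _ h ih =>
    obtain ⟨g, hg, rfl⟩ := h
    exact ih.tail ⟨pullbackFun i g, ⟨g, hg, rfl⟩, map_adjoinInv i _ g⟩

end InvExtension

lemma exists_invExtension_of_mem {f : Ω → k} (hf : f ∈ invClosure R) :
    ∃ R', InvExtension R R' ∧ f ∈ R' := by
  let T : Subalgebra k (Ω → k) :=
    { carrier := {f | ∃ R', InvExtension R R' ∧ f ∈ R'}
      mul_mem' := fun ⟨_, h₁, ha⟩ ⟨_, h₂, hb⟩ =>
        ⟨_, h₁.sup h₂, mul_mem (Algebra.mem_sup_left ha) (Algebra.mem_sup_right hb)⟩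
      add_mem' := fun ⟨_, h₁, ha⟩ ⟨_, h₂, hb⟩ =>
        ⟨_, h₁.sup h₂, add_mem (Algebra.mem_sup_left ha) (Algebra.mem_sup_right hb)⟩
      algebraMap_mem' := fun c => ⟨R, .refl, R.algebraMap_mem c⟩ }
  refine invClosure_le (T := T) (fun f hf => ⟨R, .refl, hf⟩) ?_ hf
  rintro f ⟨R', h, hf⟩
  exact ⟨_, h.trans (InvExtension.adjoinInv hf), inv_mem_adjoinInv R' f⟩

lemma exists_invExtension_of_fg (hS : S.FG) (h : S ≤ invClosure R) :
    ∃ R', InvExtension R R' ∧ S ≤ R' := by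
  classical
  obtain ⟨t, rfl⟩ := hS
  simp only [Algebra.adjoin_le_iff] at h ⊢
  induction t using Finset.induction_on with
  | empty => exact ⟨R, .refl, by simp⟩
  | insert a t _ ih =>
    rw [Finset.coe_insert, Set.insert_subset_iff] at h
    obtain ⟨R₁, h₁, ha⟩ := exists_invExtension_of_mem h.1
    obtain ⟨R₂, h₂, ht⟩ := ih h.2
    refine ⟨R₁ ⊔ R₂, h₁.sup h₂, ?_⟩
    rw [Finset.coe_insert, Set.insert_subset_iff]
    exact ⟨Algebra.mem_sup_left ha, ht.trans (le_sup_right (a := R₁))⟩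

end Functions

/-! ### Coordinate rings as algebras of functions -/

lemma exists_algHom_of_isMaximal {k : Type*} [Field k] [IsAlgClosed k] {S : Type*} [CommRing S]
    [Algebra k S] [Algebra.FiniteType k S] (M : Ideal S) (hM : M.IsMaximal) :
    ∃ χ : S →ₐ[k] k, ∀ f, f ∈ M ↔ χ f = 0 := by
  let := Ideal.Quotient.field M
  have : Module.Finite k (S ⧸ M) := finite_of_finite_type_of_isJacobsonRing k _
  let e : k ≃ₐ[k] (S ⧸ M) :=
    AlgEquiv.ofBijective (Algebra.ofId _ _) IsAlgClosed.algebraMap_bijective_of_isIntegral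
  refine ⟨e.symm.toAlgHom.comp (Ideal.Quotient.mkₐ k M), fun f => ?_⟩
  rw [← Ideal.Quotient.eq_zero_iff_mem]
  exact (map_eq_zero_iff e.symm e.symm.injective).symm

section CoordinateRing

variable {k : Type u} [Field k] {Ω Ω' : Type u}

/-- The algebra of functions `S` on `Ω` is the coordinate ring of an affine variety with set of
points `Ω`, over an algebraically closed field `k`. -/
structure IsCoordinateRing (S : Subalgebra k (Ω → k)) : Prop where
  fg : S.FG
  exists_point : ∀ χ : S →ₐ[k] k, ∃ p, ∀ f, χ f = f.1 p

open Classical in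
/-- The class of the spectrum of an algebra of functions, with the junk value `0` if the algebra is
not finitely generated. -/
def spectrumClass (S : Subalgebra k (Ω → k)) : K0 k :=
  if h : S.FG then
    haveI : Algebra.FiniteType k S := ⟨(Subalgebra.fg_top S).mpr h⟩
    (affineVariety k S).cls
  else 0

/-- The functions on `P` that are restrictions of functions in `R`. -/
abbrev restrict (P : Set Ω) (R : Subalgebra k (Ω → k)) : Subalgebra k (P → k) :=
  R.map (pullbackFun (Subtype.val : P → Ω))

/-- Restriction of functions from `Ω` to `P`, as a map of algebras of functions. -/
def restrictHom (P : Set Ω) {S S' : Subalgebra k (Ω → k)} (hS : S ≤ S') : S →ₐ[k] restrict P S' :=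
  ((pullbackFun Subtype.val).comp S.val).codRestrict _ fun f => ⟨f.1, hS f.2, rfl⟩

lemma restrictHom_surjective (P : Set Ω) (S : Subalgebra k (Ω → k)) :
    Function.Surjective (restrictHom P (le_refl S)) := by
  rintro ⟨_, f, hf, rfl⟩
  exact ⟨⟨f, hf⟩, rfl⟩

variable {S : Subalgebra k (Ω → k)} {g : Ω → k}

lemma finiteType_of_fg (h : S.FG) : Algebra.FiniteType k S :=
  ⟨(Subalgebra.fg_top S).mpr h⟩

lemma spectrumClass_eq (h : S.FG) :
    spectrumClass S = (haveI := finiteType_of_fg h; (affineVariety k S).cls) := dif_pos h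

lemma spectrumClass_of_isEmpty [IsEmpty Ω] (S : Subalgebra k (Ω → k)) : spectrumClass S = 0 := by
  have h : S.FG := ⟨∅, Subsingleton.elim _ _⟩
  have := finiteType_of_fg h
  rw [spectrumClass_eq h]
  exact affineVariety_cls_of_subsingleton

lemma isCoordinateRing_of_isEmpty [IsEmpty Ω] (S : Subalgebra k (Ω → k)) : IsCoordinateRing S :=
  ⟨⟨∅, Subsingleton.elim _ _⟩, fun χ =>
    absurd (congrArg χ (Subsingleton.elim (0 : S) 1)) (by simp)⟩

lemma spectrumClass_map_pullbackFun (h : S.FG) {i : Ω' → Ω} (hi : Function.Surjective i) :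
    spectrumClass (S.map (pullbackFun i)) = spectrumClass S := by
  have := finiteType_of_fg h
  have := finiteType_of_fg (h.map (pullbackFun i))
  rw [spectrumClass_eq h, spectrumClass_eq (h.map _)]
  exact (affineVariety_cls_congr (S.equivMapOfInjective _ (pullbackFun_injective hi))).symm

lemma IsCoordinateRing.map_pullbackFun (h : IsCoordinateRing S) {i : Ω' → Ω}
    (hi : Function.Surjective i) : IsCoordinateRing (S.map (pullbackFun i)) := by
  refine ⟨h.fg.map _, fun χ => ?_⟩
  obtain ⟨p, hp⟩ := h.exists_point
    (χ.comp (S.equivMapOfInjective _ (pullbackFun_injective hi)).toAlgHom)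
  obtain ⟨q, rfl⟩ := hi p
  refine ⟨q, ?_⟩
  rintro ⟨_, f, hf, rfl⟩
  exact hp ⟨f, hf⟩

lemma exists_pow_mul_eq (hg : g ∈ S) {f : Ω → k} (hf : f ∈ adjoinInv S g) :
    ∃ n : ℕ, ∃ r ∈ S, ∀ x, g x ≠ 0 → g x ^ n * f x = r x := by
  rw [adjoinInv, ← Algebra.adjoin_eq S, ← Algebra.adjoin_union] at hf
  induction hf using Algebra.adjoin_induction with
  | mem f hf =>
    rcases hf with hf | rfl
    · exact ⟨0, f, hf, fun x _ => by simp⟩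
    · exact ⟨1, 1, one_mem S, fun x hx => by simp [hx]⟩
  | algebraMap c => exact ⟨0, _, S.algebraMap_mem c, fun x _ => by simp⟩
  | add a b _ _ ha hb =>
    obtain ⟨n, r, hr, h⟩ := ha
    obtain ⟨n', r', hr', h'⟩ := hb
    refine ⟨n + n', g ^ n' * r + g ^ n * r',
      add_mem (mul_mem (pow_mem hg _) hr) (mul_mem (pow_mem hg _) hr'), fun x hx => ?_⟩
    simp only [Pi.add_apply, Pi.mul_apply, Pi.pow_apply, ← h x hx, ← h' x hx]
    ring
  | mul a b _ _ ha hb =>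
    obtain ⟨n, r, hr, h⟩ := ha
    obtain ⟨n', r', hr', h'⟩ := hb
    refine ⟨n + n', r * r', mul_mem hr hr', fun x hx => ?_⟩
    simp only [Pi.mul_apply, ← h x hx, ← h' x hx]
    ring

lemma IsCoordinateRing.restrict_zero (h : IsCoordinateRing S) (hg : g ∈ S) :
    IsCoordinateRing (restrict {x | g x = 0} S) := by
  refine ⟨h.fg.map _, fun χ => ?_⟩
  have hg0 : restrictHom {x | g x = 0} (le_refl S) ⟨g, hg⟩ = 0 :=
    Subtype.ext (funext fun x => x.2)
  obtain ⟨p, hp⟩ := h.exists_point (χ.comp (restrictHom _ le_rfl))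
  have hp0 : g p = 0 :=
    (hp ⟨g, hg⟩).symm.trans (by rw [AlgHom.comp_apply, hg0, map_zero])
  refine ⟨⟨p, hp0⟩, fun f => ?_⟩
  obtain ⟨f, rfl⟩ := restrictHom_surjective _ S f
  exact hp f

lemma isLocalizationAway_restrictHom_ne_zero (hg : g ∈ S) :
    @IsLocalization.Away S _ ⟨g, hg⟩ (restrict {x | g x ≠ 0} (adjoinInv S g)) _
      (restrictHom {x | g x ≠ 0} (le_sup_left : S ≤ adjoinInv S g)).toRingHom.toAlgebra := by
  let ψ := restrictHom {x | g x ≠ 0} (le_sup_left : S ≤ adjoinInv S g)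
  let := ψ.toRingHom.toAlgebra
  have hinv : ψ ⟨g, hg⟩ * restrictHom _ le_rfl ⟨g⁻¹, inv_mem_adjoinInv S g⟩ = 1 :=
    Subtype.ext (funext fun x => mul_inv_cancel₀ x.2)
  have hunit : IsUnit (algebraMap S _ ⟨g, hg⟩) := IsUnit.of_mul_eq_one (a := ψ ⟨g, hg⟩) _ hinv
  refine IsLocalization.Away.mk _ hunit ?_ ?_
  · rintro ⟨_, f, hf, rfl⟩
    obtain ⟨n, r, hr, hfr⟩ := exists_pow_mul_eq hg hf
    exact ⟨n, ⟨r, hr⟩, Subtype.ext (funext fun x => (mul_comm _ _).trans (hfr x.1 x.2))⟩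
  · intro a b hab
    refine ⟨1, Subtype.ext (funext fun x => ?_)⟩
    change g x ^ 1 * a.1 x = g x ^ 1 * b.1 x
    by_cases hx : g x = 0
    · simp [hx]
    · exact congrArg _ (congrFun (congrArg Subtype.val hab) ⟨x, hx⟩)

lemma IsCoordinateRing.restrict_ne_zero (h : IsCoordinateRing S) (hg : g ∈ S) :
    IsCoordinateRing (restrict {x | g x ≠ 0} (adjoinInv S g)) := by
  refine ⟨(h.fg.sup ⟨{g⁻¹}, by simp⟩).map _, fun χ => ?_⟩
  set ψ := restrictHom {x | g x ≠ 0} (le_sup_left : S ≤ adjoinInv S g)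
  let := ψ.toRingHom.toAlgebra
  have := isLocalizationAway_restrictHom_ne_zero hg
  obtain ⟨p, hp⟩ := h.exists_point (χ.comp ψ)
  have hp0 : g p ≠ 0 := fun h0 =>
    ((IsLocalization.Away.algebraMap_isUnit (⟨g, hg⟩ : S)).map χ).ne_zero ((hp ⟨g, hg⟩).trans h0)
  refine ⟨⟨p, hp0⟩, ?_⟩
  rintro ⟨_, f, hf, rfl⟩
  obtain ⟨n, r, hr, hfr⟩ := exists_pow_mul_eq hg hf
  have hmul : ψ ⟨g, hg⟩ ^ n * restrictHom _ le_rfl ⟨f, hf⟩ = ψ ⟨r, hr⟩ :=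
    Subtype.ext (funext fun x => hfr x.1 x.2)
  have hχ := congrArg χ hmul
  rw [map_mul, map_pow, ← AlgHom.comp_apply χ ψ, ← AlgHom.comp_apply χ ψ, hp, hp] at hχ
  exact mul_left_cancel₀ (pow_ne_zero n hp0) (hχ.trans (hfr p hp0).symm)

variable [IsAlgClosed k]

lemma ker_restrictHom_zero (h : IsCoordinateRing S) (hg : g ∈ S) :
    RingHom.ker (restrictHom {x | g x = 0} (le_refl S)) =
      (Ideal.span {(⟨g, hg⟩ : S)}).radical := by
  have := finiteType_of_fg h.fg
  have : IsJacobsonRing S := isJacobsonRing_of_finiteType (A := k)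
  refine le_antisymm (fun f hf => ?_) ?_
  · rw [Ideal.radical_eq_jacobson, Ideal.jacobson, Ideal.mem_sInf]
    rintro M ⟨hM, hmax⟩
    obtain ⟨χ, hχ⟩ := exists_algHom_of_isMaximal (k := k) M hmax
    obtain ⟨p, hp⟩ := h.exists_point χ
    have hmem : ∀ f, f ∈ M ↔ f.1 p = 0 := fun f => by rw [← hp, hχ]
    have hgp : g p = 0 := (hmem ⟨g, hg⟩).mp (hM (Ideal.mem_span_singleton_self _))
    exact (hmem f).mpr (congrFun (congrArg Subtype.val hf) ⟨p, hgp⟩)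
  · rintro f ⟨n, hn⟩
    obtain ⟨r, hr⟩ := Ideal.mem_span_singleton'.mp hn
    refine Subtype.ext (funext fun x => ?_)
    have hfx : r.1 x * g x = f.1 x ^ n := congrFun (congrArg Subtype.val hr) x
    rw [x.2, mul_zero] at hfx
    exact eq_zero_of_pow_eq_zero hfx.symm

lemma spectrumClass_eq_add (h : IsCoordinateRing S) (hg : g ∈ S) :
    spectrumClass S = spectrumClass (restrict {x | g x = 0} S) +
      spectrumClass (restrict {x | g x ≠ 0} (adjoinInv S g)) := by
  have h0 := h.restrict_zero hg
  have h1 := h.restrict_ne_zero hg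
  have := finiteType_of_fg h.fg
  have := finiteType_of_fg h0.fg
  have := finiteType_of_fg h1.fg
  rw [spectrumClass_eq h.fg, spectrumClass_eq h0.fg, spectrumClass_eq h1.fg]
  exact affineVariety_cls_eq_add_of_away ⟨g, hg⟩ _ (restrictHom_surjective _ S)
    (ker_restrictHom_zero h hg) _ (isLocalizationAway_restrictHom_ne_zero hg)

end CoordinateRing

/-! ### Affine pieces and classes of constructible sets -/

section AffinePieces

variable {k : Type u} [Field k] {Ω Ω' : Type u}

/-- `R` restricts to the coordinate ring of an affine variety with set of points `P`. -/
def IsAffinePiece (P : Set Ω) (R : Subalgebra k (Ω → k)) : Prop :=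
  IsCoordinateRing (restrict P R)

/-- The class of the affine variety with set of points `P` and coordinate ring `R|_P`. -/
def pieceClass (P : Set Ω) (R : Subalgebra k (Ω → k)) : K0 k :=
  spectrumClass (restrict P R)

lemma isAffinePiece_empty (R : Subalgebra k (Ω → k)) : IsAffinePiece ∅ R :=
  isCoordinateRing_of_isEmpty _

lemma pieceClass_empty (R : Subalgebra k (Ω → k)) : pieceClass ∅ R = 0 :=
  spectrumClass_of_isEmpty _

variable {P T : Set Ω} {R : Subalgebra k (Ω → k)} {g : Ω → k} {i : Ω' → Ω}

lemma restrictPreimage_surjective (hP : P ⊆ Set.range i) :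
    Function.Surjective (P.restrictPreimage i) := by
  rintro ⟨x, hx⟩
  obtain ⟨y, rfl⟩ := hP hx
  exact ⟨⟨y, hx⟩, rfl⟩

lemma restrict_preimage (P : Set Ω) (R : Subalgebra k (Ω → k)) (i : Ω' → Ω) :
    restrict (i ⁻¹' P) (R.map (pullbackFun i)) =
      (restrict P R).map (pullbackFun (P.restrictPreimage i)) := by
  rw [restrict, Subalgebra.map_map, Subalgebra.map_map]
  rfl

lemma IsAffinePiece.preimage (h : IsAffinePiece P R) (hP : P ⊆ Set.range i) :
    IsAffinePiece (i ⁻¹' P) (R.map (pullbackFun i)) := by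
  rw [IsAffinePiece, restrict_preimage]
  exact h.map_pullbackFun (restrictPreimage_surjective hP)

lemma pieceClass_preimage (h : IsAffinePiece P R) (hP : P ⊆ Set.range i) :
    pieceClass (i ⁻¹' P) (R.map (pullbackFun i)) = pieceClass P R := by
  rw [pieceClass, restrict_preimage]
  exact spectrumClass_map_pullbackFun h.fg (restrictPreimage_surjective hP)

/-- The identification of `P ∩ T` with a subset of `P`. -/
def interEquiv (P T : Set Ω) : ↥(P ∩ T) ≃ {x : P | x.1 ∈ T} where
  toFun x := ⟨⟨x, x.2.1⟩, x.2.2⟩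
  invFun x := ⟨x, x.1.2, x.2⟩

lemma restrict_inter (P T : Set Ω) (R : Subalgebra k (Ω → k)) :
    restrict (P ∩ T) R =
      (restrict {x : P | x.1 ∈ T} (restrict P R)).map (pullbackFun (interEquiv P T)) := by
  rw [Subalgebra.map_map, Subalgebra.map_map]
  rfl

lemma restrict_adjoinInv (P : Set Ω) (R : Subalgebra k (Ω → k)) (g : Ω → k) :
    restrict P (adjoinInv R g) = adjoinInv (restrict P R) (pullbackFun Subtype.val g) :=
  map_adjoinInv _ R g

lemma restrict_zero_adjoinInv (P : Set Ω) (R : Subalgebra k (Ω → k)) (g : Ω → k) :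
    restrict (P ∩ {x | g x = 0}) (adjoinInv R g) = restrict (P ∩ {x | g x = 0}) R := by
  have hg : pullbackFun (Subtype.val : ↥(P ∩ {x | g x = 0}) → Ω) g⁻¹ = 0 :=
    funext fun x => inv_eq_zero.mpr x.2.2
  rw [restrict_adjoinInv, adjoinInv, ← pullbackFun_inv, hg, sup_eq_left]
  exact Algebra.adjoin_le (Set.singleton_subset_iff.mpr (zero_mem _))

lemma IsAffinePiece.inter_zero (h : IsAffinePiece P R) (hg : g ∈ R) :
    IsAffinePiece (P ∩ {x | g x = 0}) (adjoinInv R g) := by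
  rw [IsAffinePiece, restrict_zero_adjoinInv, restrict_inter]
  exact (h.restrict_zero ⟨g, hg, rfl⟩).map_pullbackFun (interEquiv _ _).surjective

lemma IsAffinePiece.inter_ne_zero (h : IsAffinePiece P R) (hg : g ∈ R) :
    IsAffinePiece (P ∩ {x | g x ≠ 0}) (adjoinInv R g) := by
  rw [IsAffinePiece, restrict_inter, restrict_adjoinInv]
  exact (h.restrict_ne_zero ⟨g, hg, rfl⟩).map_pullbackFun (interEquiv _ _).surjective

lemma pieceClass_eq_add [IsAlgClosed k] (h : IsAffinePiece P R) (hg : g ∈ R) :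
    pieceClass P R = pieceClass (P ∩ {x | g x = 0}) (adjoinInv R g) +
      pieceClass (P ∩ {x | g x ≠ 0}) (adjoinInv R g) := by
  have hmem : pullbackFun Subtype.val g ∈ restrict P R := ⟨g, hg, rfl⟩
  have h0 := spectrumClass_map_pullbackFun (h.restrict_zero hmem).fg
    (interEquiv P {x | g x = 0}).surjective
  have h1 := spectrumClass_map_pullbackFun (h.restrict_ne_zero hmem).fg
    (interEquiv P {x | g x ≠ 0}).surjective
  rw [pieceClass, pieceClass, pieceClass, restrict_zero_adjoinInv, restrict_inter, restrict_inter,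
    restrict_adjoinInv, spectrumClass_eq_add h hmem]
  exact congrArg₂ _ h0.symm h1.symm

lemma adjoinInv_indicator (hT : IsClopenFor R T) : adjoinInv R (T.indicator 1) = R := by
  have hinv : (T.indicator 1 : Ω → k)⁻¹ = T.indicator 1 := by
    ext x; by_cases h : x ∈ T <;> simp [h]
  rw [adjoinInv, hinv, sup_eq_left]
  exact Algebra.adjoin_le (Set.singleton_subset_iff.mpr hT)

lemma setOf_indicator_eq_zero (T : Set Ω) : {x | T.indicator (1 : Ω → k) x = 0} = Tᶜ := by
  ext x; by_cases h : x ∈ T <;> simp [h]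

lemma setOf_indicator_ne_zero (T : Set Ω) : {x | T.indicator (1 : Ω → k) x ≠ 0} = T := by
  ext x; by_cases h : x ∈ T <;> simp [h]

lemma IsAffinePiece.inter (h : IsAffinePiece P R) (hT : IsClopenFor R T) :
    IsAffinePiece (P ∩ T) R := by
  simpa only [adjoinInv_indicator hT, setOf_indicator_ne_zero] using h.inter_ne_zero hT

lemma IsAffinePiece.sdiff (h : IsAffinePiece P R) (hT : IsClopenFor R T) :
    IsAffinePiece (P \ T) R := by
  simpa only [adjoinInv_indicator hT, setOf_indicator_eq_zero, ← Set.sdiff_eq] using h.inter_zero hT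

lemma pieceClass_inter_add_sdiff [IsAlgClosed k] (h : IsAffinePiece P R) (hT : IsClopenFor R T) :
    pieceClass (P ∩ T) R + pieceClass (P \ T) R = pieceClass P R := by
  simpa only [adjoinInv_indicator hT, setOf_indicator_eq_zero, setOf_indicator_ne_zero,
    ← Set.sdiff_eq, add_comm] using (pieceClass_eq_add h hT).symm

end AffinePieces

section Decompositions

variable {k : Type u} [Field k] {Ω Ω' : Type u}

/-- The set `Q` is a finite disjoint union of affine pieces for `R`, open and closed for `R`, whose
classes add up to `m`. -/
inductive HasDecomposition (R : Subalgebra k (Ω → k)) : Set Ω → K0 k → Prop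
  | empty : HasDecomposition R ∅ 0
  | union {P Q : Set Ω} {m : K0 k} : IsAffinePiece P R → IsClopenFor R P → Disjoint P Q →
      HasDecomposition R Q m → HasDecomposition R (P ∪ Q) (pieceClass P R + m)

variable {R R' : Subalgebra k (Ω → k)} {P Q T : Set Ω} {m m' : K0 k}

namespace HasDecomposition

lemma of_isAffinePiece (h : IsAffinePiece P R) (hP : IsClopenFor R P) :
    HasDecomposition R P (pieceClass P R) := by
  simpa using HasDecomposition.union h hP (Set.disjoint_empty P) .empty

lemma add (h : HasDecomposition R P m) (h' : HasDecomposition R Q m') (hd : Disjoint P Q) :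
    HasDecomposition R (P ∪ Q) (m + m') := by
  induction h with
  | empty => simpa using h'
  | union hpiece hclopen hdisj _ ih =>
    rw [Set.disjoint_union_left] at hd
    rw [Set.union_assoc, add_assoc]
    exact .union hpiece hclopen (Set.disjoint_union_right.mpr ⟨hdisj, hd.1⟩) (ih hd.2)

lemma preimage {i : Ω' → Ω} (h : HasDecomposition R Q m) (hQ : Q ⊆ Set.range i) :
    HasDecomposition (R.map (pullbackFun i)) (i ⁻¹' Q) m := by
  induction h with
  | empty => exact .empty
  | union hpiece hclopen hdisj _ ih =>
    rw [Set.union_subset_iff] at hQ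
    rw [Set.preimage_union, ← pieceClass_preimage hpiece hQ.1]
    exact .union (hpiece.preimage hQ.1) ⟨_, hclopen, rfl⟩ (hdisj.preimage i) (ih hQ.2)

variable [IsAlgClosed k]

lemma of_invExtension (h : IsAffinePiece P R) (hR : InvExtension R R') (hP : IsClopenFor R' P) :
    HasDecomposition R' P (pieceClass P R) := by
  induction hR using Relation.ReflTransGen.head_induction_on generalizing P with
  | refl => exact .of_isAffinePiece h hP
  | head hs hR ih =>
    obtain ⟨g, hg, rfl⟩ := hs
    have hle := InvExtension.le hR
    have hg' : g ∈ R' := hle (Algebra.mem_sup_left hg)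
    have hinv : g⁻¹ ∈ R' := hle (inv_mem_adjoinInv _ g)
    have h0 := ih (h.inter_zero hg) (hP.inter (.eq_zero hg' hinv))
    have h1 := ih (h.inter_ne_zero hg) (hP.inter (.ne_zero hg' hinv))
    have hdisj : Disjoint (P ∩ {x | g x = 0}) (P ∩ {x | g x ≠ 0}) :=
      disjoint_compl_right.mono inf_le_right inf_le_right
    have hunion : P ∩ {x | g x = 0} ∪ P ∩ {x | g x ≠ 0} = P := Set.inter_union_compl P _
    simpa only [hunion, ← pieceClass_eq_add h hg] using h0.add h1 hdisj

lemma invExtension (h : HasDecomposition R Q m) (hR : InvExtension R R') :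
    HasDecomposition R' Q m := by
  induction h with
  | empty => exact .empty
  | union hpiece hclopen hdisj _ ih =>
    exact (of_invExtension hpiece hR (hclopen.mono hR.le)).add ih hdisj

lemma exists_inter_sdiff (h : HasDecomposition R Q m) (hT : IsClopenFor R T) :
    ∃ m₁ m₂, HasDecomposition R (Q ∩ T) m₁ ∧ HasDecomposition R (Q \ T) m₂ ∧ m = m₁ + m₂ := by
  induction h with
  | empty => exact ⟨0, 0, by simpa using .empty, by simpa using .empty, by simp⟩
  | @union P' Q' m hpiece hclopen hdisj _ ih =>
    obtain ⟨m₁, m₂, ih₁, ih₂, rfl⟩ := ih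
    refine ⟨pieceClass (P' ∩ T) R + m₁, pieceClass (P' \ T) R + m₂, ?_, ?_, ?_⟩
    · rw [Set.union_inter_distrib_right]
      exact .union (hpiece.inter hT) (hclopen.inter hT)
        (hdisj.mono Set.inter_subset_left Set.inter_subset_left) ih₁
    · rw [Set.union_sdiff_distrib]
      exact .union (hpiece.sdiff hT) (hclopen.sdiff hT)
        (hdisj.mono Set.sdiff_subset Set.sdiff_subset) ih₂
    · rw [← pieceClass_inter_add_sdiff hpiece hT, add_add_add_comm]

lemma eq_pieceClass (h : HasDecomposition R P m) (hP : IsAffinePiece P R) :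
    m = pieceClass P R := by
  induction h with
  | empty => rw [pieceClass_empty]
  | @union P' Q' m _ hclopen hdisj _ ih =>
    have hsdiff : (P' ∪ Q') \ P' = Q' := by rw [Set.union_sdiff_left, hdisj.symm.sdiff_eq_left]
    have hQ' : IsAffinePiece Q' R := hsdiff ▸ hP.sdiff hclopen
    rw [← pieceClass_inter_add_sdiff hP hclopen, hsdiff, Set.union_inter_cancel_left, ih hQ']

lemma unique (h : HasDecomposition R Q m) (h' : HasDecomposition R Q m') : m = m' := by
  induction h generalizing m' with
  | empty => rw [h'.eq_pieceClass (isAffinePiece_empty R), pieceClass_empty]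
  | @union P' Q' m hpiece hclopen hdisj _ ih =>
    obtain ⟨m₁, m₂, h₁, h₂, rfl⟩ := h'.exists_inter_sdiff hclopen
    rw [Set.union_inter_cancel_left] at h₁
    rw [Set.union_sdiff_left, hdisj.symm.sdiff_eq_left] at h₂
    rw [ih h₂, h₁.eq_pieceClass hpiece]

end HasDecomposition

/-- The set `Q`, which is constructible for the structure defined by `R`, has the class `m` in the
Grothendieck ring. -/
def HasClass (R : Subalgebra k (Ω → k)) (Q : Set Ω) (m : K0 k) : Prop :=
  ∃ R', InvExtension R R' ∧ HasDecomposition R' Q m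

namespace HasClass

lemma empty (R : Subalgebra k (Ω → k)) : HasClass R ∅ 0 := ⟨R, .refl, .empty⟩

lemma preimage {i : Ω' → Ω} (h : HasClass R Q m) (hQ : Q ⊆ Set.range i) :
    HasClass (R.map (pullbackFun i)) (i ⁻¹' Q) m := by
  obtain ⟨R', hext, hdec⟩ := h
  exact ⟨_, hext.map_pullbackFun i, hdec.preimage hQ⟩

variable [IsAlgClosed k]

lemma of_isAffinePiece (h : IsAffinePiece P R) (hP : IsClopenFor (invClosure R) P) :
    HasClass R P (pieceClass P R) := by
  obtain ⟨R', hR, hP'⟩ := exists_invExtension_of_mem hP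
  exact ⟨R', hR, .of_invExtension h hR hP'⟩

lemma add (h : HasClass R P m) (h' : HasClass R Q m') (hd : Disjoint P Q) :
    HasClass R (P ∪ Q) (m + m') := by
  obtain ⟨R₁, hext₁, hdec₁⟩ := h
  obtain ⟨R₂, hext₂, hdec₂⟩ := h'
  exact ⟨R₁ ⊔ R₂, hext₁.sup hext₂, (hdec₁.invExtension (hext₁.left_sup hext₂)).add
    (hdec₂.invExtension (hext₁.right_sup hext₂)) hd⟩

lemma exists_inter_sdiff (h : HasClass R Q m) (hT : IsClopenFor (invClosure R) T) :
    ∃ m₁ m₂, HasClass R (Q ∩ T) m₁ ∧ HasClass R (Q \ T) m₂ ∧ m = m₁ + m₂ := by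
  obtain ⟨R₁, hext₁, hdec₁⟩ := h
  obtain ⟨R₂, hext₂, hT₂⟩ := exists_invExtension_of_mem hT
  obtain ⟨m₁, m₂, h₁, h₂, hm⟩ := (hdec₁.invExtension (hext₁.left_sup hext₂)).exists_inter_sdiff
    (.mono le_sup_right hT₂)
  exact ⟨m₁, m₂, ⟨_, hext₁.sup hext₂, h₁⟩, ⟨_, hext₁.sup hext₂, h₂⟩, hm⟩

lemma unique (h : HasClass R Q m) (h' : HasClass R' Q m') (hR : R.FG) (hR' : R'.FG)
    (hle : R ≤ invClosure R') (hle' : R' ≤ invClosure R) : m = m' := by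
  obtain ⟨R₁, e₁, hdec₁⟩ := h
  obtain ⟨R₂, e₂, hdec₂⟩ := h'
  obtain ⟨E₁, f₁, hE₁⟩ := exists_invExtension_of_fg hR' hle'
  obtain ⟨E₂, f₂, hE₂⟩ := exists_invExtension_of_fg hR hle
  have hext₂ : InvExtension (R₂ ⊔ E₂) ((R₁ ⊔ E₁) ⊔ (R₂ ⊔ E₂)) := by
    have := (e₁.sup f₁).sup_right (R₂ ⊔ E₂)
    rwa [sup_eq_right.mpr (hE₂.trans le_sup_right)] at this
  have hext₁ : InvExtension (R₁ ⊔ E₁) ((R₁ ⊔ E₁) ⊔ (R₂ ⊔ E₂)) := by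
    have := (e₂.sup f₂).sup_right (R₁ ⊔ E₁)
    rwa [sup_eq_right.mpr (hE₁.trans le_sup_right), sup_comm (R₂ ⊔ E₂)] at this
  exact (hdec₁.invExtension ((e₁.left_sup f₁).trans hext₁)).unique
    (hdec₂.invExtension ((e₂.left_sup f₂).trans hext₂))

theorem eq_of_bijection {E : Type u} {R' : Subalgebra k (Ω' → k)} {Q' : Set Ω'}
    (h : HasClass R Q m) (h' : HasClass R' Q' m') (hR : R.FG) (hR' : R'.FG)
    (i : E → Ω) (i' : E → Ω') (hi : Set.range i = Q) (hi' : Set.range i' = Q')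
    (hle : R.map (pullbackFun i) ≤ invClosure (R'.map (pullbackFun i')))
    (hle' : R'.map (pullbackFun i') ≤ invClosure (R.map (pullbackFun i))) : m = m' := by
  subst hi hi'
  have hE := h.preimage subset_rfl
  have hE' := h'.preimage subset_rfl
  rw [Set.preimage_range] at hE hE'
  exact hE.unique hE' (hR.map _) (hR'.map _) hle hle'

lemma sum_partition {α : Type*} (s : Finset α) (T : α → Set Ω) (h : HasClass R Q m)
    (hT : ∀ a ∈ s, IsClopenFor (invClosure R) (T a)) (hd : (s : Set α).PairwiseDisjoint T)
    (hQ : Q = ⋃ a ∈ s, T a) :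
    ∃ c : α → K0 k, (∀ a ∈ s, HasClass R (T a) (c a)) ∧ m = ∑ a ∈ s, c a := by
  classical
  induction s using Finset.induction_on generalizing Q m with
  | empty =>
    obtain rfl : Q = ∅ := by simpa using hQ
    obtain ⟨R', _, hdec⟩ := h
    exact ⟨0, by simp, by simpa using hdec.unique .empty⟩
  | insert a s ha ih =>
    obtain ⟨m₁, m₂, h₁, h₂, rfl⟩ := h.exists_inter_sdiff (hT a (Finset.mem_insert_self a s))
    rw [Finset.coe_insert, Set.pairwiseDisjoint_insert_of_notMem (by simpa using ha)] at hd
    have hdis : Disjoint (⋃ b ∈ s, T b) (T a) :=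
      Set.disjoint_iUnion₂_left.mpr fun b hb => (hd.2 b hb).symm
    rw [Finset.set_biUnion_insert] at hQ
    rw [hQ, Set.union_inter_cancel_left] at h₁
    have hsdiff : Q \ T a = ⋃ b ∈ s, T b := by rw [hQ, Set.union_sdiff_left, hdis.sdiff_eq_left]
    obtain ⟨c, hc, rfl⟩ := ih h₂ (fun b hb => hT b (Finset.mem_insert_of_mem hb)) hd.1 hsdiff
    have hupdate : ∀ b ∈ s, Function.update c a m₁ b = c b := fun b hb =>
      Function.update_of_ne (ne_of_mem_of_not_mem hb ha) _ _
    refine ⟨Function.update c a m₁, fun b hb => ?_, ?_⟩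
    · rcases Finset.mem_insert.mp hb with rfl | hb
      · simpa using h₁
      · exact (hupdate b hb).symm ▸ hc b hb
    · rw [Finset.sum_insert ha, Function.update_self, Finset.sum_congr rfl hupdate]

end HasClass

end Decompositions

/-! ### Reduced closed subschemes -/

section ReducedSubscheme

open Scheme.IdealSheafData

variable {X : Scheme.{u}}

lemma exists_isOpenImmersion_subscheme (T : TopologicalSpace.Closeds X) (U : X.affineOpens)
    {S : CommRingCat.{u}} (χ : Γ(X, U.1) ⟶ S) (hχ : Function.Surjective χ.hom)
    (hker : RingHom.ker χ.hom = (vanishingIdeal T).ideal U) :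
    ∃ j : Spec S ⟶ (vanishingIdeal T).subscheme, IsOpenImmersion j ∧
      Set.range j = (vanishingIdeal T).subschemeι ⁻¹' U.1 ∧
      j ≫ (vanishingIdeal T).subschemeι = Spec.map χ ≫ U.2.fromSpec := by
  set I := vanishingIdeal T
  let e : CommRingCat.of (Γ(X, U.1) ⧸ I.ideal U) ≅ S :=
    ((Ideal.quotEquivOfEq hker.symm).trans
      (RingHom.quotientKerEquivOfSurjective hχ)).toCommRingCatIso
  have he : CommRingCat.ofHom (Ideal.Quotient.mk (I.ideal U)) ≫ e.hom = χ := by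
    ext x; rfl
  let φ : Spec (CommRingCat.of (Γ(X, U.1) ⧸ I.ideal U)) ⟶ I.subscheme := I.subschemeCover.f U
  have hφ : IsOpenImmersion φ := I.subschemeCover.map_prop U
  have hφι : φ ≫ I.subschemeι =
      Spec.map (CommRingCat.ofHom (Ideal.Quotient.mk (I.ideal U))) ≫ U.2.fromSpec :=
    (I.subschemeCover_map_subschemeι U).trans (I.glueDataObjι_ι U)
  have hrange : Set.range φ = I.subschemeι ⁻¹' U.1 :=
    congrArg (fun V : I.subscheme.Opens => (V : Set I.subscheme))
      (I.opensRange_subschemeCover_map U)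
  refine ⟨Spec.map e.hom ≫ φ, inferInstance, ?_, ?_⟩
  · rw [← hrange]
    exact (Spec.map e.hom).surjective.range_comp φ
  · rw [Category.assoc, hφι, ← Spec.map_comp_assoc, he]

lemma exists_isOpenImmersion_subscheme_of_iso (T : TopologicalSpace.Closeds X) (U : X.affineOpens)
    {R S : CommRingCat.{u}} (e : R ≅ Γ(X, U.1)) (a : Spec R ⟶ X)
    (ha : Spec.map e.hom ≫ a = U.2.fromSpec) (χ : R ⟶ S) (hχ : Function.Surjective χ.hom)
    (hker : ∀ z, χ.hom z = 0 ↔ ∀ y : Spec R, a y ∈ (T : Set X) → z ∈ y.asIdeal) :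
    ∃ j : Spec S ⟶ (vanishingIdeal T).subscheme, IsOpenImmersion j ∧
      Set.range j = (vanishingIdeal T).subschemeι ⁻¹' U.1 ∧
      j ≫ (vanishingIdeal T).subschemeι = Spec.map χ ≫ a := by
  have ha' : Spec.map e.inv ≫ U.2.fromSpec = a := by
    rw [← ha, ← Spec.map_comp_assoc, e.hom_inv_id, Spec.map_id, Category.id_comp]
  have hsurj : Function.Surjective (e.inv ≫ χ).hom :=
    hχ.comp e.symm.commRingCatIsoToRingEquiv.surjective
  have hker' : RingHom.ker (e.inv ≫ χ).hom = (vanishingIdeal T).ideal U := by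
    rw [vanishingIdeal_ideal]
    ext w
    rw [RingHom.mem_ker, PrimeSpectrum.mem_vanishingIdeal]
    refine (hker (e.inv.hom w)).trans ⟨fun h y hy => ?_, fun h y hy => ?_⟩
    · have hw : e.hom.hom (e.inv.hom w) ∈ y.asIdeal :=
        h (Spec.map e.hom y) (by rw [← ha] at hy; exact hy)
      rwa [e.inv_hom_id_apply] at hw
    · exact h (Spec.map e.inv y) (by rw [← ha'] at hy; exact hy)
  obtain ⟨j, hj, hrange, hjι⟩ := exists_isOpenImmersion_subscheme T U (e.inv ≫ χ) hsurj hker'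
  exact ⟨j, hj, hrange, by rw [hjι, Spec.map_comp, Category.assoc, ha']⟩

lemma range_inclusion_vanishingIdeal {T T' : TopologicalSpace.Closeds X} (h : T' ≤ T) :
    Set.range (inclusion (vanishingIdeal_antimono h)) = (vanishingIdeal T).subschemeι ⁻¹' T' := by
  have hrange : Set.range (vanishingIdeal T').subschemeι = T' := by
    rw [range_subschemeι, coe_support_vanishingIdeal]
  rw [← hrange, ← inclusion_subschemeι (vanishingIdeal_antimono h), Scheme.Hom.comp_base,
    TopCat.coe_comp, Set.range_comp,
    Set.preimage_image_eq _ (vanishingIdeal T).subschemeι.isEmbedding.injective]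

lemma isCompl_range_inclusion {T T' : TopologicalSpace.Closeds X} (h : T' ≤ T) (U : X.Opens)
    (hU : (T : Set X) ∩ (U : Set X)ᶜ = T') :
    IsCompl (Set.range (inclusion (vanishingIdeal_antimono h)))
      ((vanishingIdeal T).subschemeι ⁻¹' U) := by
  have hT : (vanishingIdeal T).subschemeι ⁻¹' T = Set.univ := by
    rw [Set.preimage_eq_univ_iff, range_subschemeι, coe_support_vanishingIdeal]
  rw [range_inclusion_vanishingIdeal h, ← hU, Set.preimage_inter, hT, Set.univ_inter,
    Set.preimage_compl]
  exact isCompl_compl.symm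

end ReducedSubscheme

/-! ### Polynomial functions and Zariski closed sets -/

section ZariskiClosed

variable {k : Type u} [Field k] {ι : Type}

/-- Zariski closed subsets of the affine space `ι → k`. -/
def IsZariskiClosed (P : Set (ι → k)) : Prop :=
  ∀ p, (∀ F : MvPolynomial ι k, (∀ q ∈ P, MvPolynomial.eval q F = 0) →
    MvPolynomial.eval p F = 0) → p ∈ P

/-- The algebra of polynomial functions on `ι → k`. -/
def coordinateAlgebra (k : Type u) [Field k] (ι : Type) : Subalgebra k ((ι → k) → k) :=
  (MvPolynomial.aeval fun (i : ι) (p : ι → k) => p i).range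

lemma aeval_coord_apply (F : MvPolynomial ι k) (p : ι → k) :
    MvPolynomial.aeval (fun (i : ι) (p : ι → k) => p i) F p = MvPolynomial.eval p F := by
  have h : (Pi.evalAlgHom k (fun _ => k) p).comp
      (MvPolynomial.aeval fun (i : ι) (p : ι → k) => p i) = MvPolynomial.aeval p := by
    ext i; simp
  exact (DFunLike.congr_fun h F).trans (by rw [MvPolynomial.aeval_eq_eval])

lemma eval_mem_coordinateAlgebra (F : MvPolynomial ι k) :
    (fun p => MvPolynomial.eval p F) ∈ coordinateAlgebra k ι :=
  ⟨F, funext fun p => aeval_coord_apply F p⟩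

lemma coord_mem_coordinateAlgebra (i : ι) : (fun p => p i) ∈ coordinateAlgebra k ι := by
  simpa using eval_mem_coordinateAlgebra (k := k) (.X i)

lemma coordinateAlgebra_fg [Finite ι] : (coordinateAlgebra k ι).FG := by
  have hfg := (inferInstance : Algebra.FiniteType k (MvPolynomial ι k)).out.map
    (MvPolynomial.aeval fun (i : ι) (p : ι → k) => p i)
  rwa [Algebra.map_top] at hfg

/-- Restriction of polynomials to a set of points. -/
def evalOn (P : Set (ι → k)) : MvPolynomial ι k →ₐ[k] restrict P (coordinateAlgebra k ι) :=
  ((pullbackFun (Subtype.val : P → ι → k)).comp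
    (MvPolynomial.aeval fun (i : ι) (p : ι → k) => p i)).codRestrict _
    fun F => ⟨_, ⟨F, rfl⟩, rfl⟩

lemma evalOn_apply (P : Set (ι → k)) (F : MvPolynomial ι k) (p : P) :
    (evalOn P F).1 p = MvPolynomial.eval p.1 F := aeval_coord_apply F p.1

lemma evalOn_eq_zero_iff {P : Set (ι → k)} {F : MvPolynomial ι k} :
    evalOn P F = 0 ↔ ∀ p ∈ P, MvPolynomial.eval p F = 0 :=
  ⟨fun h p hp => by rw [← evalOn_apply P F ⟨p, hp⟩, h]; rfl,
    fun h => Subtype.ext (funext fun p => (evalOn_apply P F p).trans (h p p.2))⟩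

lemma evalOn_surjective (P : Set (ι → k)) : Function.Surjective (evalOn P) := by
  rintro ⟨_, _, ⟨F, rfl⟩, rfl⟩
  exact ⟨F, rfl⟩

lemma IsZariskiClosed.isAffinePiece [Finite ι] {P : Set (ι → k)} (h : IsZariskiClosed P) :
    IsAffinePiece P (coordinateAlgebra k ι) := by
  refine ⟨coordinateAlgebra_fg.map _, fun χ => ?_⟩
  set p : ι → k := fun i => χ (evalOn P (.X i)) with hp
  have hχ (F : MvPolynomial ι k) : χ (evalOn P F) = MvPolynomial.eval p F := by
    have hcomp : χ.comp (evalOn P) = MvPolynomial.aeval p := by ext i; simp [hp]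
    exact (DFunLike.congr_fun hcomp F).trans (by rw [MvPolynomial.aeval_eq_eval])
  refine ⟨⟨p, h p fun F hF => ?_⟩, fun f => ?_⟩
  · rw [← hχ, evalOn_eq_zero_iff.mpr hF, map_zero]
  · obtain ⟨F, rfl⟩ := evalOn_surjective P f
    rw [hχ, evalOn_apply]

lemma eval_smul_of_isHomogeneous {F : MvPolynomial ι k} {n : ℕ} (hF : F.IsHomogeneous n)
    (p : ι → k) (c : k) : MvPolynomial.eval (c • p) F = c ^ n * MvPolynomial.eval p F := by
  rw [MvPolynomial.eval_eq, MvPolynomial.eval_eq, Finset.mul_sum]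
  refine Finset.sum_congr rfl fun d hd => ?_
  have hdeg : ∑ i ∈ d.support, d i = n :=
    (DFunLike.congr_fun Finsupp.degree_eq_weight_one d).trans
      (hF (MvPolynomial.mem_support_iff.mp hd))
  simp only [Pi.smul_apply, smul_eq_mul, mul_pow, Finset.prod_mul_distrib,
    Finset.prod_pow_eq_pow_sum, hdeg]
  ring

lemma eval_smul_eq_sum (F : MvPolynomial ι k) (p : ι → k) (c : k) :
    MvPolynomial.eval (c • p) F = ∑ i ∈ Finset.range (F.totalDegree + 1),
      c ^ i * MvPolynomial.eval p (MvPolynomial.homogeneousComponent i F) := by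
  conv_lhs => rw [← MvPolynomial.sum_homogeneousComponent F]
  rw [map_sum]
  exact Finset.sum_congr rfl fun i _ =>
    eval_smul_of_isHomogeneous (MvPolynomial.homogeneousComponent_isHomogeneous i F) p c

lemma eval_homogeneousComponent_eq_zero [Infinite k] {F : MvPolynomial ι k} {p : ι → k}
    (h : ∀ c : k, MvPolynomial.eval (c • p) F = 0) (i : ℕ) :
    MvPolynomial.eval p (MvPolynomial.homogeneousComponent i F) = 0 := by
  by_cases hi : i ∈ Finset.range (F.totalDegree + 1)
  · have hpoly : (∑ i ∈ Finset.range (F.totalDegree + 1), Polynomial.monomial i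
        (MvPolynomial.eval p (MvPolynomial.homogeneousComponent i F))) = 0 := by
      refine Polynomial.funext fun c => ?_
      rw [Polynomial.eval_zero, ← h c, eval_smul_eq_sum, Polynomial.eval_finsetSum]
      exact Finset.sum_congr rfl fun i _ => by rw [Polynomial.eval_monomial, mul_comm]
    have hcoeff := congrArg (fun q => Polynomial.coeff q i) hpoly
    simpa [Polynomial.finsetSum_coeff, Polynomial.coeff_monomial, hi] using hcoeff
  · rw [MvPolynomial.homogeneousComponent_eq_zero, map_zero]
    simpa using hi

end ZariskiClosed

/-! ### Projective varieties cut by a hyperplane -/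

section Cones

attribute [local instance] MvPolynomial.gradedAlgebra

variable {k : Type u} [Field k] {ι : Type}

/-- The closed subset of projective space cut out by the equations of a set of vectors. -/
def coneLocus (C : Set (ι → k)) : TopologicalSpace.Closeds (projSpace k ι) :=
  ⟨ProjectiveSpectrum.zeroLocus (MvPolynomial.homogeneousSubmodule ι k)
      {F | ∀ p ∈ C, MvPolynomial.eval p F = 0},
    ProjectiveSpectrum.isClosed_zeroLocus _ _⟩

lemma mem_coneLocus {C : Set (ι → k)} {x : projSpace k ι} : x ∈ coneLocus C ↔
    ∀ F : MvPolynomial ι k, (∀ p ∈ C, MvPolynomial.eval p F = 0) → F ∈ x.asHomogeneousIdeal :=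
  Iff.rfl

/-- The reduced closed subscheme of projective space with underlying set `coneLocus C`. -/
abbrev coneScheme (C : Set (ι → k)) : Scheme.{u} :=
  (Scheme.IdealSheafData.vanishingIdeal (coneLocus C)).subscheme

/-- The inclusion of `coneScheme C` into projective space. -/
abbrev coneι (C : Set (ι → k)) : coneScheme C ⟶ projSpace k ι :=
  (Scheme.IdealSheafData.vanishingIdeal (coneLocus C)).subschemeι

/-- The projective variety of a cone. -/
def coneVariety [Finite ι] (C : Set (ι → k)) : Variety k where
  toOver := Over.mk (coneι C ≫ projSpaceHom k _)
  locallyOfFiniteType := by dsimp; infer_instance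
  quasiCompact := by dsimp; infer_instance
  isSeparated := by dsimp; infer_instance

/-- A Zariski closed cone. -/
structure IsClosedCone (C : Set (ι → k)) : Prop where
  smul_mem : ∀ p ∈ C, ∀ c : k, c • p ∈ C
  isZariskiClosed : IsZariskiClosed C

lemma IsClosedCone.inter_zero {C : Set (ι → k)} (h : IsClosedCone C) (σ : ι) :
    IsClosedCone (C ∩ {p | p σ = 0}) where
  smul_mem p hp c := ⟨h.smul_mem p hp.1 c, by simp [show p σ = 0 from hp.2]⟩
  isZariskiClosed p hp := ⟨h.isZariskiClosed p fun F hF => hp F fun q hq => hF q hq.1, by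
    simpa using hp (MvPolynomial.X σ) fun q hq => by simpa using hq.2⟩

lemma IsZariskiClosed.inter_one {C : Set (ι → k)} (h : IsZariskiClosed C) (σ : ι) :
    IsZariskiClosed (C ∩ {p | p σ = 1}) := fun p hp =>
  ⟨h p fun F hF => hp F fun q hq => hF q hq.1, by
    have hX := hp (MvPolynomial.X σ - 1) fun q hq => by simpa [sub_eq_zero] using hq.2
    rwa [map_sub, MvPolynomial.eval_X, map_one, sub_eq_zero] at hX⟩

lemma mem_radical_of_eval_inter_zero [IsAlgClosed k] [Finite ι] {C : Set (ι → k)}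
    (hC : IsZariskiClosed C) (σ : ι) {F : MvPolynomial ι k}
    (hF : ∀ p ∈ C ∩ {p | p σ = 0}, MvPolynomial.eval p F = 0) :
    F ∈ (MvPolynomial.vanishingIdeal k C ⊔ Ideal.span {.X σ}).radical := by
  rw [← MvPolynomial.vanishingIdeal_zeroLocus_eq_radical (K := k)]
  intro p hp
  simp only [MvPolynomial.mem_zeroLocus_iff, MvPolynomial.aeval_eq_eval] at hp ⊢
  refine hF p ⟨hC p fun G hG => hp G (Ideal.mem_sup_left ?_), ?_⟩
  · simpa only [MvPolynomial.mem_vanishingIdeal_iff, MvPolynomial.aeval_eq_eval] using hG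
  · simpa using hp (.X σ) (Ideal.mem_sup_right (Ideal.mem_span_singleton_self _))

lemma coneLocus_inter_compl_basicOpen [IsAlgClosed k] [Finite ι] {C : Set (ι → k)}
    (hC : IsZariskiClosed C) (σ : ι) : (coneLocus C : Set (projSpace k ι)) ∩
      ((Proj.basicOpen (MvPolynomial.homogeneousSubmodule ι k) (MvPolynomial.X σ) :
        (projSpace k ι).Opens) : Set (projSpace k ι))ᶜ = coneLocus (C ∩ {p | p σ = 0}) := by
  ext x
  have hx : x ∈ ((Proj.basicOpen (MvPolynomial.homogeneousSubmodule ι k) (MvPolynomial.X σ) :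
        (projSpace k ι).Opens) : Set (projSpace k ι))ᶜ ↔
      MvPolynomial.X σ ∈ x.asHomogeneousIdeal := by
    rw [Set.mem_compl_iff, SetLike.mem_coe, Proj.mem_basicOpen, not_not]
  rw [Set.mem_inter_iff, hx, SetLike.mem_coe, SetLike.mem_coe, mem_coneLocus, mem_coneLocus]
  constructor
  · rintro ⟨hCx, hXx⟩ F hF
    have hle : MvPolynomial.vanishingIdeal k C ⊔ Ideal.span {.X σ} ≤
        x.asHomogeneousIdeal.toIdeal := by
      refine sup_le (fun F hF => hCx F ?_) ((Ideal.span_singleton_le_iff_mem _).mpr hXx)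
      simpa only [MvPolynomial.mem_vanishingIdeal_iff, MvPolynomial.aeval_eq_eval] using hF
    exact x.isPrime.radical_le_iff.mpr hle (mem_radical_of_eval_inter_zero hC σ hF)
  · exact fun h => ⟨fun F hF => h F fun p hp => hF p hp.1,
      h (.X σ) fun p hp => by simpa using hp.2⟩

end Cones

section ConeChart

attribute [local instance] MvPolynomial.gradedAlgebra

variable {k : Type u} [Field k] {ι : Type} (C : Set (ι → k)) (σ : ι)

lemma X_mem_homogeneousSubmodule (σ : ι) :
    (MvPolynomial.X σ : MvPolynomial ι k) ∈ MvPolynomial.homogeneousSubmodule ι k 1 :=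
  MvPolynomial.isHomogeneous_X k σ

/-- The coordinate ring of the affine chart `X_σ ≠ 0` of projective space. -/
abbrev ChartRing (k : Type u) [Field k] (σ : ι) : Type u :=
  HomogeneousLocalization.Away (MvPolynomial.homogeneousSubmodule ι k) (MvPolynomial.X σ)

/-- The fraction `F / X_σ ^ n`, where `F` is a form of degree `n`. -/
abbrev chartFraction (n : ℕ) (F : MvPolynomial ι k)
    (hF : F ∈ MvPolynomial.homogeneousSubmodule ι k n) : ChartRing k σ :=
  .mk _ (X_mem_homogeneousSubmodule σ) n F (by simpa using hF)

/-- The inclusion of the affine chart `X_σ ≠ 0` into projective space. -/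
abbrev chartι (k : Type u) [Field k] (σ : ι) : Spec (.of (ChartRing k σ)) ⟶ projSpace k ι :=
  Proj.awayι _ _ (X_mem_homogeneousSubmodule σ) one_pos

lemma exists_chartFraction_eq (z : ChartRing k σ) : ∃ n F hF, chartFraction σ n F hF = z := by
  obtain ⟨n, F, hF, rfl⟩ :=
    HomogeneousLocalization.Away.mk_surjective _ (X_mem_homogeneousSubmodule σ) z
  exact ⟨n, F, by simpa using hF, rfl⟩

lemma chartFraction_mul_X (n : ℕ) (F : MvPolynomial ι k) (hF) :
    chartFraction σ (n + 1) (F * .X σ)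
        (MvPolynomial.IsHomogeneous.mul hF (MvPolynomial.isHomogeneous_X k σ)) =
      chartFraction σ n F hF := by
  ext
  rw [HomogeneousLocalization.Away.val_mk, HomogeneousLocalization.Away.val_mk,
    Localization.mk_eq_mk_iff, Localization.r_iff_exists]
  exact ⟨1, by simp; ring⟩

lemma evalOn_X_eq_one : evalOn (C ∩ {p | p σ = 1}) (MvPolynomial.X σ) = 1 :=
  Subtype.ext (funext fun p => by rw [evalOn_apply]; simpa using p.2.2)

/-- Evaluation of fractions `F / X_σ ^ n` on the part of a cone where `X_σ = 1`. -/
def chartEval : ChartRing k σ →+* restrict (C ∩ {p | p σ = 1}) (coordinateAlgebra k ι) :=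
  (Localization.awayLift (evalOn (C ∩ {p | p σ = 1})).toRingHom (MvPolynomial.X σ)
    (by simp [evalOn_X_eq_one])).comp (algebraMap _ _)

lemma chartEval_chartFraction (n : ℕ) (F : MvPolynomial ι k) (hF) :
    chartEval C σ (chartFraction σ n F hF) = evalOn _ F := by
  rw [chartEval, RingHom.comp_apply, HomogeneousLocalization.algebraMap_apply,
    HomogeneousLocalization.Away.val_mk,
    Localization.awayLift_mk (v := 1) (hv := by simp [evalOn_X_eq_one])]
  simp

lemma chartEval_surjective : Function.Surjective (chartEval C σ) := by
  intro f
  obtain ⟨F, rfl⟩ := evalOn_surjective _ f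
  induction F using MvPolynomial.induction_on with
  | C a => exact ⟨_, chartEval_chartFraction C σ 0 (.C a) (MvPolynomial.isHomogeneous_C ι a)⟩
  | add p q hp hq =>
    obtain ⟨a, ha⟩ := hp
    obtain ⟨b, hb⟩ := hq
    exact ⟨a + b, by rw [map_add, map_add, ha, hb]⟩
  | mul_X p i hp =>
    obtain ⟨a, ha⟩ := hp
    exact ⟨a * chartFraction σ 1 (.X i) (X_mem_homogeneousSubmodule i),
      by rw [map_mul, map_mul, ha, chartEval_chartFraction]⟩

lemma chartEval_comp_algebraMap :
    (chartEval C σ).comp ((HomogeneousLocalization.fromZeroRingHom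
      (MvPolynomial.homogeneousSubmodule ι k) (Submonoid.powers (MvPolynomial.X σ))).comp
      (algebraMap k (MvPolynomial.homogeneousSubmodule ι k 0))) = algebraMap k _ := by
  ext a : 1
  have ha : HomogeneousLocalization.fromZeroRingHom
      (MvPolynomial.homogeneousSubmodule ι k) (Submonoid.powers (MvPolynomial.X σ))
      (algebraMap k (MvPolynomial.homogeneousSubmodule ι k 0) a) =
      chartFraction σ 0 (.C a) (MvPolynomial.isHomogeneous_C ι a) := by
    ext
    simp [HomogeneousLocalization.fromZeroRingHom]
    rfl
  rw [RingHom.comp_apply, RingHom.comp_apply, ha,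
    chartEval_chartFraction _ _ _ _ (MvPolynomial.isHomogeneous_C ι a)]
  exact (evalOn _).commutes a

lemma mem_chartι_iff {n : ℕ} (hn : 0 < n) {G : MvPolynomial ι k} (hG)
    (y : Spec (.of (ChartRing k σ))) :
    G ∈ (chartι k σ y).asHomogeneousIdeal ↔ chartFraction σ n G hG ∈ y.asIdeal := by
  have hmem : chartι k σ y ∈ Proj.basicOpen (MvPolynomial.homogeneousSubmodule ι k) G ↔
      y ∈ PrimeSpectrum.basicOpen (HomogeneousLocalization.Away.isLocalizationElem
        (X_mem_homogeneousSubmodule σ) hG) := by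
    rw [← Proj.awayι_preimage_basicOpen (MvPolynomial.homogeneousSubmodule ι k)
      (X_mem_homogeneousSubmodule σ) one_pos hG hn]
    rfl
  rw [Proj.mem_basicOpen] at hmem
  replace hmem := not_iff_not.mp (hmem.trans (PrimeSpectrum.mem_basicOpen _ _))
  rw [hmem]
  simp only [HomogeneousLocalization.Away.isLocalizationElem, pow_one]

variable {C σ}

lemma mem_asIdeal_of_chartEval_eq_zero (hC : ∀ p ∈ C, ∀ c : k, c • p ∈ C)
    {z : ChartRing k σ} (hz : chartEval C σ z = 0) {y : Spec (.of (ChartRing k σ))}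
    (hy : chartι k σ y ∈ coneLocus C) : z ∈ y.asIdeal := by
  obtain ⟨n, F, hF, rfl⟩ := exists_chartFraction_eq σ z
  rw [chartEval_chartFraction, evalOn_eq_zero_iff] at hz
  rw [← chartFraction_mul_X σ n F hF,
    ← mem_chartι_iff σ n.succ_pos (MvPolynomial.IsHomogeneous.mul hF
      (MvPolynomial.isHomogeneous_X k σ))]
  refine mem_coneLocus.mp hy _ fun p hp => ?_
  rw [map_mul, MvPolynomial.eval_X]
  by_cases hpσ : p σ = 0
  · rw [hpσ, mul_zero]
  · have hp' : (p σ)⁻¹ • p ∈ C ∩ {p | p σ = 1} := ⟨hC p hp _, by simp [hpσ]⟩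
    have hFp : MvPolynomial.eval p F = 0 := by
      simpa [eval_smul_of_isHomogeneous hF, hpσ] using hz _ hp'
    rw [hFp, zero_mul]

/-- The point of the chart `X_σ ≠ 0` with homogeneous coordinates `p`, where `p σ = 1`. -/
def chartPoint (p : ↥(C ∩ {p | p σ = 1})) : Spec (.of (ChartRing k σ)) :=
  ⟨RingHom.ker (((Pi.evalRingHom (fun _ => k) p).comp (Subalgebra.val _).toRingHom).comp
    (chartEval C σ)), RingHom.ker_isPrime _⟩

lemma chartFraction_mem_chartPoint_iff (p : ↥(C ∩ {p | p σ = 1})) {n : ℕ} {G : MvPolynomial ι k}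
    (hG) : chartFraction σ n G hG ∈ (chartPoint p).asIdeal ↔ MvPolynomial.eval p.1 G = 0 := by
  rw [← evalOn_apply, ← chartEval_chartFraction C σ n G hG]
  rfl

lemma chartι_chartPoint_mem_coneLocus [Infinite k] (hC : ∀ p ∈ C, ∀ c : k, c • p ∈ C)
    (p : ↥(C ∩ {p | p σ = 1})) : chartι k σ (chartPoint p) ∈ coneLocus C := by
  rw [mem_coneLocus]
  intro H hH
  have hcomp := eval_homogeneousComponent_eq_zero fun c => hH _ (hC _ p.2.1 c)
  rw [← MvPolynomial.sum_homogeneousComponent H]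
  refine Ideal.sum_mem (chartι k σ (chartPoint p)).asHomogeneousIdeal.toIdeal fun i _ => ?_
  rcases Nat.eq_zero_or_pos i with rfl | hi
  · have hzero := hcomp 0
    rw [MvPolynomial.homogeneousComponent_zero, MvPolynomial.eval_C] at hzero
    rw [MvPolynomial.homogeneousComponent_zero, hzero, map_zero]
    exact zero_mem _
  · exact (mem_chartι_iff σ hi (MvPolynomial.homogeneousComponent_isHomogeneous i H) _).mpr
      ((chartFraction_mem_chartPoint_iff p _).mpr (hcomp i))

lemma chartEval_eq_zero_iff [Infinite k] (hC : ∀ p ∈ C, ∀ c : k, c • p ∈ C) (z : ChartRing k σ) :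
    chartEval C σ z = 0 ↔
      ∀ y : Spec (.of (ChartRing k σ)), chartι k σ y ∈ coneLocus C → z ∈ y.asIdeal := by
  refine ⟨fun hz y hy => mem_asIdeal_of_chartEval_eq_zero hC hz hy, fun h => ?_⟩
  obtain ⟨n, F, hF, rfl⟩ := exists_chartFraction_eq σ z
  rw [chartEval_chartFraction, evalOn_eq_zero_iff]
  exact fun p hp => (chartFraction_mem_chartPoint_iff ⟨p, hp⟩ hF).mp
    (h _ (chartι_chartPoint_mem_coneLocus hC ⟨p, hp⟩))

end ConeChart

section ConeCut

attribute [local instance] MvPolynomial.gradedAlgebra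

variable {k : Type u} [Field k] {ι : Type}

lemma specMap_awayToSection_awayι {A : Type u} {τ : Type*} [CommRing A] [SetLike τ A]
    [AddSubgroupClass τ A] (𝒜 : ℕ → τ) [GradedRing 𝒜] (f : A) {m : ℕ} (hf : f ∈ 𝒜 m) (hm : 0 < m) :
    Spec.map (Proj.awayToSection 𝒜 f) ≫ Proj.awayι 𝒜 f hf hm =
      (Proj.isAffineOpen_basicOpen 𝒜 f hf hm).fromSpec := by
  rw [← cancel_epi (Proj.isAffineOpen_basicOpen 𝒜 f hf hm).isoSpec.hom, IsAffineOpen.isoSpec_hom,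
    ← Category.assoc]
  change Proj.basicOpenToSpec 𝒜 f ≫ (Proj.basicOpenIsoSpec 𝒜 f hf hm).inv ≫ _ = _
  rw [← Proj.basicOpenIsoSpec_hom 𝒜 f hf hm, Iso.hom_inv_id_assoc, IsAffineOpen.fromSpec,
    ← IsAffineOpen.isoSpec_hom (Proj.isAffineOpen_basicOpen 𝒜 f hf hm), Iso.hom_inv_id_assoc]

lemma exists_isOpenImmersion_coneScheme [Infinite k] {C : Set (ι → k)}
    (hC : ∀ p ∈ C, ∀ c : k, c • p ∈ C) (σ : ι) :
    ∃ j : Spec (.of (restrict (C ∩ {p | p σ = 1}) (coordinateAlgebra k ι))) ⟶ coneScheme C,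
      IsOpenImmersion j ∧ Set.range j = coneι C ⁻¹'
        (Proj.basicOpen (MvPolynomial.homogeneousSubmodule ι k) (MvPolynomial.X σ) :
          (projSpace k ι).Opens) ∧
      j ≫ coneι C = Spec.map (CommRingCat.ofHom (chartEval C σ)) ≫ chartι k σ :=
  exists_isOpenImmersion_subscheme_of_iso (coneLocus C)
    ⟨_, Proj.isAffineOpen_basicOpen (MvPolynomial.homogeneousSubmodule ι k) _
      (X_mem_homogeneousSubmodule σ) one_pos⟩
    (Proj.basicOpenIsoAway _ _ (X_mem_homogeneousSubmodule σ) one_pos) _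
    (by rw [Proj.basicOpenIsoAway_hom]; exact specMap_awayToSection_awayι ..)
    (CommRingCat.ofHom (chartEval C σ)) (chartEval_surjective C σ) (chartEval_eq_zero_iff hC)

lemma specMap_chartEval_projSpaceHom (C : Set (ι → k)) (σ : ι) :
    Spec.map (CommRingCat.ofHom (chartEval C σ)) ≫ chartι k σ ≫ projSpaceHom k ι =
    Spec.map (CommRingCat.ofHom (algebraMap k _)) := by
  rw [projSpaceHom, Proj.awayι_toSpecZero_assoc, ← Spec.map_comp, ← Spec.map_comp,
    ← CommRingCat.ofHom_comp, ← CommRingCat.ofHom_comp, chartEval_comp_algebraMap]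

theorem coneVariety_cls_eq_add [IsAlgClosed k] [Finite ι] {C : Set (ι → k)} (hC : IsClosedCone C)
    (σ : ι) : (coneVariety C).cls = (coneVariety (C ∩ {p | p σ = 0})).cls +
      pieceClass (C ∩ {p | p σ = 1}) (coordinateAlgebra k ι) := by
  have hfg : (restrict (C ∩ {p | p σ = 1}) (coordinateAlgebra k ι)).FG :=
    coordinateAlgebra_fg.map _
  have := finiteType_of_fg hfg
  rw [pieceClass, spectrumClass_eq hfg]
  have hcut := coneLocus_inter_compl_basicOpen hC.isZariskiClosed σ
  have hle : coneLocus (C ∩ {p | p σ = 0}) ≤ coneLocus C := by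
    rw [← SetLike.coe_subset_coe, ← hcut]
    exact Set.inter_subset_left
  obtain ⟨j, hj, hrange, hjι⟩ := exists_isOpenImmersion_coneScheme hC.smul_mem σ
  let i : coneScheme (C ∩ {p | p σ = 0}) ⟶ coneScheme C :=
    Scheme.IdealSheafData.inclusion (Scheme.IdealSheafData.vanishingIdeal_antimono hle)
  have hiι : i ≫ coneι C = coneι (C ∩ {p | p σ = 0}) :=
    Scheme.IdealSheafData.inclusion_subschemeι _
  have hi : IsClosedImmersion i :=
    haveI : IsClosedImmersion (i ≫ coneι C) := by rw [hiι]; infer_instance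
    IsClosedImmersion.of_comp _ (coneι C)
  have hi_over : i ≫ (coneVariety C).toOver.hom =
      (coneVariety (C ∩ {p | p σ = 0})).toOver.hom := by
    simp only [coneVariety, Over.mk_hom, ← hiι, Category.assoc]
  have hj_over : j ≫ (coneVariety C).toOver.hom = (affineVariety k _).toOver.hom := by
    simp only [coneVariety, Over.mk_hom, reassoc_of% hjι]
    exact specMap_chartEval_projSpaceHom C σ
  exact cls_eq_add_of_isCompl (Over.homMk i hi_over) (Over.homMk j hj_over) hi hj
    (hrange ▸ isCompl_range_inclusion hle _ hcut)

end ConeCut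

/-! ### Normalized homogeneous coordinates -/

section NormalizedVectors

variable {k : Type*} [Field k] {ι : Type*}

/-- Vectors whose first nonzero coordinate, in the order of the list, is `1`. -/
def normalizedSet (k : Type*) [Field k] : List ι → Set (ι → k)
  | [] => ∅
  | σ :: l => {p | p σ = 1} ∪ ({p | p σ = 0} ∩ normalizedSet k l)

open Classical in
/-- The multiple of a vector whose first nonzero coordinate, in the order of the list, is `1`. -/
def normalizedVec : List ι → (ι → k) → ι → k
  | [], p => p
  | σ :: l, p => if p σ = 0 then normalizedVec l p else (p σ)⁻¹ • p

lemma normalizedVec_mem_normalizedSet {l : List ι} {p : ι → k} (h : ∃ σ ∈ l, p σ ≠ 0) :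
    normalizedVec l p ∈ normalizedSet k l ∧ ∃ c : k, c ≠ 0 ∧ normalizedVec l p = c • p := by
  induction l with
  | nil => simp at h
  | cons σ l ih =>
    by_cases hσ : p σ = 0
    · obtain ⟨hmem, c, hc, hp⟩ := ih (by simpa [hσ] using h)
      rw [normalizedVec, if_pos hσ]
      exact ⟨Or.inr ⟨by simp [hp, hσ], hmem⟩, c, hc, hp⟩
    · rw [normalizedVec, if_neg hσ]
      exact ⟨Or.inl (by simp [hσ]), _, inv_ne_zero hσ, rfl⟩

lemma normalizedVec_smul_of_mem {l : List ι} {p : ι → k} (h : p ∈ normalizedSet k l) {c : k}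
    (hc : c ≠ 0) : normalizedVec l (c • p) = p := by
  induction l with
  | nil => exact h.elim
  | cons σ l ih =>
    rcases h with (h : p σ = 1) | ⟨(h : p σ = 0), hl⟩
    · rw [normalizedVec, if_neg (by simp [h, hc])]
      simp [h, hc, smul_smul]
    · rw [normalizedVec, if_pos (by simp [h]), ih hl]

lemma normalizedVec_eq_self {l : List ι} {p : ι → k} (h : p ∈ normalizedSet k l) :
    normalizedVec l p = p := by
  simpa using normalizedVec_smul_of_mem h one_ne_zero

lemma normalizedVec_smul {l : List ι} {p : ι → k} (h : ∃ σ ∈ l, p σ ≠ 0) {c : k} (hc : c ≠ 0) :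
    normalizedVec l (c • p) = normalizedVec l p := by
  obtain ⟨hmem, a, ha, hp⟩ := normalizedVec_mem_normalizedSet h
  have hcp : c • p = (c * a⁻¹) • normalizedVec l p := by
    rw [hp, smul_smul, inv_mul_cancel_right₀ ha]
  rw [hcp, normalizedVec_smul_of_mem hmem (mul_ne_zero hc (inv_ne_zero ha))]

lemma ne_zero_of_mem_normalizedSet {l : List ι} {p : ι → k} (h : p ∈ normalizedSet k l) :
    p ≠ 0 := by
  rintro rfl
  induction l with
  | nil => exact h
  | cons σ l ih => exact h.elim (fun h => zero_ne_one h) fun h => ih h.2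

variable {Ω : Type*} {T : Subalgebra k (Ω → k)}

open Classical in
lemma ite_mem_of_inv_mem (hT : ∀ f ∈ T, f⁻¹ ∈ T) {g f₁ f₂ : Ω → k} (hg : g ∈ T) (h₁ : f₁ ∈ T)
    (h₂ : f₂ ∈ T) : (fun x => if g x = 0 then f₁ x else f₂ x) ∈ T := by
  have hite : (fun x => if g x = 0 then f₁ x else f₂ x) =
      (1 - g * g⁻¹) * f₁ + g * g⁻¹ * f₂ := by
    ext x
    by_cases h : g x = 0 <;> simp [h]
  rw [hite]
  exact add_mem (mul_mem (sub_mem (one_mem T) (mul_mem hg (hT g hg))) h₁)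
    (mul_mem (mul_mem hg (hT g hg)) h₂)

lemma normalizedVec_mem (hT : ∀ f ∈ T, f⁻¹ ∈ T) (l : List ι) {p : Ω → ι → k}
    (hp : ∀ i, (fun x => p x i) ∈ T) (i : ι) : (fun x => normalizedVec l (p x) i) ∈ T := by
  classical
  induction l with
  | nil => exact hp i
  | cons σ l ih =>
    have hcons : (fun x => normalizedVec (σ :: l) (p x) i) =
        fun x => if p x σ = 0 then normalizedVec l (p x) i
          else (fun x => p x σ)⁻¹ x * p x i := by
      ext x
      by_cases h : p x σ = 0 <;> simp [normalizedVec, h]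
    rw [hcons]
    exact ite_mem_of_inv_mem hT (hp σ) ih (mul_mem (hT _ (hp σ)) (hp i))

end NormalizedVectors

section ConeClass

variable {k : Type u} [Field k] {ι : Type}

lemma IsZariskiClosed.isClopenFor_invClosure [Finite ι] {C : Set (ι → k)}
    (hC : IsZariskiClosed C) : IsClopenFor (invClosure (coordinateAlgebra k ι)) C := by
  obtain ⟨s, hs⟩ := (isNoetherianRing_iff_ideal_fg (MvPolynomial ι k)).mp inferInstance
    (MvPolynomial.vanishingIdeal k C)
  have hmem (F : MvPolynomial ι k) : F ∈ Ideal.span (s : Set (MvPolynomial ι k)) ↔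
      ∀ p ∈ C, MvPolynomial.eval p F = 0 := by
    simp [hs, MvPolynomial.mem_vanishingIdeal_iff, MvPolynomial.aeval_eq_eval]
  have hinter : C = ⋂ F ∈ s, {p | MvPolynomial.eval p F = 0} := by
    refine Set.Subset.antisymm (Set.subset_iInter₂ fun F hF p hp =>
      (hmem F).mp (Ideal.subset_span hF) p hp) fun p hp => hC p fun F hF => ?_
    have hle : Ideal.span (s : Set (MvPolynomial ι k)) ≤ RingHom.ker (MvPolynomial.eval p) :=
      Ideal.span_le.mpr fun G hG => Set.mem_iInter₂.mp hp G hG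
    exact hle ((hmem F).mpr hF)
  rw [hinter]
  refine IsClopenFor.biInter s fun F _ => ?_
  have hF := le_invClosure _ (eval_mem_coordinateAlgebra F)
  exact IsClopenFor.eq_zero hF (inv_mem_invClosure hF)

attribute [local instance] MvPolynomial.gradedAlgebra in
lemma coneVariety_cls_eq_zero [Finite ι] {C : Set (ι → k)} (hC : C ⊆ {0}) :
    (coneVariety C).cls = 0 := by
  refine cls_eq_zero_of_isEmpty ⟨fun y => ?_⟩
  set x := coneι C y
  have hx : x ∈ (coneLocus C : Set (projSpace k ι)) := by
    rw [← Scheme.IdealSheafData.coe_support_vanishingIdeal,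
      ← Scheme.IdealSheafData.range_subschemeι]
    exact ⟨y, rfl⟩
  refine x.not_irrelevant_le fun F hF => hx fun p hp => ?_
  have hproj : GradedRing.proj (MvPolynomial.homogeneousSubmodule ι k) 0 F = 0 := hF
  have hF0 : MvPolynomial.homogeneousComponent 0 F = 0 := by
    rw [← hproj, GradedRing.proj_apply]
    exact (MvPolynomial.decomposition.decompose'_apply F 0).symm
  rw [MvPolynomial.homogeneousComponent_zero] at hF0
  rw [hC hp, MvPolynomial.eval_zero]
  simpa [MvPolynomial.constantCoeff_eq] using hF0

theorem hasClass_coneVariety [IsAlgClosed k] [Finite ι] (l : List ι) {C : Set (ι → k)}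
    (hC : IsClosedCone C) (hl : ∀ p ∈ C, (∀ σ ∈ l, p σ = 0) → p = 0) :
    HasClass (coordinateAlgebra k ι) (C ∩ normalizedSet k l) (coneVariety C).cls := by
  induction l generalizing C with
  | nil =>
    rw [coneVariety_cls_eq_zero fun p hp => hl p hp (by simp), normalizedSet, Set.inter_empty]
    exact HasClass.empty _
  | cons σ l ih =>
    have hzero := ih (hC.inter_zero σ) fun p hp h => hl p hp.1 (List.forall_mem_cons.mpr ⟨hp.2, h⟩)
    have hclosed := hC.isZariskiClosed.inter_one σ
    have hone := HasClass.of_isAffinePiece hclosed.isAffinePiece hclosed.isClopenFor_invClosure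
    have hdisj : Disjoint (C ∩ {p | p σ = 0} ∩ normalizedSet k l) (C ∩ {p | p σ = 1}) :=
      Set.disjoint_left.mpr fun p hp hp' => zero_ne_one (hp.1.2.symm.trans hp'.2)
    rw [coneVariety_cls_eq_add hC σ, normalizedSet, Set.inter_union_distrib_left, Set.union_comm,
      ← Set.inter_assoc]
    exact hzero.add hone hdisj

end ConeClass

/-! ### Plücker coordinates -/

section AlternatingForms

variable {k : Type*} [Field k] {V : Type*} [AddCommGroup V] [Module k V] {d : ℕ}
  {J : Submodule k V} {ω : V [⋀^Fin d]→ₗ[k] k}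

/-- An alternating form on `V` that comes from the quotient `V ⧸ J`, i.e. vanishes whenever one of
its arguments is in `J`. -/
def IsFormModulo (J : Submodule k V) (ω : V [⋀^Fin d]→ₗ[k] k) : Prop :=
  ∀ v : Fin d → V, (∃ i, v i ∈ J) → ω v = 0

namespace IsFormModulo

lemma map_update_eq (h : IsFormModulo J ω) (v : Fin d → V) (i : Fin d) {x y : V}
    (hxy : x - y ∈ J) : ω (Function.update v i x) = ω (Function.update v i y) := by
  rw [← sub_eq_zero, ← ω.map_update_sub]
  exact h _ ⟨i, by simpa using hxy⟩

lemma map_eq_of_sub_mem (h : IsFormModulo J ω) {v w : Fin d → V} (hvw : ∀ i, v i - w i ∈ J) :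
    ω v = ω w := by
  classical
  have hpiecewise (s : Finset (Fin d)) : ω (s.piecewise v w) = ω w := by
    induction s using Finset.induction_on with
    | empty => simp
    | insert i s hi ih =>
      rw [Finset.piecewise_insert, h.map_update_eq _ i (hvw i), ← ih]
      congr 1
      rw [Function.update_eq_self_iff, Finset.piecewise_eq_of_notMem _ _ _ hi]
  simpa using hpiecewise Finset.univ

lemma exists_descend (h : IsFormModulo J ω) :
    ∃ η : (V ⧸ J) [⋀^Fin d]→ₗ[k] k, ∀ v, ω v = η fun i => J.mkQ (v i) := by
  obtain ⟨s, hs⟩ := J.mkQ.exists_rightInverse_of_surjective J.range_mkQ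
  refine ⟨ω.compLinearMap s, fun v => h.map_eq_of_sub_mem fun i => ?_⟩
  rw [← Submodule.Quotient.mk_eq_zero, Submodule.Quotient.mk_sub, sub_eq_zero]
  exact (DFunLike.congr_fun hs (J.mkQ (v i))).symm

lemma map_update_sum (h : IsFormModulo J ω) {b : Fin d → V} {x : V} {c : Fin d → k}
    (hx : x - ∑ j, c j • b j ∈ J) (i : Fin d) : ω (Function.update b i x) = c i * ω b := by
  classical
  rw [h.map_update_eq b i hx, ω.map_update_sum, Finset.sum_eq_single i]
  · rw [ω.map_update_smul, Function.update_eq_self, smul_eq_mul]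
  · intro j _ hj
    rw [ω.map_update_smul, ω.map_update_self _ hj.symm, smul_zero]
  · simp

lemma map_update_eq_repr_mul (h : IsFormModulo J ω) {b : Fin d → V}
    (B : Module.Basis (Fin d) k (V ⧸ J)) (hB : ∀ i, B i = J.mkQ (b i)) (x : V) (i : Fin d) :
    ω (Function.update b i x) = B.repr (J.mkQ x) i * ω b := by
  refine h.map_update_sum (c := fun i => B.repr (J.mkQ x) i) ?_ i
  rw [← Submodule.Quotient.mk_eq_zero, ← Submodule.mkQ_apply, map_sub, map_sum, sub_eq_zero]
  conv_lhs => rw [← B.sum_repr (J.mkQ x)]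
  exact Finset.sum_congr rfl fun j _ => by rw [map_smul, hB]

variable [Module.Finite k (V ⧸ J)]

lemma mul_eq_mul (hJ : Module.finrank k (V ⧸ J) = d) {ω₁ ω₂ : V [⋀^Fin d]→ₗ[k] k}
    (h₁ : IsFormModulo J ω₁) (h₂ : IsFormModulo J ω₂) (v b : Fin d → V) :
    ω₂ v * ω₁ b = ω₁ v * ω₂ b := by
  obtain ⟨η₁, e₁⟩ := h₁.exists_descend
  obtain ⟨η₂, e₂⟩ := h₂.exists_descend
  let B := (Module.finBasis k (V ⧸ J)).reindex (finCongr hJ)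
  rw [e₁, e₁, e₂, e₂, η₁.eq_smul_basis_det B, η₂.eq_smul_basis_det B]
  simp only [AlternatingMap.smul_apply, smul_eq_mul]
  ring

lemma exists_basis (hJ : Module.finrank k (V ⧸ J) = d) (h : IsFormModulo J ω) {b : Fin d → V}
    (hb : ω b ≠ 0) : ∃ B : Module.Basis (Fin d) k (V ⧸ J), ∀ i, B i = J.mkQ (b i) := by
  obtain ⟨η, e⟩ := h.exists_descend
  have hli : LinearIndependent k fun i => J.mkQ (b i) := by
    by_contra hli
    exact hb ((e b).trans (η.map_linearDependent _ hli))
  refine ⟨Module.Basis.mk hli ?_, fun i => Module.Basis.mk_apply ..⟩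
  rw [hli.span_eq_top_of_card_eq_finrank' (by simp [hJ])]

lemma mem_iff (hJ : Module.finrank k (V ⧸ J) = d) (h : IsFormModulo J ω) {b : Fin d → V}
    (hb : ω b ≠ 0) (x : V) : x ∈ J ↔ ∀ i, ω (Function.update b i x) = 0 := by
  obtain ⟨B, hB⟩ := h.exists_basis hJ hb
  refine ⟨fun hx i => h _ ⟨i, by simpa using hx⟩, fun hx => ?_⟩
  rw [← Submodule.Quotient.mk_eq_zero, ← Submodule.mkQ_apply, ← B.repr.map_eq_zero_iff]
  ext i
  simpa [h.map_update_eq_repr_mul B hB, hb] using hx i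

lemma mul_pow_eq (hJ : Module.finrank k (V ⧸ J) = d) (h : IsFormModulo J ω) {b : Fin d → V}
    (hb : ω b ≠ 0) (v : Fin d → V) :
    ω v * ω b ^ d = ω b * Matrix.det (Matrix.of fun i j => ω (Function.update b i (v j))) := by
  obtain ⟨B, hB⟩ := h.exists_basis hJ hb
  obtain ⟨η, e⟩ := h.exists_descend
  have hmatrix : Matrix.of (fun i j => ω (Function.update b i (v j))) =
      ω b • B.toMatrix fun j => J.mkQ (v j) := by
    ext i j
    rw [Matrix.of_apply, h.map_update_eq_repr_mul B hB, Matrix.smul_apply,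
      Module.Basis.toMatrix_apply, smul_eq_mul, mul_comm]
  have hη : η B = ω b := by
    rw [e]; congr 1; exact funext hB
  rw [hmatrix, Matrix.det_smul, e v, η.eq_smul_basis_det B, AlternatingMap.smul_apply, hη,
    Module.Basis.det_apply, smul_eq_mul, Fintype.card_fin]
  ring

end IsFormModulo

end AlternatingForms

section PluckerVectors

variable {k : Type*} [Field k] {V : Type*} [AddCommGroup V] [Module k V] {d n : ℕ}
  {J : Submodule k V} (e : Module.Basis (Fin n) k V)

/-- A vector of Plücker coordinates of the quotient by `J` with respect to the basis `e`: the values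
at the tuples of basis vectors of an alternating form on `V ⧸ J`. The zero vector is allowed. -/
def IsPluckerVector (J : Submodule k V) (p : (Fin d → Fin n) → k) : Prop :=
  ∃ ω : V [⋀^Fin d]→ₗ[k] k, IsFormModulo J ω ∧ p = fun σ => ω fun i => e (σ i)

/-- The quotient map by the subspace with Plücker coordinates `p`, in the chart `p σ ≠ 0` of the
Grassmannian and up to the factor `p σ`. -/
def chartMap (p : (Fin d → Fin n) → k) (σ : Fin d → Fin n) : V →ₗ[k] (Fin d → k) :=
  e.constr k fun j i => p (Function.update σ i j)

/-- Spanning vectors of the subspace with Plücker coordinates `p`, in the chart `p σ ≠ 0`. -/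
def chartSpan (p : (Fin d → Fin n) → k) (σ : Fin d → Fin n) (j : Fin n) : V :=
  p σ • e j - ∑ i, p (Function.update σ i j) • e (σ i)

@[simp] lemma chartMap_basis (p : (Fin d → Fin n) → k) (σ : Fin d → Fin n) (j : Fin n)
    (i : Fin d) : chartMap e p σ (e j) i = p (Function.update σ i j) := by
  rw [chartMap, Module.Basis.constr_basis]

lemma chartMap_apply (ω : V [⋀^Fin d]→ₗ[k] k) (σ : Fin d → Fin n) (x : V) (i : Fin d) :
    chartMap e (fun σ => ω fun i => e (σ i)) σ x i =
      ω (Function.update (fun i => e (σ i)) i x) := by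
  have hlin : (LinearMap.proj i).comp (chartMap e (fun σ => ω fun i => e (σ i)) σ) =
      ω.toMultilinearMap.toLinearMap (fun i => e (σ i)) i := by
    refine e.ext fun j => ?_
    rw [LinearMap.comp_apply, LinearMap.proj_apply, chartMap_basis]
    exact congrArg ω (Function.comp_update e σ i j)
  exact DFunLike.congr_fun hlin x

lemma chartMap_eq_sum (p : (Fin d → Fin n) → k) (σ : Fin d → Fin n) (x : V) (i : Fin d) :
    chartMap e p σ x i = ∑ j, e.repr x j * p (Function.update σ i j) := by
  conv_lhs => rw [← e.sum_repr x, map_sum, Finset.sum_apply]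
  simp

lemma det_chartMap (p : (Fin d → Fin n) → k) (σ τ : Fin d → Fin n) :
    Matrix.detRowAlternating (fun i => chartMap e p σ (e (τ i))) =
      Matrix.det (Matrix.of fun i j => p (Function.update σ i (τ j))) := by
  rw [← Matrix.det_transpose (Matrix.of _)]
  congr 1
  ext i j
  simp

lemma smul_eq_sum_chartSpan (p : (Fin d → Fin n) → k) (σ : Fin d → Fin n) (x : V) :
    p σ • x = ∑ j, e.repr x j • chartSpan e p σ j + ∑ i, chartMap e p σ x i • e (σ i) := by
  simp only [chartMap_eq_sum, chartSpan, smul_sub, Finset.sum_sub_distrib, Finset.sum_smul,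
    Finset.smul_sum]
  rw [Finset.sum_comm (f := fun i j => (e.repr x j * p (Function.update σ i j)) • e (σ i))]
  simp only [mul_smul, sub_add_cancel]
  conv_lhs => rw [← e.sum_repr x, Finset.smul_sum]
  exact Finset.sum_congr rfl fun j _ => smul_comm _ _ _

variable {e}

lemma smul_eq_sum_chartSpan_of_chartMap_eq_zero {p : (Fin d → Fin n) → k} {σ : Fin d → Fin n}
    {x : V} (hx : chartMap e p σ x = 0) : p σ • x = ∑ j, e.repr x j • chartSpan e p σ j := by
  simpa [hx] using smul_eq_sum_chartSpan e p σ x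

lemma surjective_chartMap {p : (Fin d → Fin n) → k} {σ : Fin d → Fin n}
    (hσ : Matrix.det (Matrix.of fun i j => p (Function.update σ i (σ j))) ≠ 0) :
    Function.Surjective (chartMap e p σ) := by
  rw [← det_chartMap e] at hσ
  have hli : LinearIndependent k fun i => chartMap e p σ (e (σ i)) :=
    Matrix.linearIndependent_rows_of_det_ne_zero hσ
  rw [← LinearMap.range_eq_top, eq_top_iff, ← hli.span_eq_top_of_card_eq_finrank' (by simp),
    Submodule.span_le]
  rintro _ ⟨i, rfl⟩
  exact ⟨_, rfl⟩

lemma isPluckerVector_of_mul_pow_eq {p : (Fin d → Fin n) → k} {σ : Fin d → Fin n} (hσ : p σ ≠ 0)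
    (h : ∀ τ : Fin d → Fin n, p τ * p σ ^ d =
      p σ * Matrix.det (Matrix.of fun i j => p (Function.update σ i (τ j)))) :
    Module.finrank k (V ⧸ LinearMap.ker (chartMap e p σ)) = d ∧
      IsPluckerVector e (LinearMap.ker (chartMap e p σ)) p := by
  refine ⟨?_, (p σ / p σ ^ d) • Matrix.detRowAlternating.compLinearMap (chartMap e p σ),
    fun v ⟨i, hi⟩ => ?_, ?_⟩
  · have hdet : Matrix.det (Matrix.of fun i j => p (Function.update σ i (σ j))) ≠ 0 :=
      right_ne_zero_of_mul (h σ ▸ mul_ne_zero hσ (pow_ne_zero d hσ))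
    rw [(LinearMap.quotKerEquivOfSurjective _ (surjective_chartMap hdet)).finrank_eq]
    simp
  · rw [AlternatingMap.smul_apply, AlternatingMap.compLinearMap_apply,
      AlternatingMap.map_coord_zero (m := fun i => chartMap e p σ (v i)) _ i
        (LinearMap.mem_ker.mp hi), smul_zero]
  · ext τ
    rw [AlternatingMap.smul_apply, AlternatingMap.compLinearMap_apply, det_chartMap, smul_eq_mul,
      div_mul_eq_mul_div, ← h, mul_div_cancel_right₀ _ (pow_ne_zero d hσ)]

lemma exists_isPluckerVector [Module.Finite k (V ⧸ J)] (hJ : Module.finrank k (V ⧸ J) = d) :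
    ∃ p : (Fin d → Fin n) → k, IsPluckerVector e J p ∧ p ≠ 0 := by
  let B := (Module.finBasis k (V ⧸ J)).reindex (finCongr hJ)
  let ω : V [⋀^Fin d]→ₗ[k] k := B.det.compLinearMap J.mkQ
  refine ⟨_, ⟨ω, fun v ⟨i, hi⟩ => ?_, rfl⟩, fun h0 => ?_⟩
  · exact B.det.map_coord_zero i ((Submodule.Quotient.mk_eq_zero J).mpr hi)
  · have hω : ω = 0 := e.ext_alternating fun v _ => congrFun h0 v
    have hone : ω (fun i => Function.surjInv J.mkQ_surjective (B i)) = 1 := by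
      change B.det (fun i => J.mkQ _) = 1
      simp only [Function.surjInv_eq]
      exact B.det_self
    simp [hω] at hone

namespace IsPluckerVector

variable {p : (Fin d → Fin n) → k}

lemma smul (hp : IsPluckerVector e J p) (c : k) : IsPluckerVector e J (c • p) := by
  obtain ⟨ω, h, rfl⟩ := hp
  exact ⟨c • ω, fun v hv => by simp [h v hv], rfl⟩

lemma apply_update_apply (hp : IsPluckerVector e J p) (σ : Fin d → Fin n) (i i' : Fin d) :
    p (Function.update σ i' (σ i)) = if i = i' then p σ else 0 := by
  obtain ⟨ω, -, rfl⟩ := hp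
  split_ifs with hi
  · subst hi; simp
  · refine ω.map_eq_zero_of_eq _ (i := i) (j := i') ?_ hi
    simp [Function.update_of_ne hi]

variable [Module.Finite k (V ⧸ J)]

lemma exists_smul (hJ : Module.finrank k (V ⧸ J) = d) {p' : (Fin d → Fin n) → k}
    (hp : IsPluckerVector e J p) (hp' : IsPluckerVector e J p') (h0 : p ≠ 0) (h0' : p' ≠ 0) :
    ∃ c : k, c ≠ 0 ∧ p' = c • p := by
  obtain ⟨σ, hσ⟩ := Function.ne_iff.mp h0
  obtain ⟨ω, h, hpω⟩ := hp
  obtain ⟨ω', h', hpω'⟩ := hp'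
  have hsmul : p' = (p' σ / p σ) • p := by
    ext τ
    have hmul : p' τ * p σ = p τ * p' σ := by
      rw [hpω, hpω']
      exact h.mul_eq_mul hJ h' _ _
    rw [Pi.smul_apply, smul_eq_mul, div_mul_eq_mul_div, eq_div_iff hσ, hmul, mul_comm]
  refine ⟨_, fun hc => h0' ?_, hsmul⟩
  rw [hsmul, hc, zero_smul]

variable {σ : Fin d → Fin n}

lemma ker_chartMap (hJ : Module.finrank k (V ⧸ J) = d) (hp : IsPluckerVector e J p)
    (hσ : p σ ≠ 0) : LinearMap.ker (chartMap e p σ) = J := by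
  obtain ⟨ω, h, rfl⟩ := hp
  ext x
  rw [LinearMap.mem_ker, h.mem_iff hJ hσ, funext_iff]
  simp only [chartMap_apply, Pi.zero_apply]

lemma mul_pow_eq (hJ : Module.finrank k (V ⧸ J) = d) (hp : IsPluckerVector e J p)
    (hσ : p σ ≠ 0) (τ : Fin d → Fin n) :
    p τ * p σ ^ d = p σ * Matrix.det (Matrix.of fun i j => p (Function.update σ i (τ j))) := by
  obtain ⟨ω, h, rfl⟩ := hp
  rw [h.mul_pow_eq hJ hσ]
  congr 3
  ext i j
  exact congrArg ω (Function.comp_update e σ i (τ j)).symm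

lemma chartSpan_mem (hJ : Module.finrank k (V ⧸ J) = d) (hp : IsPluckerVector e J p)
    (hσ : p σ ≠ 0) (j : Fin n) : chartSpan e p σ j ∈ J := by
  rw [← hp.ker_chartMap hJ hσ, LinearMap.mem_ker]
  ext i
  rw [chartSpan, map_sub, map_sum]
  simp only [map_smul, Pi.sub_apply, Pi.smul_apply, chartMap_basis, Finset.sum_apply, smul_eq_mul,
    Pi.zero_apply, hp.apply_update_apply]
  simp [mul_comm]

lemma span_chartSpan (hJ : Module.finrank k (V ⧸ J) = d) (hp : IsPluckerVector e J p)
    (hσ : p σ ≠ 0) : Submodule.span k (Set.range (chartSpan e p σ)) = J := by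
  refine le_antisymm (Submodule.span_le.mpr ?_) fun x hx => ?_
  · rintro _ ⟨j, rfl⟩
    exact hp.chartSpan_mem hJ hσ j
  · rw [← hp.ker_chartMap hJ hσ, LinearMap.mem_ker] at hx
    rw [← Submodule.smul_mem_iff _ hσ, smul_eq_sum_chartSpan_of_chartMap_eq_zero hx]
    exact Submodule.sum_mem _ fun j _ => Submodule.smul_mem _ _ (Submodule.subset_span ⟨j, rfl⟩)

end IsPluckerVector

end PluckerVectors

section PluckerCone

variable {k : Type u} [Field k] {A : Type u} [CommRing A] [Algebra k A] {d : ℕ}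

lemma finrank_quotient_restrictScalars (J : Ideal A) :
    Module.finrank k (A ⧸ J.restrictScalars k) = Module.finrank k (A ⧸ J) :=
  (Submodule.Quotient.restrictScalarsEquiv k J).finrank_eq

lemma mem_pluckerCone [Module.Finite k A] {p : PluckerIndex k A d → k} : p ∈ pluckerCone k A d ↔
    ∃ J : Ideal A, Module.finrank k (A ⧸ J.restrictScalars k) = d ∧
      IsPluckerVector (Module.finBasis k A) (J.restrictScalars k) p := by
  simp only [finrank_quotient_restrictScalars]
  rfl

lemma eval_eq_zero_of_forall_apply_ne_zero {ι : Type*} {C : Set (ι → k)} {p : ι → k}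
    (hp : ∀ F : MvPolynomial ι k, (∀ q ∈ C, MvPolynomial.eval q F = 0) →
      MvPolynomial.eval p F = 0) {σ : ι} (hσ : p σ ≠ 0) (F : MvPolynomial ι k)
    (hF : ∀ q ∈ C, q σ ≠ 0 → MvPolynomial.eval q F = 0) : MvPolynomial.eval p F = 0 := by
  have hXF : MvPolynomial.eval p (.X σ * F) = 0 := hp _ fun q hq => by
    rw [map_mul, MvPolynomial.eval_X, mul_eq_zero, or_iff_not_imp_left]
    exact hF q hq
  rw [map_mul, MvPolynomial.eval_X] at hXF
  exact (mul_eq_zero_iff_left hσ).mp hXF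

section Chart

variable {n : ℕ} (e : Module.Basis (Fin n) k A)

/-- The determinantal relation of `IsPluckerVector.mul_pow_eq`, as a polynomial in the Plücker
coordinates. -/
def detRelation (k : Type u) [Field k] (σ τ : Fin d → Fin n) :
    MvPolynomial (Fin d → Fin n) k :=
  .X τ * .X σ ^ d - .X σ * Matrix.det (Matrix.of fun i j => .X (Function.update σ i (τ j)))

lemma eval_detRelation (σ τ : Fin d → Fin n) (p : (Fin d → Fin n) → k) :
    MvPolynomial.eval p (detRelation k σ τ) = p τ * p σ ^ d -
      p σ * Matrix.det (Matrix.of fun i j => p (Function.update σ i (τ j))) := by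
  simp only [detRelation, map_mul, map_sub, map_pow, MvPolynomial.eval_X, RingHom.map_det]
  congr 3
  ext i j
  simp

/-- The relation expressing that multiplication by `e l` maps the spanning vector of index `j` into
the subspace, as a polynomial in the Plücker coordinates; see `eval_idealRelation`. -/
def idealRelation (σ : Fin d → Fin n) (l j : Fin n) (m : Fin d) :
    MvPolynomial (Fin d → Fin n) k :=
  let M (y : A) : MvPolynomial (Fin d → Fin n) k :=
    ∑ r, .C (e.repr y r) * .X (Function.update σ m r)
  .X σ * M (e l * e j) - ∑ i, .X (Function.update σ i j) * M (e l * e (σ i))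

lemma eval_idealRelation (σ : Fin d → Fin n) (l j : Fin n) (m : Fin d)
    (p : (Fin d → Fin n) → k) : MvPolynomial.eval p (idealRelation e σ l j m) =
      chartMap e p σ (e l * chartSpan e p σ j) m := by
  simp only [idealRelation, map_sub, map_mul, map_sum, MvPolynomial.eval_X, MvPolynomial.eval_C,
    ← chartMap_eq_sum]
  simp only [chartSpan, mul_sub, Finset.mul_sum, mul_smul_comm, map_sub, map_sum, map_smul,
    Pi.sub_apply, Finset.sum_apply, Pi.smul_apply, smul_eq_mul]

variable {e}

lemma mul_mem_ker_chartMap {p : (Fin d → Fin n) → k} {σ : Fin d → Fin n} (hσ : p σ ≠ 0)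
    (h : ∀ l j, chartMap e p σ (e l * chartSpan e p σ j) = 0) (a : A) {x : A}
    (hx : x ∈ LinearMap.ker (chartMap e p σ)) : a * x ∈ LinearMap.ker (chartMap e p σ) := by
  have hsum : p σ • (a * x) =
      ∑ l, ∑ j, (e.repr a l * e.repr x j) • (e l * chartSpan e p σ j) := by
    rw [← mul_smul_comm, smul_eq_sum_chartSpan_of_chartMap_eq_zero hx]
    conv_lhs => rw [← e.sum_repr a]
    simp only [Finset.sum_mul_sum, smul_mul_smul_comm]
  rw [← Submodule.smul_mem_iff _ hσ, LinearMap.mem_ker, hsum]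
  simp [h]

end Chart

variable [Module.Finite k A]

lemma isZariskiClosed_pluckerCone : IsZariskiClosed (pluckerCone k A d) := fun p hp => by
  set e := Module.finBasis k A
  by_cases h0 : p = 0
  · subst h0
    obtain ⟨q, hq⟩ : (pluckerCone k A d).Nonempty := by
      by_contra! hempty
      simpa using hp 1 (by simp [hempty])
    obtain ⟨J, hJ, hq⟩ := mem_pluckerCone.mp hq
    exact mem_pluckerCone.mpr ⟨J, hJ, by simpa using hq.smul 0⟩
  obtain ⟨σ, hσ : p σ ≠ 0⟩ := Function.ne_iff.mp h0
  have hdet (τ : PluckerIndex k A d) : MvPolynomial.eval p (detRelation k σ τ) = 0 := by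
    refine eval_eq_zero_of_forall_apply_ne_zero hp hσ _ fun q hq hqσ => ?_
    obtain ⟨J, hJ, hq⟩ := mem_pluckerCone.mp hq
    rw [eval_detRelation, hq.mul_pow_eq hJ hqσ, sub_self]
  have hmul (l j) (m : Fin d) : MvPolynomial.eval p (idealRelation e σ l j m) = 0 := by
    refine eval_eq_zero_of_forall_apply_ne_zero hp hσ _ fun q hq hqσ => ?_
    obtain ⟨J, hJ, hq⟩ := mem_pluckerCone.mp hq
    have hmem : e l * chartSpan e q σ j ∈ J.restrictScalars k :=
      J.mul_mem_left _ (hq.chartSpan_mem hJ hqσ j)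
    rw [← hq.ker_chartMap hJ hqσ, LinearMap.mem_ker] at hmem
    rw [eval_idealRelation, hmem, Pi.zero_apply]
  simp only [eval_detRelation, sub_eq_zero] at hdet
  simp only [eval_idealRelation] at hmul
  let J : Ideal A :=
    { (LinearMap.ker (chartMap e p σ)).toAddSubmonoid with
      smul_mem' := fun a _ hx => mul_mem_ker_chartMap hσ (fun l j => funext (hmul l j)) a hx }
  exact mem_pluckerCone.mpr ⟨J, isPluckerVector_of_mul_pow_eq hσ hdet⟩

theorem isClosedCone_pluckerCone : IsClosedCone (pluckerCone k A d) where
  smul_mem p hp c := by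
    obtain ⟨J, hJ, hp⟩ := mem_pluckerCone.mp hp
    exact mem_pluckerCone.mpr ⟨J, hJ, hp.smul c⟩
  isZariskiClosed := isZariskiClosed_pluckerCone

end PluckerCone

/-! ### Families of subspaces with coordinates in an algebra of functions -/

section DetForm

variable {k : Type*} [Field k] {V : Type*} [AddCommGroup V] [Module k V] {r d : ℕ}
  (B : Module.Basis (Fin r ⊕ Fin d) k V)

/-- The alternating form `v ↦ det (w, v)`, which is a form modulo any `r`-dimensional subspace that
contains the `w i`. -/
def detForm (w : Fin r → V) : V [⋀^Fin d]→ₗ[k] k where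
  toFun v := B.det (Sum.elim w v)
  map_update_add' {inst} v i x y := by
    obtain rfl : inst = instDecidableEqFin d := Subsingleton.elim _ _
    simp only [← Sum.update_elim_inr, B.det.map_update_add]
  map_update_smul' {inst} v i c x := by
    obtain rfl : inst = instDecidableEqFin d := Subsingleton.elim _ _
    simp only [← Sum.update_elim_inr, B.det.map_update_smul]
  map_eq_zero_of_eq' v i j hij hne :=
    B.det.map_eq_zero_of_eq _ (i := Sum.inr i) (j := Sum.inr j) (by simpa using hij) (by simpa)

lemma detForm_apply (w : Fin r → V) (v : Fin d → V) : detForm B w v = B.det (Sum.elim w v) := rfl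

variable {J : Submodule k V} {w : Fin r → V}

lemma isFormModulo_detForm [Module.Finite k J] (hJ : Module.finrank k J = r)
    (hw : ∀ i, w i ∈ J) : IsFormModulo J (detForm B w) := by
  rintro v ⟨i, hi⟩
  rw [detForm_apply]
  refine B.det.map_linearDependent _ fun hli => ?_
  let f : Option (Fin r) → Fin r ⊕ Fin d := fun o => o.elim (Sum.inr i) Sum.inl
  have hf : Function.Injective f := by
    rintro (_ | a) (_ | b) h <;> simp_all [f]
  let g : Option (Fin r) → J := fun o => o.elim ⟨v i, hi⟩ fun j => ⟨w j, hw j⟩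
  have hfg : Sum.elim w v ∘ f = J.subtype ∘ g := by
    ext (_ | a) <;> rfl
  have hg : LinearIndependent k g := LinearIndependent.of_comp J.subtype (hfg ▸ hli.comp f hf)
  simpa [hJ] using hg.fintype_card_le_finrank

lemma detForm_ne_zero [Module.Finite k V] (hJ : Module.finrank k (V ⧸ J) = d)
    (hw : ∀ i, w i ∈ J) (hli : LinearIndependent k w) : detForm B w ≠ 0 := by
  let b := (Module.finBasis k (V ⧸ J)).reindex (finCongr hJ)
  let v : Fin d → V := fun i => Function.surjInv J.mkQ_surjective (b i)
  have hv : (Submodule.Quotient.mk ∘ v : Fin d → V ⧸ J) = b :=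
    funext fun i => Function.surjInv_eq J.mkQ_surjective (b i)
  have hwJ : LinearIndependent k (fun i => (⟨w i, hw i⟩ : J)) :=
    LinearIndependent.of_comp J.subtype hli
  have hwv := hwJ.sumElim_of_quotient v (by rw [hv]; exact b.linearIndependent)
  have hspan := hwv.span_eq_top_of_card_eq_finrank' (Module.finrank_eq_card_basis B).symm
  have hunit : IsUnit (B.det (Sum.elim w v)) :=
    (Module.Basis.is_basis_iff_det B).mp ⟨hwv, hspan⟩
  intro h0
  rw [← detForm_apply, h0] at hunit
  simp at hunit

lemma exists_detForm_basis_ne_zero [Module.Finite k V] {ι α : Type*}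
    (e : Module.Basis ι k V) (hJ : Module.finrank k (V ⧸ J) = d) (hJr : Module.finrank k J = r)
    {u : α → V} (hu : Submodule.span k (Set.range u) = J) :
    ∃ (s : Fin r → α) (σ : Fin d → ι), detForm B (u ∘ s) (e ∘ σ) ≠ 0 := by
  obtain ⟨f, hf, -, hli⟩ := Submodule.exists_fun_fin_finrank_span_eq k (Set.range u)
  have hr : r = Module.finrank k (Submodule.span k (Set.range u)) := by rw [hu, hJr]
  choose s hs using fun i : Fin r => hf (Fin.cast hr i)
  have hlis : LinearIndependent k (u ∘ s) := by
    rw [show u ∘ s = f ∘ Fin.cast hr from funext hs]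
    exact hli.comp _ (Fin.cast_injective _)
  have hmem (i : Fin r) : (u ∘ s) i ∈ J := hu ▸ Submodule.subset_span ⟨s i, rfl⟩
  by_contra! hzero
  exact detForm_ne_zero B hJ hmem hlis (e.ext_alternating fun σ _ => hzero s σ)

end DetForm

section Definable

variable {k : Type*} [Field k] {Ω : Type*} {T : Subalgebra k (Ω → k)}

lemma det_mem {m : Type*} [Fintype m] [DecidableEq m] {M : Ω → Matrix m m k}
    (hM : ∀ i j, (fun x => M x i j) ∈ T) : (fun x => (M x).det) ∈ T := by
  let N : Matrix m m T := Matrix.of fun i j => ⟨fun x => M x i j, hM i j⟩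
  have hdet : (fun x => (M x).det) = N.det.1 := by
    ext x
    exact (RingHom.map_det ((Pi.evalRingHom (fun _ => k) x).comp T.val.toRingHom) N).symm
  rw [hdet]
  exact N.det.2

lemma mem_of_forall_exists_ne_zero (hT : ∀ f ∈ T, f⁻¹ ∈ T) {β : Type*} [Finite β]
    {g f' : β → Ω → k} {f : Ω → k} (hg : ∀ b, g b ∈ T) (hf' : ∀ b, f' b ∈ T)
    (h : ∀ x b, g b x ≠ 0 → f x = f' b x) (hex : ∀ x, ∃ b, g b x ≠ 0) : f ∈ T := by
  classical
  have := Fintype.ofFinite β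
  have hfinset (s : Finset β) : ∃ F ∈ T, ∀ x, (∃ b ∈ s, g b x ≠ 0) → f x = F x := by
    induction s using Finset.induction_on with
    | empty => exact ⟨0, zero_mem T, by simp⟩
    | insert b s _ ih =>
      obtain ⟨F, hF, hfF⟩ := ih
      refine ⟨_, ite_mem_of_inv_mem hT (hg b) hF (hf' b), fun x hx => ?_⟩
      split_ifs with hb
      · exact hfF x (by simpa [hb] using hx)
      · exact h x b hb
  obtain ⟨F, hF, hfF⟩ := hfinset Finset.univ
  rwa [show f = F from funext fun x => hfF x (by simpa using hex x)]

variable {n n' : ℕ} {V V' : Type*} [AddCommGroup V'] [Module k V'] [AddCommGroup V] [Module k V]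

/-- A family of vectors whose coordinates, in the basis `e`, are functions in `T`. -/
def IsDefinableVec (T : Subalgebra k (Ω → k)) (e : Module.Basis (Fin n) k V) (w : Ω → V) : Prop :=
  ∀ j, (fun x => e.repr (w x) j) ∈ T

variable {e : Module.Basis (Fin n) k V} {e' : Module.Basis (Fin n') k V'}

namespace IsDefinableVec

lemma const (v : V) : IsDefinableVec T e fun _ => v := fun j => T.algebraMap_mem (e.repr v j)

lemma functional {w : Ω → V} (hw : IsDefinableVec T e w) (φ : V →ₗ[k] k) :
    (fun x => φ (w x)) ∈ T := by
  have hsum : (fun x => φ (w x)) =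
      ∑ j, (fun x => e.repr (w x) j) * algebraMap k (Ω → k) (φ (e j)) := by
    ext x
    conv_lhs => rw [← e.sum_repr (w x), map_sum]
    simp
  rw [hsum]
  exact sum_mem fun j _ => mul_mem (hw j) (T.algebraMap_mem _)

lemma map {w : Ω → V} (hw : IsDefinableVec T e w) (L : V →ₗ[k] V') :
    IsDefinableVec T e' fun x => L (w x) := fun j => hw.functional ((e'.coord j).comp L)

lemma sub {w w' : Ω → V} (hw : IsDefinableVec T e w) (hw' : IsDefinableVec T e w') :
    IsDefinableVec T e fun x => w x - w' x := fun j => by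
  simp only [map_sub]
  exact sub_mem (hw j) (hw' j)

lemma smul {f : Ω → k} (hf : f ∈ T) {w : Ω → V} (hw : IsDefinableVec T e w) :
    IsDefinableVec T e fun x => f x • w x := fun j => by
  simp only [map_smul]
  exact mul_mem hf (hw j)

lemma sum {α : Type*} (s : Finset α) {w : α → Ω → V} (hw : ∀ a, IsDefinableVec T e (w a)) :
    IsDefinableVec T e fun x => ∑ a ∈ s, w a x := fun j => by
  have hsum : (fun x => e.repr (∑ a ∈ s, w a x) j) = ∑ a ∈ s, fun x => e.repr (w a x) j := by
    ext x; simp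
  rw [hsum]
  exact sum_mem fun a _ => hw a j

lemma chartSpan {d : ℕ} {p : Ω → (Fin d → Fin n) → k} (hp : ∀ σ, (fun x => p x σ) ∈ T)
    (σ : Fin d → Fin n) (j : Fin n) :
    IsDefinableVec T e fun x => HilbZeta.chartSpan e (p x) σ j :=
  ((const _).smul (hp _)).sub (sum _ fun _ => (const _).smul (hp _))

lemma detForm_apply_basis_mem {r d : ℕ} (h : n = r + d) {w : Fin r → Ω → V}
    (hw : ∀ i, IsDefinableVec T e (w i)) (σ : Fin d → Fin n) :
    (fun x => detForm (e.reindex ((finCongr h).trans finSumFinEquiv.symm)) (fun i => w i x)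
      fun i => e (σ i)) ∈ T := by
  simp only [detForm_apply, Module.Basis.det_apply]
  refine det_mem fun i j => ?_
  simp only [Module.Basis.toMatrix_apply, Module.Basis.repr_reindex_apply]
  rcases j with j | j
  · exact hw j _
  · exact T.algebraMap_mem (e.repr (e (σ j)) _)

end IsDefinableVec

variable [Module.Finite k V] {d : ℕ} {J : Ω → Submodule k V}
  (hJ : ∀ x, Module.finrank k (V ⧸ J x) = d) {p : Ω → (Fin d → Fin n) → k}
  (hp : ∀ x, IsPluckerVector e (J x) (p x)) (hp0 : ∀ x, p x ≠ 0)

include hJ hp hp0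

lemma exists_isDefinableVec_span (hpT : ∀ σ, (fun x => p x σ) ∈ T) :
    ∃ w : (Fin d → Fin n) × Fin n → Ω → V, (∀ a, IsDefinableVec T e (w a)) ∧
      ∀ x, Submodule.span k (Set.range fun a => w a x) = J x := by
  refine ⟨fun a x => p x a.1 • chartSpan e (p x) a.1 a.2,
    fun a => (IsDefinableVec.chartSpan hpT a.1 a.2).smul (hpT _), fun x => le_antisymm ?_ ?_⟩
  · rw [Submodule.span_le]
    rintro _ ⟨a, rfl⟩
    by_cases ha : p x a.1 = 0
    · simp [ha]
    · exact (J x).smul_mem _ ((hp x).chartSpan_mem (hJ x) ha a.2)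
  · obtain ⟨σ, hσ⟩ := Function.ne_iff.mp (hp0 x)
    rw [← (hp x).span_chartSpan (hJ x) hσ, Submodule.span_le]
    rintro _ ⟨j, rfl⟩
    rw [SetLike.mem_coe, ← Submodule.smul_mem_iff _ hσ]
    exact Submodule.subset_span ⟨(σ, j), rfl⟩

variable {α : Type*} [Finite α] {w : α → Ω → V}

/-- The maximal minors of the spanning vectors are Plücker coordinates, and normalizing makes the
choice of nonvanishing minors irrelevant. -/
lemma normalizedVec_mem_of_span (hT : ∀ f ∈ T, f⁻¹ ∈ T) (hw : ∀ a, IsDefinableVec T e (w a))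
    (hspan : ∀ x, Submodule.span k (Set.range fun a => w a x) = J x) {l : List (Fin d → Fin n)}
    (hl : ∀ σ, σ ∈ l) (τ : Fin d → Fin n) : (fun x => normalizedVec l (p x) τ) ∈ T := by
  rcases isEmpty_or_nonempty Ω with hΩ | ⟨⟨x₀⟩⟩
  · rw [Subsingleton.elim (fun x => normalizedVec l (p x) τ) 0]
    exact zero_mem T
  obtain ⟨r, hr⟩ : ∃ r, ∀ x, Module.finrank k (J x) = r := by
    refine ⟨n - d, fun x => ?_⟩
    rw [← hJ x, ← Module.finrank_eq_card_basis e |>.trans (Fintype.card_fin n),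
      ← (J x).finrank_quotient_add_finrank, Nat.add_sub_cancel_left]
  have hn : n = r + d := by
    rw [← hr x₀, ← hJ x₀, add_comm, (J x₀).finrank_quotient_add_finrank,
      Module.finrank_eq_card_basis e, Fintype.card_fin]
  let B := e.reindex ((finCongr hn).trans finSumFinEquiv.symm)
  let minors (s : Fin r → α) (x : Ω) (σ : Fin d → Fin n) : k :=
    detForm B (fun i => w (s i) x) fun i => e (σ i)
  have hminors_mem (s σ) : (fun x => minors s x σ) ∈ T :=
    IsDefinableVec.detForm_apply_basis_mem hn (fun i => hw (s i)) σ
  have hminors (s x) : IsPluckerVector e (J x) (minors s x) :=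
    ⟨_, isFormModulo_detForm B (hr x) fun i => hspan x ▸ Submodule.subset_span ⟨s i, rfl⟩, rfl⟩
  refine mem_of_forall_exists_ne_zero hT (β := (Fin r → α) × (Fin d → Fin n))
    (g := fun b x => minors b.1 x b.2) (f' := fun b x => normalizedVec l (minors b.1 x) τ)
    (fun b => hminors_mem b.1 b.2) (fun b => normalizedVec_mem hT l (hminors_mem b.1) τ)
    (fun x ⟨s, σ⟩ hb => ?_) fun x => ?_
  · obtain ⟨c, hc, hpc⟩ := (hminors s x).exists_smul (hJ x) (hp x) (Function.ne_iff.mpr ⟨σ, hb⟩)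
      (hp0 x)
    change normalizedVec l (p x) τ = normalizedVec l (minors s x) τ
    rw [hpc, normalizedVec_smul ⟨σ, hl σ, hb⟩ hc]
  · obtain ⟨s, σ, hne⟩ := exists_detForm_basis_ne_zero B e (hJ x) (hr x) (hspan x)
    exact ⟨(s, σ), hne⟩

omit hJ hp hp0 in
lemma isClopenFor_le (hT : ∀ f ∈ T, f⁻¹ ∈ T) (hw : ∀ a, IsDefinableVec T e (w a))
    (hspan : ∀ x, Submodule.span k (Set.range fun a => w a x) = J x) (K : Submodule k V) :
    IsClopenFor T {x | J x ≤ K} := by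
  have := Fintype.ofFinite α
  let b := Module.finBasis k (V ⧸ K)
  have hinter : {x | J x ≤ K} = ⋂ a ∈ (Finset.univ : Finset α),
      ⋂ j ∈ (Finset.univ : Finset (Fin _)), {x | (b.coord j).comp K.mkQ (w a x) = 0} := by
    ext x
    simp only [Finset.mem_univ, Set.iInter_true, Set.mem_iInter, Set.mem_ofPred_eq]
    rw [← hspan, Submodule.span_le, Set.range_subset_iff]
    refine forall_congr' fun a => ?_
    rw [SetLike.mem_coe, ← Submodule.Quotient.mk_eq_zero, ← b.forall_coord_eq_zero_iff]
    rfl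
  rw [hinter]
  refine IsClopenFor.biInter _ fun a _ => IsClopenFor.biInter _ fun j _ => ?_
  have hmem := (hw a).functional ((b.coord j).comp K.mkQ)
  exact IsClopenFor.eq_zero hmem (hT _ hmem)

end Definable

/-! ### Families of ideals -/

section ColengthIdeal

variable {k : Type u} [Field k] {A : Type u} [CommRing A] [Algebra k A]

/-- The ideals of colength `d` of `A` that contain `N`, which correspond to the ideals of colength
`d` of `A ⧸ N`. -/
abbrev ColengthIdeal (k : Type u) [Field k] {A : Type u} [CommRing A] [Algebra k A]
    (N : Ideal A) (d : ℕ) : Type u :=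
  {I : Ideal A // Module.finrank k (A ⧸ I) = d ∧ N ≤ I}

variable {N : Ideal A} {d : ℕ}

/-- All Plücker indices, in some order. -/
def pluckerList (k : Type u) [Field k] (A : Type u) [CommRing A] [Algebra k A]
    (d : ℕ) : List (PluckerIndex k A d) :=
  Finset.univ.toList

lemma mem_pluckerList (σ : PluckerIndex k A d) : σ ∈ pluckerList k A d := by
  simp [pluckerList]

lemma exists_mem_pluckerList_ne_zero {p : PluckerIndex k A d → k} (hp : p ≠ 0) :
    ∃ σ ∈ pluckerList k A d, p σ ≠ 0 := by
  obtain ⟨σ, hσ⟩ := Function.ne_iff.mp hp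
  exact ⟨σ, mem_pluckerList σ, hσ⟩

namespace ColengthIdeal

/-- The ideal of `A ⧸ N` that corresponds to `I`, as a subspace. -/
def toSubmodule (I : ColengthIdeal k N d) : Submodule k (A ⧸ N) :=
  (I.1.map (Ideal.Quotient.mk N)).restrictScalars k

lemma finrank_quotient_toSubmodule (I : ColengthIdeal k N d) :
    Module.finrank k ((A ⧸ N) ⧸ I.toSubmodule) = d := by
  rw [toSubmodule, finrank_quotient_restrictScalars]
  exact (DoubleQuot.quotQuotEquivQuotOfLEₐ k I.2.2).toLinearEquiv.finrank_eq.trans I.2.1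

lemma toSubmodule_eq_map (I : ColengthIdeal k N d) :
    I.toSubmodule = (I.1.restrictScalars k).map (Ideal.Quotient.mkₐ k N).toLinearMap := by
  ext y
  simp only [toSubmodule, Submodule.restrictScalars_mem,
    Ideal.mem_map_iff_of_surjective _ Ideal.Quotient.mk_surjective, Submodule.mem_map]
  rfl

lemma comap_toSubmodule (I : ColengthIdeal k N d) :
    I.toSubmodule.comap (Ideal.Quotient.mkₐ k N).toLinearMap = I.1.restrictScalars k := by
  ext y
  change Ideal.Quotient.mk N y ∈ I.1.map (Ideal.Quotient.mk N) ↔ y ∈ I.1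
  rw [← Ideal.mem_comap, Ideal.comap_map_of_surjective _ Ideal.Quotient.mk_surjective,
    ← RingHom.ker_eq_comap_bot, Ideal.mk_ker, sup_eq_left.mpr I.2.2]

lemma restrictScalars_eq_sup (I : ColengthIdeal k N d) {s : A ⧸ N →ₗ[k] A}
    (hs : (Ideal.Quotient.mkₐ k N).toLinearMap ∘ₗ s = LinearMap.id) :
    I.1.restrictScalars k = I.toSubmodule.map s ⊔ N.restrictScalars k := by
  set q : A →ₗ[k] A ⧸ N := (Ideal.Quotient.mkₐ k N).toLinearMap
  have hker : LinearMap.ker q = N.restrictScalars k := by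
    ext y
    exact Ideal.Quotient.eq_zero_iff_mem
  rw [← hker, ← Submodule.comap_map_eq, ← Submodule.map_comp, hs, Submodule.map_id,
    I.comap_toSubmodule]

variable [Module.Finite k (A ⧸ N)]

/-- The Plücker vector of an ideal, with first nonzero coordinate `1`. -/
def pluckerVec (I : ColengthIdeal k N d) : PluckerIndex k (A ⧸ N) d → k :=
  normalizedVec (pluckerList k (A ⧸ N) d) (exists_isPluckerVector (n := Module.finrank k (A ⧸ N))
    (e := Module.finBasis k (A ⧸ N)) I.finrank_quotient_toSubmodule).choose

lemma pluckerVec_mem (I : ColengthIdeal k N d) :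
    I.pluckerVec ∈ normalizedSet k (pluckerList k (A ⧸ N) d) :=
  (normalizedVec_mem_normalizedSet (exists_mem_pluckerList_ne_zero
    (exists_isPluckerVector I.finrank_quotient_toSubmodule).choose_spec.2)).1

lemma isPluckerVector_pluckerVec (I : ColengthIdeal k N d) :
    IsPluckerVector (Module.finBasis k (A ⧸ N)) I.toSubmodule I.pluckerVec := by
  have hp := (exists_isPluckerVector (n := Module.finrank k (A ⧸ N))
    (e := Module.finBasis k (A ⧸ N)) I.finrank_quotient_toSubmodule).choose_spec
  obtain ⟨c, -, hc⟩ :=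
    (normalizedVec_mem_normalizedSet (exists_mem_pluckerList_ne_zero hp.2)).2
  rw [pluckerVec, hc]
  exact hp.1.smul c

lemma pluckerVec_ne_zero (I : ColengthIdeal k N d) : I.pluckerVec ≠ 0 :=
  ne_zero_of_mem_normalizedSet I.pluckerVec_mem

lemma range_pluckerVec : Set.range (pluckerVec (k := k) (N := N) (d := d)) =
    pluckerCone k (A ⧸ N) d ∩ normalizedSet k (pluckerList k (A ⧸ N) d) := by
  ext p
  constructor
  · rintro ⟨I, rfl⟩
    exact ⟨mem_pluckerCone.mpr ⟨_, I.finrank_quotient_toSubmodule, I.isPluckerVector_pluckerVec⟩,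
      I.pluckerVec_mem⟩
  · rintro ⟨hp, hn⟩
    obtain ⟨J, hJ, hp⟩ := mem_pluckerCone.mp hp
    have hle : N ≤ J.comap (Ideal.Quotient.mk N) :=
      N.mk_ker.symm.trans_le (Ideal.comap_mono bot_le)
    have hmap : (J.comap (Ideal.Quotient.mk N)).map (Ideal.Quotient.mk N) = J :=
      Ideal.map_comap_of_surjective _ Ideal.Quotient.mk_surjective J
    let I : ColengthIdeal k N d := ⟨J.comap (Ideal.Quotient.mk N), by
      refine (DoubleQuot.quotQuotEquivQuotOfLEₐ k hle).toLinearEquiv.finrank_eq.symm.trans ?_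
      change Module.finrank k (_ ⧸ Ideal.map (Ideal.Quotient.mk N) _) = d
      rw [hmap, ← finrank_quotient_restrictScalars, hJ], hle⟩
    have hI : IsPluckerVector (Module.finBasis k (A ⧸ N)) I.toSubmodule p := by
      rwa [toSubmodule, hmap]
    obtain ⟨c, hc, hIp⟩ := hI.exists_smul I.finrank_quotient_toSubmodule
      I.isPluckerVector_pluckerVec (ne_zero_of_mem_normalizedSet hn) I.pluckerVec_ne_zero
    refine ⟨I, ?_⟩
    rw [← normalizedVec_eq_self I.pluckerVec_mem, hIp, normalizedVec_smul_of_mem hn hc]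

end ColengthIdeal

variable [Module.Finite k (A ⧸ N)]

/-- The algebra of polynomial functions in the normalized Plücker coordinates on the set of ideals
of colength `d` that contain `N`. -/
def pluckerAlgebra (k : Type u) [Field k] {A : Type u} [CommRing A] [Algebra k A] (N : Ideal A)
    [Module.Finite k (A ⧸ N)] (d : ℕ) : Subalgebra k (ColengthIdeal k N d → k) :=
  (coordinateAlgebra k (PluckerIndex k (A ⧸ N) d)).map (pullbackFun ColengthIdeal.pluckerVec)

lemma pluckerAlgebra_fg : (pluckerAlgebra k N d).FG := coordinateAlgebra_fg.map _

lemma map_coordinateAlgebra_le {Ω : Type*} {ι : Type} {p : Ω → ι → k} {T : Subalgebra k (Ω → k)}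
    (h : ∀ i, (fun x => p x i) ∈ T) : (coordinateAlgebra k ι).map (pullbackFun p) ≤ T := by
  rw [coordinateAlgebra, MvPolynomial.aeval_range, AlgHom.map_adjoin, Algebra.adjoin_le_iff]
  rintro _ ⟨_, ⟨i, rfl⟩, rfl⟩
  exact h i

theorem hasClass_idealVariety [IsAlgClosed k] :
    HasClass (pluckerAlgebra k N d) Set.univ (idealVariety k (A ⧸ N) d).cls := by
  have h := hasClass_coneVariety (pluckerList k (A ⧸ N) d)
    (isClosedCone_pluckerCone (k := k) (A := A ⧸ N) (d := d))
    (fun p _ h => funext fun σ => h σ (mem_pluckerList σ))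
  rw [← ColengthIdeal.range_pluckerVec] at h
  have h' := h.preimage subset_rfl
  rwa [Set.preimage_range] at h'

section Families

variable {E : Type*} {T : Subalgebra k (E → k)}

lemma exists_isDefinableVec_toSubmodule {i : E → ColengthIdeal k N d}
    (hi : (pluckerAlgebra k N d).map (pullbackFun i) ≤ T) :
    ∃ w : PluckerIndex k (A ⧸ N) d × Fin (Module.finrank k (A ⧸ N)) → E → A ⧸ N,
      (∀ a, IsDefinableVec T (Module.finBasis k (A ⧸ N)) (w a)) ∧
        ∀ x, Submodule.span k (Set.range fun a => w a x) = (i x).toSubmodule :=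
  exists_isDefinableVec_span (fun x => (i x).finrank_quotient_toSubmodule)
    (fun x => (i x).isPluckerVector_pluckerVec) (fun x => (i x).pluckerVec_ne_zero)
    fun σ => hi ⟨_, ⟨_, coord_mem_coordinateAlgebra σ, rfl⟩, rfl⟩

lemma map_pluckerAlgebra_le_of_span (hT : ∀ f ∈ T, f⁻¹ ∈ T) {i : E → ColengthIdeal k N d}
    {α : Type*} [Finite α] {w : α → E → A ⧸ N}
    (hw : ∀ a, IsDefinableVec T (Module.finBasis k (A ⧸ N)) (w a))
    (hspan : ∀ x, Submodule.span k (Set.range fun a => w a x) = (i x).toSubmodule) :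
    (pluckerAlgebra k N d).map (pullbackFun i) ≤ T := by
  rw [pluckerAlgebra, Subalgebra.map_map]
  refine map_coordinateAlgebra_le (p := fun x => (i x).pluckerVec) fun σ => ?_
  simpa only [normalizedVec_eq_self (ColengthIdeal.pluckerVec_mem _)] using
    normalizedVec_mem_of_span (fun x => (i x).finrank_quotient_toSubmodule)
      (fun x => (i x).isPluckerVector_pluckerVec) (fun x => (i x).pluckerVec_ne_zero) hT hw hspan
      mem_pluckerList σ

variable {N' : Ideal A} {d' : ℕ} [Module.Finite k (A ⧸ N')]

lemma map_pluckerAlgebra_le_of_map {i : E → ColengthIdeal k N d} {i' : E → ColengthIdeal k N' d'}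
    (L : A →ₗ[k] A)
    (h : ∀ x, (i' x).1.restrictScalars k = ((i x).1.restrictScalars k).map L) :
    (pluckerAlgebra k N' d').map (pullbackFun i') ≤
      invClosure ((pluckerAlgebra k N d).map (pullbackFun i)) := by
  obtain ⟨w, hw, hspan⟩ := exists_isDefinableVec_toSubmodule
    (le_invClosure ((pluckerAlgebra k N d).map (pullbackFun i)))
  let q : A →ₗ[k] A ⧸ N := (Ideal.Quotient.mkₐ k N).toLinearMap
  let q' : A →ₗ[k] A ⧸ N' := (Ideal.Quotient.mkₐ k N').toLinearMap
  obtain ⟨s, hs⟩ := q.exists_rightInverse_of_surjective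
    (LinearMap.range_eq_top.mpr Ideal.Quotient.mk_surjective)
  obtain ⟨t, ht⟩ : ((N.restrictScalars k).map (q' ∘ₗ L)).FG := IsNoetherian.noetherian _
  refine map_pluckerAlgebra_le_of_span (fun f hf => inv_mem_invClosure hf)
    (w := Sum.elim (fun a x => q' (L (s (w a x)))) fun (c : t) _ => c.1) ?_ fun x => ?_
  · rintro (a | c)
    · exact (hw a).map (q' ∘ₗ L ∘ₗ s)
    · exact IsDefinableVec.const _
  · rw [(i' x).toSubmodule_eq_map, h, (i x).restrictScalars_eq_sup hs, Submodule.map_sup,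
      Submodule.map_sup, ← hspan, Submodule.map_span, Submodule.map_span, Submodule.map_span,
      ← Submodule.map_comp L, ← ht, ← Submodule.span_union]
    congr 1
    ext y
    simp [q']

end Families

lemma isClopenFor_colengthIdeal_le (K : Submodule k A) :
    IsClopenFor (invClosure (pluckerAlgebra k N d))
      {I : ColengthIdeal k N d | I.1.restrictScalars k ≤ K} := by
  by_cases hK : N.restrictScalars k ≤ K
  · obtain ⟨w, hw, hspan⟩ := exists_isDefinableVec_toSubmodule (k := k) (N := N) (d := d) (i := id)
      (T := invClosure (pluckerAlgebra k N d)) (by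
        rintro _ ⟨f, hf, rfl⟩
        exact le_invClosure _ hf)
    convert isClopenFor_le (fun f hf => inv_mem_invClosure hf) hw hspan
      (K.map (Ideal.Quotient.mkₐ k N).toLinearMap) using 3 with I
    change _ ≤ _ ↔ I.toSubmodule ≤ _
    rw [I.toSubmodule_eq_map]
    refine ⟨fun h => Submodule.map_mono h, fun h y hy => ?_⟩
    obtain ⟨z, hz, hzy⟩ := h ⟨y, hy, rfl⟩
    have hyz : y - z ∈ N := (Ideal.Quotient.mk_eq_mk_iff_sub_mem y z).mp hzy.symm
    simpa using K.add_mem (hK hyz) hz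
  · have hempty : {I : ColengthIdeal k N d | I.1.restrictScalars k ≤ K} = ∅ :=
      Set.eq_empty_of_forall_notMem fun I hI => hK (le_trans (fun y hy => I.2.2 hy) hI)
    rw [hempty, IsClopenFor, Set.indicator_empty]
    exact zero_mem _

theorem HasClass.eq_of_linear [IsAlgClosed k] {N' : Ideal A} {d' : ℕ} [Module.Finite k (A ⧸ N')]
    {E : Type u} {i : E → ColengthIdeal k N d} {i' : E → ColengthIdeal k N' d'} {m m' : K0 k}
    (hm : HasClass (pluckerAlgebra k N d) (Set.range i) m)
    (hm' : HasClass (pluckerAlgebra k N' d') (Set.range i') m') (L L' : A →ₗ[k] A)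
    (h : ∀ x, (i' x).1.restrictScalars k = ((i x).1.restrictScalars k).map L)
    (h' : ∀ x, (i x).1.restrictScalars k = ((i' x).1.restrictScalars k).map L') : m = m' :=
  hm.eq_of_bijection hm' pluckerAlgebra_fg pluckerAlgebra_fg i i' rfl rfl
    (map_pluckerAlgebra_le_of_map L' h') (map_pluckerAlgebra_le_of_map L h)

end ColengthIdeal

/-! ### Generating functions of eventually shift invariant arrays -/

section ShiftArray

variable {ι : Type*} {M : Type*} [CommRing M]

/-- The array `h a d` is supported near the hyperplane `∑ i, a i = d` of the orthant, and its
support meets `d = 0` in the origin at most. -/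
structure IsSupportedNearHyperplane [Fintype ι] (δ G : ℕ) (h : (ι → ℕ) → ℕ → M) : Prop where
  le_of_ne_zero : ∀ a d, h a d ≠ 0 → ∀ i, a i ≤ d + δ
  le_sum_of_ne_zero : ∀ a d, h a d ≠ 0 → d + δ ≤ ∑ i, a i + G
  eq_zero_of_ne_zero : ∀ a, a ≠ 0 → h a 0 = 0

lemma IsSupportedNearHyperplane.sub [Fintype ι] {δ G : ℕ} {h h' : (ι → ℕ) → ℕ → M}
    (H : IsSupportedNearHyperplane δ G h)
    (H' : IsSupportedNearHyperplane δ G h') :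
    IsSupportedNearHyperplane δ G (h - h') := by
  have hor : ∀ a d, (h - h') a d ≠ 0 → h a d ≠ 0 ∨ h' a d ≠ 0 := fun a d hne => by
    by_contra! hc
    exact hne (by simp [hc.1, hc.2])
  refine ⟨fun a d hne => ?_, fun a d hne => ?_, fun a ha => ?_⟩
  · exact (hor a d hne).elim (H.le_of_ne_zero a d) (H'.le_of_ne_zero a d)
  · exact (hor a d hne).elim (H.le_sum_of_ne_zero a d) (H'.le_sum_of_ne_zero a d)
  · simp [H.eq_zero_of_ne_zero a ha, H'.eq_zero_of_ne_zero a ha]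

variable [DecidableEq ι]

lemma single_one_le {i : ι} {a : ι → ℕ} (hi : a i ≠ 0) : Pi.single i 1 ≤ a := fun j => by
  obtain rfl | hj := eq_or_ne j i
  · simpa using Nat.one_le_iff_ne_zero.mpr hi
  · simp [hj]

lemma exists_eq_add_single {i : ι} {a : ι → ℕ} (hi : a i ≠ 0) :
    ∃ b : ι → ℕ, a = b + Pi.single i 1 :=
  ⟨_, (tsub_add_cancel_of_le (single_one_le hi)).symm⟩

lemma add_single_ne_zero (a : ι → ℕ) (i : ι) : a + Pi.single i 1 ≠ 0 :=
  Function.ne_iff.mpr ⟨i, by simp⟩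

/-- The array `h`, shifted by one in direction `i` and in the last index, and extended by zero. -/
def arrayShift (i : ι) (h : (ι → ℕ) → ℕ → M) (a : ι → ℕ) (d : ℕ) : M :=
  if a i = 0 ∨ d = 0 then 0 else h (a - Pi.single i 1) (d - 1)

@[simp] lemma arrayShift_zero (i : ι) (h : (ι → ℕ) → ℕ → M) (a : ι → ℕ) :
    arrayShift i h a 0 = 0 := by
  simp [arrayShift]

lemma arrayShift_of_eq_zero {i : ι} (h : (ι → ℕ) → ℕ → M) {a : ι → ℕ} (ha : a i = 0) (d : ℕ) :
    arrayShift i h a d = 0 := by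
  simp [arrayShift, ha]

@[simp] lemma arrayShift_add_single (i : ι) (h : (ι → ℕ) → ℕ → M) (a : ι → ℕ) (d : ℕ) :
    arrayShift i h (a + Pi.single i 1) (d + 1) = h a d := by
  simp [arrayShift]

lemma exists_of_arrayShift_ne_zero {i : ι} {h : (ι → ℕ) → ℕ → M} {a : ι → ℕ} {d : ℕ}
    (hne : arrayShift i h a d ≠ 0) :
    ∃ b e, a = b + Pi.single i 1 ∧ d = e + 1 ∧ h b e ≠ 0 := by
  obtain _ | e := d
  · exact absurd (arrayShift_zero i h a) hne
  obtain ⟨b, rfl⟩ := exists_eq_add_single fun ha => hne (arrayShift_of_eq_zero h ha (e + 1))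
  exact ⟨b, e, rfl, rfl, by rwa [arrayShift_add_single] at hne⟩

variable [Fintype ι]

/-- The array `h` is supported near the hyperplane `∑ i, a i = d`. In the half space `γ i ≤ a i` it
is invariant under the shift in direction `i` if `i ∉ s`, and in `γ i < a i` it is zero if
`i ∈ s`. -/
structure IsEventuallyShiftInvariant (γ : ι → ℕ) (δ G : ℕ) (s : Finset ι)
    (h : (ι → ℕ) → ℕ → M) : Prop extends IsSupportedNearHyperplane δ G h where
  shift : ∀ i ∉ s, ∀ a d, γ i ≤ a i → h (a + Pi.single i 1) (d + 1) = h a d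
  eq_zero : ∀ i ∈ s, ∀ a d, γ i < a i → h a d = 0

/-- A finite set of indices that contains the support of `h · d`. -/
def arrayBox (ι : Type*) [Fintype ι] [DecidableEq ι] (δ d : ℕ) : Finset (ι → ℕ) :=
  Fintype.piFinset fun _ => Finset.range (d + δ + 1)

/-- The generating function `∑ (∑ h a d) t ^ d` of an array supported in the boxes `arrayBox`. -/
def arraySeries (δ : ℕ) (h : (ι → ℕ) → ℕ → M) : PowerSeries M :=
  PowerSeries.mk fun d => ∑ a ∈ arrayBox ι δ d, h a d

lemma mem_arrayBox {δ d : ℕ} {a : ι → ℕ} : a ∈ arrayBox ι δ d ↔ ∀ i, a i ≤ d + δ := by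
  simp only [arrayBox, Fintype.mem_piFinset, Finset.mem_range, Nat.lt_succ_iff]

lemma add_single_mem_arrayBox {δ d : ℕ} {a : ι → ℕ} (ha : a ∈ arrayBox ι δ d) (i : ι) :
    a + Pi.single i 1 ∈ arrayBox ι δ (d + 1) := by
  refine mem_arrayBox.mpr fun j => ?_
  have hj := mem_arrayBox.mp ha j
  rw [Pi.add_apply, Pi.single_apply]
  split_ifs <;> omega

variable {γ : ι → ℕ} {δ G : ℕ} {s : Finset ι} {h : (ι → ℕ) → ℕ → M} {i : ι}

namespace IsSupportedNearHyperplane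

lemma mem_arrayBox (H : IsSupportedNearHyperplane δ G h) {a : ι → ℕ} {d : ℕ} (hne : h a d ≠ 0) :
    a ∈ arrayBox ι δ d :=
  HilbZeta.mem_arrayBox.mpr (H.le_of_ne_zero a d hne)

lemma arrayShift (H : IsSupportedNearHyperplane δ G h) (i : ι) :
    IsSupportedNearHyperplane δ G (arrayShift i h) where
  le_of_ne_zero a d hne := by
    obtain ⟨b, e, rfl, rfl, hb⟩ := exists_of_arrayShift_ne_zero hne
    exact HilbZeta.mem_arrayBox.mp (add_single_mem_arrayBox (H.mem_arrayBox hb) i)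
  le_sum_of_ne_zero a d hne := by
    obtain ⟨b, e, rfl, rfl, hb⟩ := exists_of_arrayShift_ne_zero hne
    have := H.le_sum_of_ne_zero b e hb
    simp only [Pi.add_apply, Finset.sum_add_distrib, Finset.sum_pi_single', Finset.mem_univ,
      if_true]
    omega
  eq_zero_of_ne_zero a _ := arrayShift_zero i h a

lemma arraySeries_arrayShift (H : IsSupportedNearHyperplane δ G h) (i : ι) :
    arraySeries δ (HilbZeta.arrayShift i h) = arraySeries δ h * PowerSeries.X := by
  ext d
  obtain _ | d := d
  · simp [arraySeries]
  rw [PowerSeries.coeff_succ_mul_X, arraySeries, arraySeries, PowerSeries.coeff_mk,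
    PowerSeries.coeff_mk]
  symm
  refine Finset.sum_of_injOn (· + Pi.single i 1) (add_left_injective _).injOn
    (fun a ha => add_single_mem_arrayBox ha i) (fun a _ ha => ?_)
    fun a _ => (arrayShift_add_single i h a d).symm
  by_contra hne
  obtain ⟨b, e, rfl, he, hb⟩ := exists_of_arrayShift_ne_zero hne
  obtain rfl : d = e := Nat.succ_injective he
  exact ha ⟨b, H.mem_arrayBox hb, rfl⟩

end IsSupportedNearHyperplane

namespace IsEventuallyShiftInvariant

lemma arrayShift_shift (H : IsEventuallyShiftInvariant γ δ G s h) {j : ι} (hj : j ∉ s)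
    (hji : j ≠ i) {a : ι → ℕ} (ha : γ j ≤ a j) (d : ℕ) :
    arrayShift i h (a + Pi.single j 1) (d + 1) = arrayShift i h a d := by
  by_cases hai : a i = 0
  · rw [arrayShift_of_eq_zero h hai, arrayShift_of_eq_zero h (by simp [hai, hji.symm])]
  obtain ⟨b, rfl⟩ := exists_eq_add_single hai
  rw [add_right_comm, arrayShift_add_single]
  obtain _ | d := d
  · rw [arrayShift_zero, H.eq_zero_of_ne_zero _ (add_single_ne_zero b j)]
  · rw [arrayShift_add_single]
    exact H.shift j hj b d (by simpa [hji] using ha)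

lemma arrayShift_eq (H : IsEventuallyShiftInvariant γ δ G s h) (hi : i ∉ s) {a : ι → ℕ}
    (ha : γ i < a i) (d : ℕ) : arrayShift i h a d = h a d := by
  obtain ⟨b, rfl⟩ := exists_eq_add_single ha.ne_bot
  obtain _ | d := d
  · rw [arrayShift_zero, H.eq_zero_of_ne_zero _ (add_single_ne_zero b i)]
  · rw [arrayShift_add_single, H.shift i hi b d (by simpa [Nat.lt_succ_iff] using ha)]

lemma arrayShift_eq_zero (H : IsEventuallyShiftInvariant γ δ G s h) (hi : i ∉ s) {j : ι}
    (hj : j ∈ s) {a : ι → ℕ} (ha : γ j < a j) (d : ℕ) : arrayShift i h a d = 0 := by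
  by_contra hne
  obtain ⟨b, e, rfl, rfl, hb⟩ := exists_of_arrayShift_ne_zero hne
  exact hb (H.eq_zero j hj b e (by simpa [ne_of_mem_of_not_mem hj hi] using ha))

lemma sub_arrayShift (H : IsEventuallyShiftInvariant γ δ G s h) (hi : i ∉ s) :
    IsEventuallyShiftInvariant γ δ G (insert i s) (h - arrayShift i h) where
  toIsSupportedNearHyperplane :=
    H.toIsSupportedNearHyperplane.sub (H.toIsSupportedNearHyperplane.arrayShift i)
  shift j hj a d ha := by
    rw [Finset.mem_insert, not_or] at hj
    simp only [Pi.sub_apply, H.shift j hj.2 a d ha, H.arrayShift_shift hj.2 hj.1 ha]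
  eq_zero j hj a d ha := by
    rw [Pi.sub_apply, Pi.sub_apply, sub_eq_zero]
    obtain rfl | hj := Finset.mem_insert.mp hj
    · exact (H.arrayShift_eq hi ha d).symm
    · rw [H.eq_zero j hj a d ha, H.arrayShift_eq_zero hi hj ha]

lemma arraySeries_sub_arrayShift (H : IsEventuallyShiftInvariant γ δ G s h) (i : ι) :
    arraySeries δ (h - arrayShift i h) = arraySeries δ h * (1 - PowerSeries.X) := by
  rw [mul_sub, mul_one, ← H.toIsSupportedNearHyperplane.arraySeries_arrayShift i]
  ext d
  simp [arraySeries]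

lemma exists_arraySeries_eq_mul_pow (H : IsEventuallyShiftInvariant γ δ G ∅ h) (s : Finset ι) :
    ∃ h' : (ι → ℕ) → ℕ → M, IsEventuallyShiftInvariant γ δ G s h' ∧
      arraySeries δ h' = arraySeries δ h * (1 - PowerSeries.X) ^ s.card := by
  induction s using Finset.induction_on with
  | empty => exact ⟨h, H, by simp⟩
  | insert i s hi ih =>
    obtain ⟨h', H', hh'⟩ := ih
    refine ⟨_, H'.sub_arrayShift hi, ?_⟩
    rw [H'.arraySeries_sub_arrayShift, hh', Finset.card_insert_of_notMem hi, pow_succ, mul_assoc]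

lemma exists_arraySeries_eq_polynomial (H : IsEventuallyShiftInvariant γ δ G Finset.univ h) :
    ∃ P : Polynomial M, arraySeries δ h = (P : PowerSeries M) := by
  refine ⟨PowerSeries.trunc (∑ i, γ i + G + 1) (arraySeries δ h), ?_⟩
  ext d
  rw [Polynomial.coeff_coe, PowerSeries.coeff_trunc]
  split_ifs with hd
  · rfl
  rw [arraySeries, PowerSeries.coeff_mk]
  refine Finset.sum_eq_zero fun a _ => ?_
  by_contra hne
  have hle := H.le_sum_of_ne_zero a d hne
  have hsum : ∑ i, a i ≤ ∑ i, γ i := Finset.sum_le_sum fun i _ =>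
    not_lt.mp fun hlt => hne (H.eq_zero i (Finset.mem_univ i) a d hlt)
  omega

theorem exists_polynomial (H : IsEventuallyShiftInvariant γ δ G ∅ h) :
    ∃ P : Polynomial M,
      arraySeries δ h * (1 - PowerSeries.X) ^ Fintype.card ι = (P : PowerSeries M) := by
  obtain ⟨h', H', hh'⟩ := H.exists_arraySeries_eq_mul_pow Finset.univ
  rw [← Finset.card_univ, ← hh']
  exact H'.exists_arraySeries_eq_polynomial

end IsEventuallyShiftInvariant

end ShiftArray

/-! ### Colengths -/

section Length

variable {k : Type*} [CommRing k] {V W : Type*} [AddCommGroup V] [Module k V] [AddCommGroup W]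
  [Module k W]

lemma length_quotient_map (φ : V →ₗ[k] W) (hφ : Function.Injective φ) (P : Submodule k V) :
    Module.length k (W ⧸ P.map φ) = Module.length k (V ⧸ P) + Module.length k (W ⧸ φ.range) := by
  let f : V ⧸ P →ₗ[k] W ⧸ P.map φ := P.mapQ _ φ (Submodule.le_comap_map φ P)
  let g : W ⧸ P.map φ →ₗ[k] W ⧸ φ.range := Submodule.factor (LinearMap.map_le_range)
  have hf : Function.Injective f := by
    rw [← LinearMap.ker_eq_bot, Submodule.ker_mapQ, Submodule.comap_map_eq_of_injective hφ,
      Submodule.mkQ_map_self]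
  have hfg : Function.Exact f g := by
    rw [LinearMap.exact_iff]
    simp only [f, g, Submodule.factor, Submodule.ker_mapQ, Submodule.range_mapQ,
      Submodule.comap_id]
  exact Module.length_eq_add_of_exact f g hf (Submodule.factor_surjective _) hfg

lemma length_quotient_mono {P Q : Submodule k V} (h : P ≤ Q) :
    Module.length k (V ⧸ Q) ≤ Module.length k (V ⧸ P) :=
  Module.length_le_of_surjective (Submodule.factor h) (Submodule.factor_surjective h)

variable {A : Type*} [CommRing A] [Algebra k A]

lemma length_quotient_restrictScalars (I : Ideal A) :
    Module.length k (A ⧸ I.restrictScalars k) = Module.length k (A ⧸ I) :=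
  (Submodule.Quotient.restrictScalarsEquiv k I).length_eq

lemma range_mulLeft (x : A) :
    (LinearMap.mulLeft k x).range = (Ideal.span {x}).restrictScalars k := by
  ext z
  simp only [LinearMap.mem_range, Submodule.restrictScalars_mem, Ideal.mem_span_singleton,
    LinearMap.mulLeft_apply, Dvd.dvd, eq_comm]

lemma map_mulLeft_restrictScalars (x : A) (I : Ideal A) :
    (I.restrictScalars k).map (LinearMap.mulLeft k x) =
      (Ideal.span {x} * I).restrictScalars k := by
  ext z
  simp only [Submodule.mem_map, Submodule.restrictScalars_mem, Ideal.mem_span_singleton_mul,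
    LinearMap.mulLeft_apply]

lemma mulLeft_injective {x : A} (hx : x ∈ nonZeroDivisors A) :
    Function.Injective (LinearMap.mulLeft k x) := fun _ _ h =>
  (mul_cancel_left_mem_nonZeroDivisors hx).mp h

lemma length_quotient_span_mul {x : A} (hx : x ∈ nonZeroDivisors A) (I : Ideal A) :
    Module.length k (A ⧸ Ideal.span {x} * I) =
      Module.length k (A ⧸ I) + Module.length k (A ⧸ Ideal.span {x}) := by
  have h := length_quotient_map (LinearMap.mulLeft k x) (mulLeft_injective hx)
    (I.restrictScalars k)
  rwa [map_mulLeft_restrictScalars, range_mulLeft, length_quotient_restrictScalars,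
    length_quotient_restrictScalars, length_quotient_restrictScalars] at h

lemma length_quotient_span_singleton_mul {x : A} (hx : x ∈ nonZeroDivisors A) (y : A) :
    Module.length k (A ⧸ Ideal.span {x * y}) =
      Module.length k (A ⧸ Ideal.span {y}) + Module.length k (A ⧸ Ideal.span {x}) := by
  rw [← length_quotient_span_mul hx, Ideal.span_singleton_mul_span_singleton]

variable [IsLocalRing A] [IsNoetherianRing A]

open IsLocalRing in
/-- Otherwise Nakayama's lemma gives `m ^ j ≤ I`. -/
lemma sup_maximalIdeal_pow_succ_lt {I : Ideal A} {j : ℕ} (hj : ¬ maximalIdeal A ^ j ≤ I) :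
    I ⊔ maximalIdeal A ^ (j + 1) < I ⊔ maximalIdeal A ^ j := by
  refine lt_of_le_of_ne (sup_le_sup_left (Ideal.pow_le_pow_right j.le_succ) I) fun he => hj ?_
  refine Submodule.le_of_le_smul_of_le_jacobson_bot (I := maximalIdeal A)
    (IsNoetherian.noetherian _) (maximalIdeal_le_jacobson _) ?_
  rw [smul_eq_mul, ← pow_succ', he]
  exact le_sup_right

open IsLocalRing in
lemma le_length_quotient_sup_maximalIdeal_pow {I : Ideal A} {j : ℕ}
    (hj : ¬ maximalIdeal A ^ j ≤ I) :
    (j + 1 : ℕ) ≤ Module.length k (A ⧸ I ⊔ maximalIdeal A ^ (j + 1)) := by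
  have hcoheight (n : ℕ) : Module.length k (A ⧸ I ⊔ maximalIdeal A ^ n) =
      Order.coheight ((I ⊔ maximalIdeal A ^ n).restrictScalars k) := by
    rw [← length_quotient_restrictScalars, Module.length_quotient]
  have hsucc (n : ℕ) (hn : ¬ maximalIdeal A ^ n ≤ I) :
      Module.length k (A ⧸ I ⊔ maximalIdeal A ^ n) + 1 ≤
        Module.length k (A ⧸ I ⊔ maximalIdeal A ^ (n + 1)) := by
    rw [hcoheight, hcoheight]
    exact Order.coheight_add_one_le (sup_maximalIdeal_pow_succ_lt hn)
  induction j with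
  | zero => simpa using le_add_self.trans (hsucc 0 hj)
  | succ j ih =>
    have hj' : ¬ maximalIdeal A ^ j ≤ I := fun h =>
      hj ((Ideal.pow_le_pow_right j.le_succ).trans h)
    rw [Nat.cast_add, Nat.cast_one]
    exact (add_le_add_left (ih hj') 1).trans (hsucc (j + 1) hj)

lemma maximalIdeal_pow_le_of_length_quotient_eq {I : Ideal A} {d : ℕ}
    (h : Module.length k (A ⧸ I) = d) : IsLocalRing.maximalIdeal A ^ d ≤ I := by
  by_contra hd
  have hmono : Module.length k (A ⧸ I ⊔ IsLocalRing.maximalIdeal A ^ (d + 1)) ≤ d := by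
    rw [← h]
    exact Module.length_le_of_surjective (Ideal.Quotient.factorₐ k le_sup_left).toLinearMap
      (Ideal.Quotient.factor_surjective le_sup_left)
  have hle : d + 1 ≤ d := by
    exact_mod_cast (le_length_quotient_sup_maximalIdeal_pow hd).trans hmono
  omega

end Length

/-! ### Ideals of a subring and the ideals they generate in the normalization -/

section PowProd

variable {ι : Type*} [Fintype ι] {M : Type*} [CommMonoid M]

/-- The monomial `∏ t i ^ a i`. -/
def powProd (t : ι → M) (a : ι → ℕ) : M := ∏ i, t i ^ a i

@[simp] lemma powProd_zero (t : ι → M) : powProd t 0 = 1 := by simp [powProd]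

lemma powProd_add (t : ι → M) (a b : ι → ℕ) :
    powProd t (a + b) = powProd t a * powProd t b := by
  simp [powProd, pow_add, Finset.prod_mul_distrib]

lemma powProd_single [DecidableEq ι] (t : ι → M) (i : ι) (n : ℕ) :
    powProd t (Pi.single i n) = t i ^ n := by
  rw [powProd, Fintype.prod_eq_single i fun j hj => by simp [hj], Pi.single_eq_same]

lemma powProd_add_single [DecidableEq ι] (t : ι → M) (a : ι → ℕ) (i : ι) :
    powProd t (a + Pi.single i 1) = powProd t a * t i := by
  rw [powProd_add, powProd_single, pow_one]

lemma pow_dvd_powProd (t : ι → M) {a : ι → ℕ} {i : ι} {n : ℕ} (h : n ≤ a i) :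
    t i ^ n ∣ powProd t a :=
  (pow_dvd_pow _ h).trans (Finset.dvd_prod_of_mem _ (Finset.mem_univ i))

end PowProd

section IdealImage

variable {k A B : Type*} [CommRing k] [CommRing A] [CommRing B] [Algebra k A] [Algebra k B]
  [Algebra A B]

lemma span_singleton_mul_inj {x : B} (hx : x ∈ nonZeroDivisors B) {I J : Ideal B} :
    Ideal.span {x} * I = Ideal.span {x} * J ↔ I = J := by
  have hmap (I : Ideal B) : Ideal.span {x} * I = Submodule.map (LinearMap.mulLeft B x) I :=
    (map_mulLeft_restrictScalars x I).symm
  rw [hmap, hmap, (Submodule.map_injective_of_injective (mulLeft_injective hx)).eq_iff]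

lemma length_quotient_span_pow {x : B} (hx : x ∈ nonZeroDivisors B) (n : ℕ) :
    Module.length k (B ⧸ Ideal.span {x ^ n}) = n * Module.length k (B ⧸ Ideal.span {x}) := by
  induction n with
  | zero =>
    have : Subsingleton (B ⧸ Ideal.span {x ^ 0}) := by
      rw [Ideal.Quotient.subsingleton_iff, pow_zero, Ideal.span_singleton_one]
    rw [Module.length_eq_zero, Nat.cast_zero, zero_mul]
  | succ n ih =>
    rw [pow_succ', length_quotient_span_singleton_mul hx, ih, Nat.cast_succ, add_one_mul]

lemma length_quotient_span_prod {ι : Type*} {x : ι → B} (hx : ∀ i, x i ∈ nonZeroDivisors B)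
    (s : Finset ι) : Module.length k (B ⧸ Ideal.span {∏ i ∈ s, x i}) =
      ∑ i ∈ s, Module.length k (B ⧸ Ideal.span {x i}) := by
  classical
  induction s using Finset.induction_on with
  | empty =>
    have : Subsingleton (B ⧸ Ideal.span {∏ i ∈ (∅ : Finset ι), x i}) := by
      rw [Ideal.Quotient.subsingleton_iff, Finset.prod_empty, Ideal.span_singleton_one]
    rw [Module.length_eq_zero, Finset.sum_empty]
  | insert i s hi ih =>
    rw [Finset.prod_insert hi, length_quotient_span_singleton_mul (hx i), ih,
      Finset.sum_insert hi, add_comm]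

variable [IsScalarTower k A B]

variable (k A B) in
/-- The inclusion of `A` into `B` as a `k`-linear map. -/
abbrev inclusionMap : A →ₗ[k] B := (IsScalarTower.toAlgHom k A B).toLinearMap

variable (k A B) in
/-- The `δ`-invariant of `A` in `B`, that is, the length of `B ⧸ A`. -/
def deltaInvariant : ℕ∞ := Module.length k (B ⧸ (inclusionMap k A B).range)

variable (k B) in
/-- An ideal of `A` as a subspace of `B`. -/
def idealImage (I : Ideal A) : Submodule k B := (I.restrictScalars k).map (inclusionMap k A B)

lemma mem_idealImage {I : Ideal A} {b : B} :
    b ∈ idealImage k B I ↔ ∃ x ∈ I, algebraMap A B x = b := Iff.rfl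

lemma span_idealImage (I : Ideal A) :
    Ideal.span (idealImage k B I : Set B) = I.map (algebraMap A B) := rfl

lemma map_le_iff_le_comap_inclusionMap (I : Ideal A) (J : Ideal B) :
    I.map (algebraMap A B) ≤ J ↔
      I.restrictScalars k ≤ (J.restrictScalars k).comap (inclusionMap k A B) :=
  Ideal.map_le_iff_le_comap

lemma idealImage_le_map (I : Ideal A) :
    idealImage k B I ≤ (I.map (algebraMap A B)).restrictScalars k :=
  Submodule.map_le_iff_le_comap.mpr ((map_le_iff_le_comap_inclusionMap I _).mp le_rfl)

lemma length_quotient_idealImage (h : Function.Injective (algebraMap A B)) (I : Ideal A) :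
    Module.length k (B ⧸ idealImage k B I) = Module.length k (A ⧸ I) + deltaInvariant k A B := by
  rw [idealImage, length_quotient_map _ h, length_quotient_restrictScalars, deltaInvariant]

lemma mul_mem_idealImage {c : B} (hc : ∀ b, ∃ a, algebraMap A B a = c * b) {I : Ideal A} {z : B}
    (hz : z ∈ I.map (algebraMap A B)) : c * z ∈ idealImage k B I := by
  refine Submodule.span_induction (p := fun z _ => ∀ b : B, c * (b * z) ∈ idealImage k B I)
    ?_ ?_ ?_ ?_ hz 1 |> (by simpa using ·)
  · rintro _ ⟨x, hx, rfl⟩ b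
    obtain ⟨a, ha⟩ := hc b
    refine mem_idealImage.mpr ⟨a * x, I.mul_mem_left a hx, ?_⟩
    rw [map_mul, ha, mul_assoc]
  · intro b
    simp
  · intro y z _ _ hy hz b
    rw [mul_add, mul_add]
    exact add_mem (hy b) (hz b)
  · intro r z _ hz b
    rw [smul_eq_mul, ← mul_assoc b]
    exact hz _

variable (k) in
/-- The relation `I' = c I` between ideals `I` and `I'` of `A`, for `c ∈ B`. -/
def IsScaledBy (c : B) (I I' : Ideal A) : Prop :=
  idealImage k B I' = (idealImage k B I).map (LinearMap.mulLeft k c)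

namespace IsScaledBy

variable {c : B} {I I' : Ideal A}

lemma map_eq (h : IsScaledBy k c I I') :
    I'.map (algebraMap A B) = Ideal.span {c} * I.map (algebraMap A B) := by
  rw [← span_idealImage (k := k), ← span_idealImage (k := k), h, Ideal.span_mul_span']
  congr 1
  ext b
  simp

lemma length_quotient (h : IsScaledBy k c I I') (hc : c ∈ nonZeroDivisors B)
    (hinj : Function.Injective (algebraMap A B)) (hδ : deltaInvariant k A B ≠ ⊤) :
    Module.length k (A ⧸ I') =
      Module.length k (A ⧸ I) + Module.length k (B ⧸ Ideal.span {c}) := by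
  have h' := length_quotient_idealImage (k := k) hinj I'
  rw [h, length_quotient_map _ (mulLeft_injective hc), length_quotient_idealImage hinj,
    range_mulLeft, length_quotient_restrictScalars, add_right_comm] at h'
  exact (ENat.add_left_injective_of_ne_top hδ h').symm

end IsScaledBy

end IdealImage

/-- Over a field, `I` and `c I` are images of each other under linear maps that do not depend
on `I`. -/
lemma exists_linearMap_of_isScaledBy {k A B : Type*} [Field k] [CommRing A] [CommRing B]
    [Algebra k A] [Algebra k B] [Algebra A B] [IsScalarTower k A B] {c : B}
    (hc : c ∈ nonZeroDivisors B) (hinj : Function.Injective (algebraMap A B)) :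
    ∃ L L' : A →ₗ[k] A, ∀ I I' : Ideal A, IsScaledBy k c I I' →
      I'.restrictScalars k = (I.restrictScalars k).map L ∧
      I.restrictScalars k = (I'.restrictScalars k).map L' := by
  let l : A →ₗ[k] B := inclusionMap k A B
  let l' : A →ₗ[k] B := LinearMap.mulLeft k c ∘ₗ l
  have hl' : Function.Injective l' := (mulLeft_injective (k := k) hc).comp hinj
  obtain ⟨ρ, hρ⟩ := l.exists_leftInverse_of_injective (LinearMap.ker_eq_bot.mpr hinj)
  obtain ⟨ρ', hρ'⟩ := l'.exists_leftInverse_of_injective (LinearMap.ker_eq_bot.mpr hl')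
  refine ⟨ρ ∘ₗ l', ρ' ∘ₗ l, fun I I' h => ?_⟩
  have hmap : (I'.restrictScalars k).map l = (I.restrictScalars k).map l' := by
    rw [Submodule.map_comp]
    exact h
  constructor
  · rw [Submodule.map_comp, ← hmap, ← Submodule.map_comp, hρ, Submodule.map_id]
  · rw [Submodule.map_comp, hmap, ← Submodule.map_comp, hρ', Submodule.map_id]

section UniformizingSystem

variable {ι : Type*} [Fintype ι]

/-- A uniformizing system for `A ⊆ B`, where `B` has the role of the normalization of a curve
singularity `A`: the `t i` generate the maximal ideals of `B`, the monomial `powProd t γ` lies in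
the conductor of `A` in `B`, and `t i` is congruent to `1` modulo the part of `powProd t γ` that is
prime to `t i`. -/
structure IsUniformizingSystem (k A : Type*) {B : Type*} [CommRing k] [CommRing A] [CommRing B]
    [Algebra k A] [Algebra k B] [Algebra A B] (t : ι → B) (γ : ι → ℕ) : Prop where
  injective : Function.Injective (algebraMap A B)
  regular : ∀ i, t i ∈ nonZeroDivisors B
  length_quotient : ∀ i, Module.length k (B ⧸ Ideal.span {t i}) = 1
  conductor : ∀ b, ∃ a, algebraMap A B a = powProd t γ * b
  dvd_sub_one : ∀ i, powProd t γ ∣ (t i - 1) * t i ^ γ i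
  exists_map_eq : ∀ I : Ideal A, Module.Finite k (A ⧸ I) →
    ∃ a, I.map (algebraMap A B) = Ideal.span {powProd t a}
  le_of_dvd : ∀ a b, powProd t a ∣ powProd t b → a ≤ b

namespace IsUniformizingSystem

variable {k A B : Type*} [CommRing k] [CommRing A] [CommRing B] [Algebra k A] [Algebra k B]
  [Algebra A B] {t : ι → B} {γ : ι → ℕ}

lemma length_quotient_powProd (H : IsUniformizingSystem k A t γ) (a : ι → ℕ) :
    Module.length k (B ⧸ Ideal.span {powProd t a}) = (∑ i, a i : ℕ) := by
  rw [powProd, length_quotient_span_prod fun i => pow_mem (H.regular i) _, Nat.cast_sum]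
  refine Finset.sum_congr rfl fun i _ => ?_
  rw [length_quotient_span_pow (H.regular i), H.length_quotient, mul_one]

lemma eq_of_span_eq (H : IsUniformizingSystem k A t γ) {a b : ι → ℕ}
    (h : Ideal.span {powProd t a} = Ideal.span {powProd t b}) : a = b :=
  le_antisymm (H.le_of_dvd _ _ (Ideal.span_singleton_le_span_singleton.mp h.ge))
    (H.le_of_dvd _ _ (Ideal.span_singleton_le_span_singleton.mp h.le))

lemma exists_algebraMap_eq_sub_one_mul (H : IsUniformizingSystem k A t γ) {a : ι → ℕ} {i : ι}
    (hi : γ i ≤ a i) (b : B) :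
    ∃ x, algebraMap A B x = (t i - 1) * (powProd t a * b) := by
  obtain ⟨c, hc⟩ := H.dvd_sub_one i
  obtain ⟨e, he⟩ := pow_dvd_powProd t hi
  obtain ⟨x, hx⟩ := H.conductor (c * e * b)
  refine ⟨x, ?_⟩
  rw [hx, he]
  linear_combination (- e * b) * hc

variable [IsScalarTower k A B]

lemma deltaInvariant_ne_top (H : IsUniformizingSystem k A t γ) : deltaInvariant k A B ≠ ⊤ := by
  have hle : deltaInvariant k A B ≤
      Module.length k (B ⧸ (Ideal.span {powProd t γ}).restrictScalars k) :=
    length_quotient_mono fun y hy => by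
      obtain ⟨b, rfl⟩ := Ideal.mem_span_singleton.mp hy
      exact H.conductor b
  rw [length_quotient_restrictScalars, H.length_quotient_powProd] at hle
  exact ne_top_of_le_ne_top (ENat.natCast_ne_top _) hle

section Bounds

variable {I : Ideal A} {a : ι → ℕ} {d : ℕ}

lemma length_quotient_idealImage_eq (H : IsUniformizingSystem k A t γ)
    (hI : Module.length k (A ⧸ I) = d) :
    Module.length k (B ⧸ idealImage k B I) = (d + (deltaInvariant k A B).toNat : ℕ) := by
  rw [length_quotient_idealImage H.injective, hI, Nat.cast_add,
    ENat.natCast_toNat H.deltaInvariant_ne_top]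

lemma sum_le (H : IsUniformizingSystem k A t γ) (hI : Module.length k (A ⧸ I) = d)
    (ha : I.map (algebraMap A B) = Ideal.span {powProd t a}) :
    ∑ i, a i ≤ d + (deltaInvariant k A B).toNat := by
  have hle := length_quotient_mono (idealImage_le_map (k := k) (B := B) I)
  rw [length_quotient_restrictScalars, ha, H.length_quotient_powProd,
    H.length_quotient_idealImage_eq hI] at hle
  exact_mod_cast hle

lemma le_sum (H : IsUniformizingSystem k A t γ) (hI : Module.length k (A ⧸ I) = d)
    (ha : I.map (algebraMap A B) = Ideal.span {powProd t a}) :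
    d + (deltaInvariant k A B).toNat ≤ ∑ i, a i + ∑ i, γ i := by
  have hle : (Ideal.span {powProd t (a + γ)}).restrictScalars k ≤ idealImage k B I := fun y hy => by
    obtain ⟨b, rfl⟩ := Ideal.mem_span_singleton.mp hy
    rw [powProd_add, mul_comm (powProd t a), mul_assoc]
    refine mul_mem_idealImage H.conductor ?_
    rw [ha]
    exact Ideal.mem_span_singleton.mpr ⟨b, rfl⟩
  have hlen := length_quotient_mono hle
  rw [length_quotient_restrictScalars, H.length_quotient_powProd,
    H.length_quotient_idealImage_eq hI] at hlen
  simp only [Pi.add_apply, Finset.sum_add_distrib] at hlen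
  exact_mod_cast hlen

end Bounds

variable {i : ι} {I I' : Ideal A} {a : ι → ℕ}

lemma length_of_isScaledBy (H : IsUniformizingSystem k A t γ) (h : IsScaledBy k (t i) I I') :
    Module.length k (A ⧸ I') = Module.length k (A ⧸ I) + 1 := by
  rw [h.length_quotient (H.regular i) H.injective H.deltaInvariant_ne_top, H.length_quotient]

/-- Modulo the conductor, `t i` is `1` on the multiples of `powProd t a`, so that `t i I` lies
in `A`. -/
lemma exists_isScaledBy (H : IsUniformizingSystem k A t γ) (hi : γ i ≤ a i)
    (ha : I.map (algebraMap A B) = Ideal.span {powProd t a}) :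
    ∃ I', IsScaledBy k (t i) I I' := by
  let l := Algebra.linearMap A B
  refine ⟨((Submodule.map l I).map (LinearMap.mulLeft A (t i))).comap l, ?_⟩
  ext b
  rw [mem_idealImage]
  constructor
  · rintro ⟨x, ⟨_, ⟨y, hy, rfl⟩, hxy⟩, rfl⟩
    exact ⟨_, ⟨y, hy, rfl⟩, hxy⟩
  · rintro ⟨_, ⟨y, hy, rfl⟩, rfl⟩
    obtain ⟨b, hb⟩ := Ideal.mem_span_singleton.mp (ha ▸ Ideal.mem_map_of_mem _ hy)
    obtain ⟨x, hx⟩ := H.exists_algebraMap_eq_sub_one_mul hi b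
    have hxy : algebraMap A B (x + y) = t i * algebraMap A B y := by
      rw [map_add, hx, ← hb]
      ring
    exact ⟨x + y, ⟨_, ⟨y, hy, rfl⟩, hxy.symm⟩, hxy⟩

variable [DecidableEq ι]

lemma exists_isScaledBy_of_add_single (H : IsUniformizingSystem k A t γ) (hi : γ i ≤ a i)
    (ha : I'.map (algebraMap A B) = Ideal.span {powProd t (a + Pi.single i 1)}) :
    ∃ I, IsScaledBy k (t i) I I' := by
  let l := Algebra.linearMap A B
  refine ⟨((Submodule.map l I').comap (LinearMap.mulLeft A (t i))).comap l, ?_⟩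
  ext b
  rw [mem_idealImage]
  constructor
  · rintro ⟨z, hz, rfl⟩
    obtain ⟨b, hb⟩ := Ideal.mem_span_singleton.mp (ha ▸ Ideal.mem_map_of_mem _ hz)
    rw [powProd_add_single] at hb
    obtain ⟨x, hx⟩ := H.exists_algebraMap_eq_sub_one_mul hi b
    have hzx : t i * algebraMap A B (z - x) = algebraMap A B z := by
      rw [map_sub, hx, hb]
      ring
    exact ⟨_, ⟨z - x, ⟨z, hz, hzx.symm⟩, rfl⟩, hzx⟩
  · rintro ⟨_, ⟨y, ⟨z, hz, hzy⟩, rfl⟩, rfl⟩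
    exact ⟨z, hz, hzy⟩

lemma map_eq_span_add_single_iff (H : IsUniformizingSystem k A t γ)
    (h : IsScaledBy k (t i) I I') :
    I'.map (algebraMap A B) = Ideal.span {powProd t (a + Pi.single i 1)} ↔
      I.map (algebraMap A B) = Ideal.span {powProd t a} := by
  rw [h.map_eq, powProd_add_single, mul_comm (powProd t a),
    ← Ideal.span_singleton_mul_span_singleton]
  exact span_singleton_mul_inj (H.regular i)

end IsUniformizingSystem

end UniformizingSystem

/-! ### Stratification by the ideal generated in the normalization -/

namespace ColengthIdeal

variable {k A : Type u} [Field k] [CommRing A] [Algebra k A] {d : ℕ}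

section

variable {N : Ideal A} [Module.Finite k (A ⧸ N)]

lemma finite (I : ColengthIdeal k N d) : Module.Finite k (A ⧸ I.1) :=
  Module.Finite.of_surjective (Ideal.Quotient.factorₐ k I.2.2).toLinearMap
    (Ideal.Quotient.factor_surjective I.2.2)

lemma length_quotient (I : ColengthIdeal k N d) : Module.length k (A ⧸ I.1) = d := by
  have := I.finite
  rw [Module.length_eq_finrank, I.2.1]

end

lemma finrank_eq_of_length_eq {V : Type*} [AddCommGroup V] [Module k V]
    (h : Module.length k V = d) : Module.finrank k V = d := by
  have hne : Module.length k V ≠ ⊤ := h ▸ ENat.natCast_ne_top d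
  have := (isFiniteLength_iff_isNoetherian_isArtinian.mp (Module.length_ne_top_iff.mp hne)).1
  rw [Module.length_eq_finrank] at h
  exact_mod_cast h

/-- An ideal of colength `d` of a Noetherian local ring, which contains the `d`-th power of the
maximal ideal, as a point of the punctual Hilbert scheme. -/
def ofLengthEq [IsLocalRing A] [IsNoetherianRing A] (I : Ideal A)
    (h : Module.length k (A ⧸ I) = d) : ColengthIdeal k (IsLocalRing.maximalIdeal A ^ d) d :=
  ⟨I, finrank_eq_of_length_eq h, maximalIdeal_pow_le_of_length_quotient_eq h⟩

end ColengthIdeal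

section Strata

variable {ι : Type*} [Fintype ι] {k A : Type u} [Field k] [CommRing A] [Algebra k A]
  {B : Type*} [CommRing B] [Algebra k B] [Algebra A B] {t : ι → B} {γ : ι → ℕ}

/-- The ideals of colength `d` that generate the ideal `(powProd t a)` of `B`. -/
def stratum (t : ι → B) (N : Ideal A) (d : ℕ) (a : ι → ℕ) : Set (ColengthIdeal k N d) :=
  {I | I.1.map (algebraMap A B) = Ideal.span {powProd t a}}

namespace IsUniformizingSystem

section

variable {N : Ideal A} [Module.Finite k (A ⧸ N)] {d : ℕ}

lemma stratum_eq [DecidableEq ι] (H : IsUniformizingSystem k A t γ) (a : ι → ℕ) :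
    (stratum t N d a : Set (ColengthIdeal k N d)) =
      {I | I.1.map (algebraMap A B) ≤ Ideal.span {powProd t a}} ∩
        ⋂ i ∈ (Finset.univ : Finset ι),
          {I | I.1.map (algebraMap A B) ≤ Ideal.span {powProd t (a + Pi.single i 1)}}ᶜ := by
  ext I
  obtain ⟨b, hb⟩ := H.exists_map_eq I.1 I.finite
  simp only [stratum, Set.mem_inter_iff, Set.mem_ofPred_eq, hb, Set.mem_iInter, Set.mem_compl_iff,
    Ideal.span_singleton_le_span_singleton]
  constructor
  · intro h
    obtain rfl := H.eq_of_span_eq h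
    exact ⟨dvd_rfl, fun i _ hi => by simpa using H.le_of_dvd _ _ hi i⟩
  · rintro ⟨hab, hlt⟩
    obtain ⟨c, rfl⟩ := exists_add_of_le (H.le_of_dvd _ _ hab)
    suffices c = 0 by rw [this, add_zero]
    by_contra hc
    obtain ⟨i, hi⟩ := Function.ne_iff.mp hc
    obtain ⟨c, rfl⟩ := exists_eq_add_single hi
    refine hlt i (Finset.mem_univ i) ⟨powProd t c, ?_⟩
    rw [← powProd_add, add_assoc, add_comm c]

variable [IsScalarTower k A B]

lemma isClopenFor_stratum (H : IsUniformizingSystem k A t γ) (a : ι → ℕ) :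
    IsClopenFor (invClosure (pluckerAlgebra k N d)) (stratum t N d a) := by
  classical
  have hle (b : B) : IsClopenFor (invClosure (pluckerAlgebra k N d))
      {I : ColengthIdeal k N d | I.1.map (algebraMap A B) ≤ Ideal.span {b}} := by
    simp only [map_le_iff_le_comap_inclusionMap (k := k)]
    exact isClopenFor_colengthIdeal_le _
  rw [H.stratum_eq]
  exact (hle _).inter (.biInter _ fun i _ => (hle _).compl)

lemma le_of_mem_stratum (H : IsUniformizingSystem k A t γ) {I : ColengthIdeal k N d} {a : ι → ℕ}
    (hI : I ∈ stratum t N d a) (i : ι) : a i ≤ d + (deltaInvariant k A B).toNat :=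
  (Finset.single_le_sum (f := a) (fun _ _ => Nat.zero_le _) (Finset.mem_univ i)).trans
    (H.sum_le I.length_quotient hI)

lemma exists_mem_arrayBox_mem_stratum [DecidableEq ι] (H : IsUniformizingSystem k A t γ)
    (I : ColengthIdeal k N d) :
    ∃ a ∈ arrayBox ι (deltaInvariant k A B).toNat d, I ∈ stratum t N d a := by
  obtain ⟨a, ha⟩ := H.exists_map_eq I.1 I.finite
  exact ⟨a, mem_arrayBox.mpr (H.le_of_mem_stratum ha), ha⟩

variable [IsAlgClosed k]

lemma exists_hasClass_stratum (H : IsUniformizingSystem k A t γ) (N : Ideal A)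
    [Module.Finite k (A ⧸ N)] (d : ℕ) (a : ι → ℕ) :
    ∃ m, HasClass (pluckerAlgebra k N d) (stratum t N d a) m := by
  obtain ⟨m, _, hm, -, -⟩ :=
    hasClass_idealVariety.exists_inter_sdiff (H.isClopenFor_stratum a (N := N) (d := d))
  exact ⟨m, by rwa [Set.univ_inter] at hm⟩

/-- The class of a stratum in the Grothendieck ring. -/
def stratumClass (H : IsUniformizingSystem k A t γ) (N : Ideal A) [Module.Finite k (A ⧸ N)]
    (d : ℕ) (a : ι → ℕ) : K0 k :=
  (H.exists_hasClass_stratum N d a).choose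

lemma hasClass_stratumClass (H : IsUniformizingSystem k A t γ) (N : Ideal A)
    [Module.Finite k (A ⧸ N)] (d : ℕ) (a : ι → ℕ) :
    HasClass (pluckerAlgebra k N d) (stratum t N d a) (H.stratumClass N d a) :=
  (H.exists_hasClass_stratum N d a).choose_spec

lemma stratumClass_eq (H : IsUniformizingSystem k A t γ) {m : K0 k} {a : ι → ℕ}
    (h : HasClass (pluckerAlgebra k N d) (stratum t N d a) m) : H.stratumClass N d a = m :=
  (H.hasClass_stratumClass N d a).unique h pluckerAlgebra_fg pluckerAlgebra_fg
    (le_invClosure _) (le_invClosure _)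

lemma stratum_nonempty (H : IsUniformizingSystem k A t γ) {a : ι → ℕ}
    (h : H.stratumClass N d a ≠ 0) :
    (stratum t N d a : Set (ColengthIdeal k N d)).Nonempty := by
  by_contra hempty
  refine h (H.stratumClass_eq ?_)
  rw [Set.not_nonempty_iff_eq_empty.mp hempty]
  exact HasClass.empty _

lemma cls_idealVariety_eq_sum [DecidableEq ι] (H : IsUniformizingSystem k A t γ) (N : Ideal A)
    [Module.Finite k (A ⧸ N)] (d : ℕ) :
    (idealVariety k (A ⧸ N) d).cls =
      ∑ a ∈ arrayBox ι (deltaInvariant k A B).toNat d, H.stratumClass N d a := by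
  have hdisj : (arrayBox ι (deltaInvariant k A B).toNat d : Set (ι → ℕ)).PairwiseDisjoint
      (stratum t N d : (ι → ℕ) → Set (ColengthIdeal k N d)) := fun a _ b _ hab =>
    Set.disjoint_left.mpr fun I ha hb => hab (H.eq_of_span_eq (ha.symm.trans hb))
  have hcover : (Set.univ : Set (ColengthIdeal k N d)) =
      ⋃ a ∈ arrayBox ι (deltaInvariant k A B).toNat d, stratum t N d a :=
    (Set.eq_univ_of_forall fun I => Set.mem_iUnion₂.mpr <| by
      simpa only [exists_prop] using H.exists_mem_arrayBox_mem_stratum I).symm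
  obtain ⟨c, hc, hsum⟩ := hasClass_idealVariety.sum_partition _ _
    (fun a _ => H.isClopenFor_stratum a) hdisj hcover
  rw [hsum]
  exact Finset.sum_congr rfl fun a ha => (H.stratumClass_eq (hc a ha)).symm

end

variable [IsScalarTower k A B] [IsLocalRing A] [IsNoetherianRing A]
  [∀ d, Module.Finite k (A ⧸ IsLocalRing.maximalIdeal A ^ d)]

open IsLocalRing

section

variable {i : ι} {a : ι → ℕ} {d : ℕ}

lemma exists_isScaledBy_mem_stratum (H : IsUniformizingSystem k A t γ) (hi : γ i ≤ a i)
    {I : ColengthIdeal k (maximalIdeal A ^ d) d} (hI : I ∈ stratum t (maximalIdeal A ^ d) d a) :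
    ∃ I' : ColengthIdeal k (maximalIdeal A ^ (d + 1)) (d + 1), IsScaledBy k (t i) I.1 I'.1 := by
  obtain ⟨I', hI'⟩ := H.exists_isScaledBy hi hI
  have hlen := H.length_of_isScaledBy hI'
  rw [I.length_quotient] at hlen
  exact ⟨.ofLengthEq I' hlen, hI'⟩

variable [DecidableEq ι]

lemma exists_isScaledBy_of_mem_stratum_add_single (H : IsUniformizingSystem k A t γ)
    (hi : γ i ≤ a i) {I' : ColengthIdeal k (maximalIdeal A ^ (d + 1)) (d + 1)}
    (hI' : I' ∈ stratum t (maximalIdeal A ^ (d + 1)) (d + 1) (a + Pi.single i 1)) :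
    ∃ I : ColengthIdeal k (maximalIdeal A ^ d) d, IsScaledBy k (t i) I.1 I'.1 := by
  obtain ⟨I, hI⟩ := H.exists_isScaledBy_of_add_single hi hI'
  have hlen := H.length_of_isScaledBy hI
  rw [I'.length_quotient, Nat.cast_add, Nat.cast_one] at hlen
  exact ⟨.ofLengthEq I (ENat.add_left_injective_of_ne_top ENat.one_ne_top hlen).symm, hI⟩

variable [IsAlgClosed k]

/-- Multiplication by `t i` identifies the two strata. -/
lemma stratumClass_add_single (H : IsUniformizingSystem k A t γ) (hi : γ i ≤ a i) (d : ℕ) :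
    H.stratumClass (maximalIdeal A ^ (d + 1)) (d + 1) (a + Pi.single i 1) =
      H.stratumClass (maximalIdeal A ^ d) d a := by
  let E := {p : ColengthIdeal k (maximalIdeal A ^ d) d ×
      ColengthIdeal k (maximalIdeal A ^ (d + 1)) (d + 1) //
    IsScaledBy k (t i) p.1.1 p.2.1 ∧ p.1 ∈ stratum t (maximalIdeal A ^ d) d a}
  have hfst : Set.range (fun p : E => p.1.1) = stratum t (maximalIdeal A ^ d) d a := by
    ext I
    refine ⟨?_, fun hI => ?_⟩
    · rintro ⟨p, rfl⟩
      exact p.2.2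
    · obtain ⟨I', hI'⟩ := H.exists_isScaledBy_mem_stratum hi hI
      exact ⟨⟨(I, I'), hI', hI⟩, rfl⟩
  have hsnd : Set.range (fun p : E => p.1.2) =
      stratum t (maximalIdeal A ^ (d + 1)) (d + 1) (a + Pi.single i 1) := by
    ext I'
    refine ⟨?_, fun hI' => ?_⟩
    · rintro ⟨p, rfl⟩
      exact (H.map_eq_span_add_single_iff p.2.1).mpr p.2.2
    · obtain ⟨I, hI⟩ := H.exists_isScaledBy_of_mem_stratum_add_single hi hI'
      exact ⟨⟨(I, I'), hI, (H.map_eq_span_add_single_iff hI).mp hI'⟩, rfl⟩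
  obtain ⟨L, L', hL⟩ := exists_linearMap_of_isScaledBy (k := k) (H.regular i) H.injective
  have hclass := H.hasClass_stratumClass (maximalIdeal A ^ d) d a
  have hclass' := H.hasClass_stratumClass (maximalIdeal A ^ (d + 1)) (d + 1) (a + Pi.single i 1)
  rw [← hfst] at hclass
  rw [← hsnd] at hclass'
  exact (hclass.eq_of_linear hclass' L L' (fun p => (hL _ _ p.2.1).1)
    fun p => (hL _ _ p.2.1).2).symm

lemma isEventuallyShiftInvariant_stratumClass (H : IsUniformizingSystem k A t γ) :
    IsEventuallyShiftInvariant γ (deltaInvariant k A B).toNat (∑ i, γ i) ∅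
      (fun a d => H.stratumClass (maximalIdeal A ^ d) d a) where
  le_of_ne_zero a d h i := by
    obtain ⟨I, hI⟩ := H.stratum_nonempty h
    exact H.le_of_mem_stratum hI i
  le_sum_of_ne_zero a d h := by
    obtain ⟨I, hI⟩ := H.stratum_nonempty h
    exact H.le_sum I.length_quotient hI
  eq_zero_of_ne_zero a ha := by
    by_contra h
    obtain ⟨I, hI⟩ := H.stratum_nonempty h
    have htop : I.1 = ⊤ := top_le_iff.mp (by simpa [pow_zero, Ideal.one_eq_top] using I.2.2)
    refine ha (H.eq_of_span_eq (hI.symm.trans ?_))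
    rw [htop, Ideal.map_top, powProd_zero, Ideal.span_singleton_one]
  shift i _ a d hi := H.stratumClass_add_single hi d
  eq_zero i hi := by simp at hi

end

theorem exists_polynomial [IsAlgClosed k] (H : IsUniformizingSystem k A t γ) :
    ∃ P : Polynomial (K0 k),
      (PowerSeries.mk fun d => (idealVariety k (A ⧸ maximalIdeal A ^ d) d).cls) *
        (1 - PowerSeries.X) ^ Fintype.card ι = (P : PowerSeries (K0 k)) := by
  classical
  obtain ⟨P, hP⟩ := H.isEventuallyShiftInvariant_stratumClass.exists_polynomial
  refine ⟨P, ?_⟩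
  rw [← hP]
  congr 2
  ext d
  exact H.cls_idealVariety_eq_sum _ d

end IsUniformizingSystem

end Strata

/-! ### Principal maximal ideals -/

section Principal

variable {B : Type*} [CommRing B]

/-- Nakayama's lemma gives an `r ∈ 1 + n` that maps `n` into `(t)`. Hence the ideal of all such `r`
is contained neither in `n` nor, since it contains `t`, in another maximal ideal. -/
lemma eq_span_singleton_of_le_sup_mul {n : Ideal B} (hn : n.IsMaximal) (hfg : n.FG) {t : B}
    (htn : t ∈ n) (hle : n ≤ Ideal.span {t} ⊔ n * n)
    (ht : ∀ n' : Ideal B, n'.IsMaximal → t ∈ n' → n' = n) : n = Ideal.span {t} := by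
  refine le_antisymm ?_ ((Ideal.span_singleton_le_iff_mem n).mpr htn)
  obtain ⟨r, hr, hrn⟩ := Submodule.exists_sub_one_mem_and_smul_le_of_fg_of_le_sup hfg le_rfl hle
  let S : Ideal B := (Ideal.span {t}).colon (n : Set B)
  have htS : t ∈ S := Submodule.mem_colon.mpr fun p _ =>
    Ideal.mul_mem_right _ _ (Ideal.mem_span_singleton_self t)
  have hrS : r ∈ S := Submodule.mem_colon.mpr fun p hp => hrn ⟨p, hp, rfl⟩
  have hS : S = ⊤ := by
    by_contra hne
    obtain ⟨n', hn', hSn⟩ := Ideal.exists_le_maximal S hne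
    obtain rfl := ht n' hn' (hSn htS)
    exact hn.ne_top ((Ideal.eq_top_iff_one _).mpr (by simpa using sub_mem (hSn hrS) hr))
  intro w hw
  simpa using Submodule.mem_colon.mp (hS ▸ Submodule.mem_top : (1 : B) ∈ S) w hw

lemma exists_le_span_singleton_sup_mul {n J : Ideal B} (hn : n.IsMaximal) {y z : B} (hz : z ∈ n)
    (hy : y ∉ n) (h : ∀ w ∈ n, z ∣ y * w) (hJ : n ⊔ J = ⊤) :
    ∃ t ∈ n, t - 1 ∈ J ∧ n ≤ Ideal.span {t} ⊔ n * n := by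
  have hJ2 : n * n ⊔ J = ⊤ := by rw [← pow_two, Ideal.pow_sup_eq_top hJ]
  obtain ⟨e', he', e, he, hee⟩ := Submodule.mem_sup.mp ((Ideal.eq_top_iff_one _).mp hJ2)
  obtain ⟨α, ν, hν, hαν⟩ := hn.exists_inv hy
  refine ⟨e * z + e', add_mem (n.mul_mem_left e hz) (Ideal.mul_le_right he'), ?_, fun w hw => ?_⟩
  · rw [show e * z + e' - 1 = (z - 1) * e by linear_combination hee]
    exact J.mul_mem_left _ he
  · obtain ⟨v, hv⟩ := h w hw
    have hw' : w = (e * z + e') * (α * v) + (e' * (z * (α * v)) - e' * (α * v) + ν * w) := by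
      linear_combination (-w) * hαν + α * hv + (- z * α * v) * hee
    rw [hw']
    refine Submodule.add_mem_sup (Ideal.mul_mem_right _ _ (Ideal.mem_span_singleton_self _)) ?_
    exact add_mem (sub_mem (Ideal.mul_mem_right _ _ he') (Ideal.mul_mem_right _ _ he'))
      (Ideal.mul_mem_mul hν hw)

/-- The hypotheses on `y` and `z` say that `z` generates `n` locally at `n`. -/
lemma exists_eq_span_singleton_of_dvd_mul {n J : Ideal B} (hn : n.IsMaximal) (hfg : n.FG)
    {y z : B} (hz : z ∈ n) (hy : y ∉ n) (h : ∀ w ∈ n, z ∣ y * w) (hJ : n ⊔ J = ⊤)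
    (hJ' : ∀ n' : Ideal B, n'.IsMaximal → n' ≠ n → J ≤ n') :
    ∃ t, n = Ideal.span {t} ∧ t - 1 ∈ J := by
  obtain ⟨t, htn, htJ, hle⟩ := exists_le_span_singleton_sup_mul hn hz hy h hJ
  refine ⟨t, eq_span_singleton_of_le_sup_mul hn hfg htn hle fun n' hn' ht => ?_, htJ⟩
  by_contra hne
  refine hn'.ne_top ((Ideal.eq_top_iff_one _).mpr ?_)
  simpa using sub_mem ht (hJ' n' hn' hne htJ)

lemma exists_eq_span_singleton_mul {x : B} {J : Ideal B} (h : J ≤ Ideal.span {x}) :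
    ∃ J', J = Ideal.span {x} * J' := by
  let l := LinearMap.mulLeft B x
  have hJ : J ≤ l.range := h.trans (range_mulLeft (k := B) x).ge
  refine ⟨Submodule.comap l J, ?_⟩
  exact (Submodule.map_comap_eq_of_le hJ).symm.trans
    (map_mulLeft_restrictScalars x (Submodule.comap l J))

lemma exists_not_dvd_forall_dvd_mul {c : B} [IsArtinianRing (B ⧸ Ideal.span {c})] {n : Ideal B}
    (hn : n ≠ ⊤) (hc : c ∈ n) : ∃ b, ¬ c ∣ b ∧ ∀ w ∈ n, c ∣ b * w := by
  let q := Ideal.Quotient.mk (Ideal.span {c})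
  have hq (b : B) : q b = 0 ↔ c ∣ b := by
    rw [Ideal.Quotient.eq_zero_iff_mem, Ideal.mem_span_singleton]
  have hne : n.map q ≠ ⊤ := by
    have hker : RingHom.ker q ≤ n := by rwa [Ideal.mk_ker, Ideal.span_singleton_le_iff_mem]
    rwa [Ne, Ideal.map_eq_top_iff_of_ker_le q hker
      (q.isIntegral_of_surjective Ideal.Quotient.mk_surjective)]
  have hdisj : Disjoint (n.map q : Set (B ⧸ Ideal.span {c}))
      (nonZeroDivisors (B ⧸ Ideal.span {c})) :=
    Set.disjoint_left.mpr fun x hx hx' =>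
      hne (Ideal.eq_top_of_isUnit_mem _ hx (IsArtinianRing.isUnit_of_mem_nonZeroDivisors hx'))
  obtain ⟨b, hb, hb0⟩ := SetLike.exists_of_lt
    (Ideal.bot_lt_annihilator_of_disjoint_nonZeroDivisors hdisj)
  obtain ⟨b, rfl⟩ := Ideal.Quotient.mk_surjective b
  refine ⟨b, fun h => hb0 ((hq b).mpr h), fun w hw => (hq _).mp ?_⟩
  rw [map_mul]
  exact Submodule.mem_annihilator.mp hb _ (Ideal.mem_map_of_mem _ hw)

end Principal

/-! ### Uniformizing systems of curve normalizations -/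

section Normalization

variable {k A B : Type*} [Field k] [CommRing A] [Algebra k A] [CommRing B] [Algebra A B]

lemma finite_quotient_map [Algebra k B] [IsScalarTower k A B] [Module.Finite A B] (I : Ideal A)
    [Module.Finite k (A ⧸ I)] : Module.Finite k (B ⧸ I.map (algebraMap A B)) := by
  have : Module.Finite (A ⧸ I) (B ⧸ I.map (algebraMap A B)) :=
    Module.Finite.of_restrictScalars_finite A _ _
  have : IsScalarTower k (A ⧸ I) (B ⧸ I.map (algebraMap A B)) :=
    IsScalarTower.of_algebraMap_eq fun x =>
      congrArg (Ideal.Quotient.mk _) (IsScalarTower.algebraMap_apply k A B x)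
  exact Module.Finite.trans (A ⧸ I) _

lemma finite_quotient_of_le [Algebra k B] {I J : Ideal B} (h : I ≤ J) [Module.Finite k (B ⧸ I)] :
    Module.Finite k (B ⧸ J) :=
  .of_surjective (Ideal.Quotient.factorₐ k h).toLinearMap (Ideal.Quotient.factor_surjective h)

lemma length_quotient_of_isMaximal [IsAlgClosed k] [Algebra k B] (n : Ideal B) [n.IsMaximal]
    [Module.Finite k (B ⧸ n)] : Module.length k (B ⧸ n) = 1 := by
  have hb := IsAlgClosed.algebraMap_bijective_of_isIntegral (k := k) (K := B ⧸ n)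
  rw [← (LinearEquiv.ofBijective (Algebra.linearMap k (B ⧸ n)) hb).length_eq,
    Module.length_eq_one]

lemma comap_eq_maximalIdeal [IsLocalRing A] [Module.Finite A B] (n : Ideal B) [n.IsMaximal] :
    n.comap (algebraMap A B) = IsLocalRing.maximalIdeal A :=
  IsLocalRing.eq_maximalIdeal (Ideal.isMaximal_comap_of_isIntegral_of_isMaximal n)

variable (A B) in
lemma finite_maximalSpectrum [IsLocalRing A] [Module.Finite A B] :
    Finite (MaximalSpectrum B) := by
  have := (Algebra.QuasiFinite.finite_primesOver (S := B) (IsLocalRing.maximalIdeal A)).to_subtype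
  exact .of_injective (β := (IsLocalRing.maximalIdeal A).primesOver B)
    (fun n => ⟨n.asIdeal, n.isMaximal.isPrime, ⟨(comap_eq_maximalIdeal n.asIdeal).symm⟩⟩)
    fun n n' h => MaximalSpectrum.ext (congrArg Subtype.val h)

lemma span_powProd {ι : Type*} [Fintype ι] (t : ι → B) (a : ι → ℕ) :
    Ideal.span {powProd t a} = ∏ i, Ideal.span {t i} ^ a i := by
  simp only [powProd, Ideal.span_singleton_pow, Ideal.prod_span_singleton]

lemma le_of_powProd_dvd [Fintype (MaximalSpectrum B)] {t : MaximalSpectrum B → B}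
    (ht : ∀ i, i.asIdeal = Ideal.span {t i}) (hreg : ∀ i, t i ∈ nonZeroDivisors B)
    (a b : MaximalSpectrum B → ℕ) (h : powProd t a ∣ powProd t b) : a ≤ b := by
  classical
  intro i
  by_contra! hlt
  obtain ⟨c, hc⟩ := (pow_dvd_powProd t (Nat.succ_le_of_lt hlt)).trans h
  rw [powProd, ← Finset.mul_prod_erase _ _ (Finset.mem_univ i), pow_succ, mul_assoc,
    mul_cancel_left_mem_nonZeroDivisors (pow_mem (hreg i) _)] at hc
  have hp : i.asIdeal.IsPrime := i.isMaximal.isPrime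
  have hmem : ∏ j ∈ Finset.univ.erase i, t j ^ b j ∈ i.asIdeal := by
    rw [ht, Ideal.mem_span_singleton]
    exact ⟨c, hc⟩
  obtain ⟨j, hj, hji⟩ := hp.prod_mem_iff.mp hmem
  have hle : j.asIdeal ≤ i.asIdeal := by
    rw [ht j, Ideal.span_singleton_le_iff_mem]
    exact hp.mem_of_pow_mem _ hji
  exact Finset.ne_of_mem_erase hj
    (MaximalSpectrum.ext (j.isMaximal.eq_of_le i.isMaximal.ne_top hle))

lemma exists_eq_span_powProd [IsAlgClosed k] [Algebra k B] [Fintype (MaximalSpectrum B)]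
    {t : MaximalSpectrum B → B}
    (ht : ∀ i, i.asIdeal = Ideal.span {t i}) (hreg : ∀ i, t i ∈ nonZeroDivisors B) (J : Ideal B)
    [Module.Finite k (B ⧸ J)] : ∃ a, J = Ideal.span {powProd t a} := by
  classical
  obtain ⟨d, hd⟩ : ∃ d : ℕ, Module.length k (B ⧸ J) = d := ⟨_, Module.length_eq_finrank k _⟩
  induction d generalizing J with
  | zero =>
    rw [Nat.cast_zero, Module.length_eq_zero_iff, Ideal.Quotient.subsingleton_iff] at hd
    exact ⟨0, by rw [hd, powProd_zero, Ideal.span_singleton_one]⟩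
  | succ d ih =>
    have hne : J ≠ ⊤ := by
      rw [Ne, ← Ideal.Quotient.subsingleton_iff, ← Module.length_eq_zero_iff (R := k), hd]
      exact_mod_cast d.succ_ne_zero
    obtain ⟨n, hn, hJn⟩ := Ideal.exists_le_maximal J hne
    let i : MaximalSpectrum B := ⟨n, hn⟩
    have := finite_quotient_of_le (k := k) hJn
    obtain ⟨J', rfl⟩ := exists_eq_span_singleton_mul (hJn.trans (ht i).le)
    have := finite_quotient_of_le (k := k) (Ideal.mul_le_right : Ideal.span {t i} * J' ≤ J')
    rw [length_quotient_span_mul (hreg i), ← ht i, length_quotient_of_isMaximal n, Nat.cast_succ]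
      at hd
    obtain ⟨a, ha⟩ := ih J' (ENat.add_left_injective_of_ne_top ENat.one_ne_top hd)
    refine ⟨a + Pi.single i 1, ?_⟩
    rw [ha, powProd_add_single, Ideal.span_singleton_mul_span_singleton, mul_comm]

/-- The properties of the normalization `B` of the local ring `A` of a curve singularity that
determine its structure: `c` is a regular element of the conductor, and `B` is closed under
fractions with denominator `c` that stabilize an ideal containing `c`. -/
structure IsCurveNormalization (k : Type*) {A : Type*} (B : Type*) [Field k] [CommRing A]
    [Algebra k A] [CommRing B] [Algebra A B] [IsLocalRing A] (c : A) : Prop where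
  injective : Function.Injective (algebraMap A B)
  mem : c ∈ IsLocalRing.maximalIdeal A
  regular : algebraMap A B c ∈ nonZeroDivisors B
  conductor : ∀ b, ∃ a, algebraMap A B a = algebraMap A B c * b
  finite_quotient : Module.Finite k (A ⧸ Ideal.span {c})
  dvd : ∀ (b : B) (J : Ideal B), algebraMap A B c ∈ J →
    (∀ x ∈ J, ∃ y ∈ J, b * x = algebraMap A B c * y) → algebraMap A B c ∣ b

namespace IsCurveNormalization

variable [IsLocalRing A] [Module.Finite A B] {c : A}

lemma mem_of_isMaximal (H : IsCurveNormalization k B c) {n : Ideal B} (hn : n.IsMaximal) :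
    algebraMap A B c ∈ n := by
  rw [← Ideal.mem_comap, comap_eq_maximalIdeal n]
  exact H.mem

lemma regular_of_eq_span (H : IsCurveNormalization k B c) {n : Ideal B}
    (hn : n.IsMaximal) {t : B} (ht : n = Ideal.span {t}) : t ∈ nonZeroDivisors B := by
  obtain ⟨s, hs⟩ := Ideal.mem_span_singleton.mp (ht ▸ H.mem_of_isMaximal hn)
  exact (mul_mem_nonZeroDivisors.mp (hs ▸ H.regular)).1

variable [Algebra k B] [IsScalarTower k A B]

lemma finite_quotient_span (H : IsCurveNormalization k B c) :
    Module.Finite k (B ⧸ Ideal.span {algebraMap A B c}) := by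
  have := H.finite_quotient
  rw [← Set.image_singleton, ← Ideal.map_span]
  exact finite_quotient_map _

lemma finite_quotient_of_isMaximal (H : IsCurveNormalization k B c) {n : Ideal B}
    (hn : n.IsMaximal) : Module.Finite k (B ⧸ n) := by
  have := H.finite_quotient_span
  exact finite_quotient_of_le ((Ideal.span_singleton_le_iff_mem n).mpr (H.mem_of_isMaximal hn))

/-- Take `b ∉ c B` with `b n ⊆ c B`. The fraction `b / c` does not stabilize `n`, so it sends some
`z ∈ n` to some `y ∉ n`; hence `z` generates `n` locally. -/
lemma exists_forall_dvd_mul (H : IsCurveNormalization k B c) {n : Ideal B} (hn : n.IsMaximal) :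
    ∃ z ∈ n, ∃ y ∉ n, ∀ w ∈ n, z ∣ y * w := by
  have hcn := H.mem_of_isMaximal hn
  have := H.finite_quotient_span
  have : IsArtinianRing (B ⧸ Ideal.span {algebraMap A B c}) := .of_finite k _
  obtain ⟨b, hb, hbn⟩ := exists_not_dvd_forall_dvd_mul hn.ne_top hcn
  obtain ⟨z, hz, y, hy, hzy⟩ : ∃ z ∈ n, ∃ y ∉ n, b * z = algebraMap A B c * y := by
    by_contra! hcon
    refine hb (H.dvd b n hcn fun x hx => ?_)
    obtain ⟨y, hy⟩ := hbn x hx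
    exact ⟨y, by_contra fun hyn => hcon x hx y hyn hy, hy⟩
  refine ⟨z, hz, y, hy, fun w hw => ?_⟩
  obtain ⟨v, hv⟩ := hbn w hw
  refine ⟨v, (mul_cancel_left_mem_nonZeroDivisors H.regular).mp ?_⟩
  linear_combination (- w) * hzy + z * hv

variable [IsNoetherianRing B] [Fintype (MaximalSpectrum B)]

lemma exists_eq_span_singleton [DecidableEq (MaximalSpectrum B)] (H : IsCurveNormalization k B c)
    {γ : MaximalSpectrum B → ℕ} (hγ : ∀ i, γ i ≠ 0) (i : MaximalSpectrum B) :
    ∃ t, i.asIdeal = Ideal.span {t} ∧ t - 1 ∈ ∏ j ∈ Finset.univ.erase i, j.asIdeal ^ γ j := by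
  obtain ⟨z, hz, y, hy, h⟩ := H.exists_forall_dvd_mul i.isMaximal
  refine exists_eq_span_singleton_of_dvd_mul i.isMaximal (IsNoetherian.noetherian _) hz hy h
    (Ideal.sup_prod_eq_top fun j hj => Ideal.sup_pow_eq_top ?_) fun n' hn' hne => ?_
  · exact i.isMaximal.coprime_of_ne j.isMaximal fun he =>
      Finset.ne_of_mem_erase hj (MaximalSpectrum.ext he.symm)
  · have hmem : (⟨n', hn'⟩ : MaximalSpectrum B) ∈ Finset.univ.erase i :=
      Finset.mem_erase.mpr ⟨fun he => hne (congrArg MaximalSpectrum.asIdeal he),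
        Finset.mem_univ _⟩
    exact (Ideal.le_of_dvd (Finset.dvd_prod_of_mem _ hmem)).trans (Ideal.pow_le_self (hγ _))

/-- The exponents `γ i` are enlarged by `1` since `exists_eq_span_singleton` requires `γ i ≠ 0`. -/
theorem exists_isUniformizingSystem [IsAlgClosed k] (H : IsCurveNormalization k B c) :
    ∃ (t : MaximalSpectrum B → B) (γ : MaximalSpectrum B → ℕ), IsUniformizingSystem k A t γ := by
  classical
  choose τ hτ _ using H.exists_eq_span_singleton (γ := fun _ => 1) fun _ => one_ne_zero
  have := H.finite_quotient_span
  obtain ⟨γ, hγ⟩ := exists_eq_span_powProd (k := k) hτ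
    (fun i => H.regular_of_eq_span i.isMaximal (hτ i)) (Ideal.span {algebraMap A B c})
  choose t ht ht1 using H.exists_eq_span_singleton (γ := γ + 1) fun _ => Nat.succ_ne_zero _
  have hreg : ∀ i, t i ∈ nonZeroDivisors B := fun i => H.regular_of_eq_span i.isMaximal (ht i)
  refine ⟨t, γ + 1, ?_⟩
  constructor
  case injective => exact H.injective
  case regular => exact hreg
  case length_quotient =>
    intro i
    have := i.isMaximal
    have := H.finite_quotient_of_isMaximal i.isMaximal
    rw [← ht, length_quotient_of_isMaximal]
  case conductor =>
    have hcγ : algebraMap A B c ∣ powProd t γ := by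
      rw [← Ideal.mem_span_singleton, hγ, span_powProd]
      simp only [← hτ, ht]
      rw [← span_powProd]
      exact Ideal.mem_span_singleton_self _
    obtain ⟨e, he⟩ := hcγ
    intro b
    obtain ⟨a, ha⟩ := H.conductor (e * powProd t 1 * b)
    refine ⟨a, ?_⟩
    rw [ha, powProd_add, he]
    ring
  case dvd_sub_one =>
    intro i
    have hi := ht1 i
    simp only [ht, Ideal.span_singleton_pow, Ideal.prod_span_singleton,
      Ideal.mem_span_singleton] at hi
    rw [powProd, ← Finset.mul_prod_erase _ _ (Finset.mem_univ i), mul_comm]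
    exact mul_dvd_mul_right hi _
  case exists_map_eq =>
    intro I hI
    have := finite_quotient_map (k := k) (B := B) I
    exact exists_eq_span_powProd (k := k) ht hreg _
  case le_of_dvd => exact le_of_powProd_dvd ht hreg

end IsCurveNormalization

end Normalization

section IntegralClosure

lemma isIntegral_of_mul_mem {R K : Type*} [CommRing R] [CommRing K] [Algebra R K]
    (N : Submodule R K) [IsNoetherian R N] {u : K} (hu : IsUnit u) (huN : u ∈ N) {x : K}
    (hx : ∀ y ∈ N, x * y ∈ N) : IsIntegral R x := by
  let S : Subalgebra R K :=
    { carrier := {x | ∀ y ∈ N, x * y ∈ N}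
      mul_mem' := fun ha hb y hy => by rw [mul_assoc]; exact ha _ (hb _ hy)
      add_mem' := fun ha hb y hy => by rw [add_mul]; exact N.add_mem (ha _ hy) (hb _ hy)
      algebraMap_mem' := fun r y hy => by rw [← Algebra.smul_def]; exact N.smul_mem r hy }
  let φ : S →ₗ[R] N :=
    (LinearMap.mulRight R u ∘ₗ S.val.toLinearMap).codRestrict N fun s => s.2 u huN
  have hφ : Function.Injective φ := fun _ _ hab =>
    Subtype.ext (hu.mul_left_injective (congrArg Subtype.val hab))
  exact isIntegral_of_submodule_noetherian S (isNoetherian_of_injective φ hφ) x hx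

lemma dvd_of_forall_mul_eq_mul {R K : Type*} [CommRing R] [CommRing K] [Algebra R K]
    [IsNoetherian R (integralClosure R K)] {b c : integralClosure R K} (hc : IsUnit (c : K))
    {J : Ideal (integralClosure R K)} (hcJ : c ∈ J) (h : ∀ x ∈ J, ∃ y ∈ J, b * x = c * y) :
    c ∣ b := by
  obtain ⟨v, hv⟩ := hc.exists_right_inv
  let N : Submodule R K := (J.restrictScalars R).map (integralClosure R K).val.toLinearMap
  have hint : IsIntegral R (v * (b : K)) := by
    refine isIntegral_of_mul_mem N hc ⟨c, hcJ, rfl⟩ ?_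
    rintro _ ⟨x, hx, rfl⟩
    obtain ⟨y, hy, hxy⟩ := h x hx
    have hxy' : (b : K) * x = c * y := congrArg Subtype.val hxy
    refine ⟨y, hy, ?_⟩
    change (y : K) = v * b * x
    linear_combination (-v) * hxy' - (y : K) * hv
  refine ⟨⟨v * b, hint⟩, Subtype.ext ?_⟩
  change (b : K) = c * (v * b)
  linear_combination (-(b : K)) * hv

variable {A : Type*} [CommRing A]

lemma exists_mem_maximalIdeal_mem_nonZeroDivisors [IsLocalRing A] [IsNoetherianRing A]
    [IsReduced A] (hA : ¬ IsField A) :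
    ∃ c ∈ IsLocalRing.maximalIdeal A, c ∈ nonZeroDivisors A := by
  by_contra! h
  obtain ⟨x, hx, hx0⟩ := SetLike.exists_of_lt
    (Ideal.bot_lt_annihilator_of_disjoint_nonZeroDivisors (Set.disjoint_left.mpr h))
  have hmul : ∀ y ∈ IsLocalRing.maximalIdeal A, x * y = 0 := Submodule.mem_annihilator.mp hx
  by_cases hxm : x ∈ IsLocalRing.maximalIdeal A
  · exact hx0 (IsReduced.eq_zero x ⟨2, by rw [pow_two, hmul x hxm]⟩)
  · have hu : IsUnit x := IsLocalRing.notMem_maximalIdeal.mp hxm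
    refine hA (IsLocalRing.isField_iff_maximalIdeal_eq.mpr (eq_bot_iff.mpr fun y hy => ?_))
    exact hu.mul_right_eq_zero.mp (hmul y hy)

lemma exists_forall_algebraMap_eq_mul {K : Type*} [CommRing K] [Algebra A K] {M : Submonoid A}
    [IsLocalization M K] (B : Subalgebra A K) [Module.Finite A B] :
    ∃ d ∈ M, ∀ b : B, ∃ a, algebraMap A B a = algebraMap A B d * b := by
  obtain ⟨d, hd, h⟩ := FractionalIdeal.isFractional_of_fg (S := M)
    (Module.Finite.iff_fg.mp ‹Module.Finite A (Subalgebra.toSubmodule B)›)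
  refine ⟨d, hd, fun b => ?_⟩
  obtain ⟨a, ha⟩ := h b b.2
  exact ⟨a, Subtype.ext (ha.trans (Algebra.smul_def d (b : K)))⟩

lemma exists_maximalIdeal_pow_le_span [IsLocalRing A] [IsNoetherianRing A]
    (hdim : ringKrullDim A = 1) {c : A} (hc : c ∈ nonZeroDivisors A) :
    ∃ d, IsLocalRing.maximalIdeal A ^ d ≤ Ideal.span {c} := by
  have hsucc := ringKrullDim_quotient_succ_le_of_nonZeroDivisor hc
  have : Ring.KrullDimLE 0 (A ⧸ Ideal.span {c}) := by
    rw [hdim, show (1 : WithBot ℕ∞) = 0 + 1 from (zero_add 1).symm] at hsucc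
    exact Ring.krullDimLE_iff.mpr (ENat.WithBot.add_le_add_one_right_iff.mp hsucc)
  have : IsArtinianRing (A ⧸ Ideal.span {c}) := isArtinianRing_iff_krullDimLE_zero.mpr this
  exact IsLocalRing.exists_maximalIdeal_pow_le_of_isArtinianRing_quotient _

theorem exists_isCurveNormalization (k : Type*) [Field k] [Algebra k A] [IsLocalRing A]
    [IsNoetherianRing A] [IsReduced A] (hdim : ringKrullDim A = 1)
    [∀ d, Module.Finite k (A ⧸ IsLocalRing.maximalIdeal A ^ d)]
    [Module.Finite A (integralClosure A (FractionRing A))] :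
    ∃ c : A, IsCurveNormalization k (integralClosure A (FractionRing A)) c := by
  have hfield : ¬ IsField A := fun hA => by
    rw [ringKrullDim_eq_zero_of_isField hA] at hdim
    exact zero_ne_one hdim
  obtain ⟨c₁, hc₁, hreg₁⟩ := exists_mem_maximalIdeal_mem_nonZeroDivisors hfield
  obtain ⟨c₂, hreg₂, hcond⟩ := exists_forall_algebraMap_eq_mul (M := nonZeroDivisors A)
    (integralClosure A (FractionRing A))
  have hreg : c₁ * c₂ ∈ nonZeroDivisors A := mul_mem hreg₁ hreg₂
  have hunit : IsUnit (algebraMap A (FractionRing A) (c₁ * c₂)) :=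
    IsLocalization.map_units (FractionRing A) (⟨_, hreg⟩ : nonZeroDivisors A)
  refine ⟨c₁ * c₂, ?_⟩
  constructor
  case injective =>
    exact fun _ _ hab => IsFractionRing.injective A (FractionRing A) (congrArg Subtype.val hab)
  case mem => exact Ideal.mul_mem_right _ _ hc₁
  case regular =>
    refine mem_nonZeroDivisors_iff_right.mpr fun x hx => Subtype.ext ?_
    exact hunit.mul_left_eq_zero.mp (congrArg Subtype.val hx)
  case conductor =>
    intro b
    obtain ⟨a, ha⟩ := hcond b
    exact ⟨c₁ * a, by rw [map_mul, map_mul, ha, mul_assoc]⟩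
  case finite_quotient =>
    obtain ⟨d, hd⟩ := exists_maximalIdeal_pow_le_span hdim hreg
    exact finite_quotient_of_le hd
  case dvd => exact fun b J hcJ h => dvd_of_forall_mul_eq_mul hunit hcJ h

end IntegralClosure

/-! ### Finiteness of the integral closure -/

section FiniteIntegralClosure

lemma restrictScalars_integralClosure (R S L : Type*) [CommRing R] [CommRing S] [CommRing L]
    [Algebra R S] [Algebra R L] [Algebra S L] [IsScalarTower R S L] [Algebra.IsIntegral R S] :
    (integralClosure S L).restrictScalars R = integralClosure R L :=
  SetLike.ext fun x => ⟨fun hx => isIntegral_trans x hx, fun hx => IsIntegral.tower_top hx⟩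

lemma finite_integralClosure_iff (R S L : Type*) [CommRing R] [CommRing S] [CommRing L]
    [Algebra R S] [Algebra R L] [Algebra S L] [IsScalarTower R S L] [Module.Finite R S] :
    Module.Finite R (integralClosure R L) ↔ Module.Finite S (integralClosure S L) := by
  have heq := restrictScalars_integralClosure R S L
  constructor <;> intro h
  · rw [← heq] at h
    have : Module.Finite R (integralClosure S L) := h
    exact Module.Finite.of_restrictScalars_finite R S _
  · have : Module.Finite R (integralClosure S L) := Module.Finite.trans S _
    rw [← heq]
    exact this

lemma finite_integralClosure_of_isLocalization {R S L : Type*} [CommRing R] [CommRing S]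
    [CommRing L] [Algebra R S] [Algebra R L] [Algebra S L] [IsScalarTower R S L] (M : Submonoid R)
    [IsLocalization M S] [Module.Finite R (integralClosure R L)] :
    Module.Finite S (integralClosure S L) := by
  have hle : integralClosure R L ≤ (integralClosure S L).restrictScalars R :=
    fun _ hx => IsIntegral.tower_top hx
  let ι : integralClosure R L →+* integralClosure S L := (Subalgebra.inclusion hle).toRingHom
  let : Algebra (integralClosure R L) (integralClosure S L) := ι.toAlgebra
  have : IsScalarTower (integralClosure R L) (integralClosure S L) L := .of_algebraMap_eq' rfl
  have : IsScalarTower R (integralClosure R L) (integralClosure S L) := .of_algebraMap_eq' rfl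
  have hunits : Algebra.algebraMapSubmonoid L M ≤ IsUnit.submonoid L := by
    rintro _ ⟨m, hm, rfl⟩
    rw [IsScalarTower.algebraMap_apply R S L]
    exact (IsLocalization.map_units S (⟨m, hm⟩ : M)).map _
  have : IsLocalization (Algebra.algebraMapSubmonoid L M) L := IsLocalization.self hunits
  have := IsLocalization.integralClosure (S := L) (Rf := S) (Sf := L) M
  exact Module.Finite.of_isLocalization R (integralClosure R L) M

lemma finite_integralClosure_of_forall_eq_zero {A K ι : Type*} [CommRing A] [IsNoetherianRing A]
    [CommRing K] [Algebra A K] [Finite ι] {L : ι → Type*} [∀ i, CommRing (L i)]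
    [∀ i, Algebra A (L i)] [∀ i, Module.Finite A (integralClosure A (L i))]
    (Φ : ∀ i, K →ₐ[A] L i) (h : ∀ x, (∀ i, Φ i x = 0) → x = 0) :
    Module.Finite A (integralClosure A K) := by
  let ψ : integralClosure A K →ₗ[A] ∀ i, integralClosure A (L i) :=
    LinearMap.pi fun i => (Φ i).mapIntegralClosure.toLinearMap
  have hψ : Function.Injective ψ := (injective_iff_map_eq_zero ψ).mpr fun b hb =>
    Subtype.ext (h b fun i => congrArg Subtype.val (congrFun hb i))
  have : IsNoetherian A (integralClosure A K) := isNoetherian_of_injective ψ hψ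
  infer_instance

lemma finite_of_injective_of_comp_eq {P C T : Type*} [CommRing P] [IsNoetherianRing P] [CommRing C]
    [Algebra P C] [CommRing T] {f : P →+* T} (hf : f.Finite) {φ : C →+* T}
    (hφ : Function.Injective φ) (h : φ.comp (algebraMap P C) = f) : Module.Finite P C := by
  let := f.toAlgebra
  have : Module.Finite P T := hf
  let ψ : C →ₐ[P] T := { φ with commutes' := RingHom.congr_fun h }
  have : IsNoetherian P C := isNoetherian_of_injective ψ.toLinearMap hφ
  infer_instance

lemma finite_iterateFrobenius_mvPolynomial {k : Type*} [Field k] (p : ℕ) [ExpChar k p]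
    [PerfectRing k p] {σ : Type*} [Finite σ] [ExpChar (MvPolynomial σ k) p] (n : ℕ) :
    (iterateFrobenius (MvPolynomial σ k) p n).Finite := by
  refine RingHom.IsIntegral.to_finite (fun x => ?_) ?_
  · refine ⟨Polynomial.X ^ p ^ n - Polynomial.C x,
      Polynomial.monic_X_pow_sub_C x (pow_ne_zero _ (expChar_pos k p).ne'), ?_⟩
    simp [iterateFrobenius_def]
  · have hcomm : (MvPolynomial.C (σ := σ)).comp (iterateFrobenius k p n) =
        (iterateFrobenius (MvPolynomial σ k) p n).comp MvPolynomial.C := by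
      ext1 a
      simp [iterateFrobenius_def]
    have hfrob : (iterateFrobenius k p n).FiniteType :=
      RingHom.FiniteType.of_surjective _ (bijective_iterateFrobenius k p n).2
    have hC : (MvPolynomial.C (R := k) (σ := σ)).FiniteType :=
      RingHom.finiteType_algebraMap.mpr inferInstance
    exact (hcomm ▸ hC.comp hfrob : RingHom.FiniteType _).of_comp_finiteType

/-- Some power of Frobenius maps `L` into `E`, so that it embeds the integral closure in `L` into
the integral closure in `E`. -/
lemma finite_integralClosure_of_isPurelyInseparable {P E L : Type*} [CommRing P]
    [IsNoetherianRing P] [Field E] [Field L] [Algebra P E] [Algebra E L] [Algebra P L]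
    [IsScalarTower P E L] [IsPurelyInseparable E L] [FiniteDimensional E L] (p : ℕ) [ExpChar P p]
    [ExpChar E p] (hfrob : ∀ n, (iterateFrobenius P p n).Finite)
    [Module.Finite P (integralClosure P E)] :
    Module.Finite P (integralClosure P L) := by
  let n := IsPurelyInseparable.exponent E L
  let F : L →+* E := IsPurelyInseparable.iterateFrobenius E L p le_rfl
  have hF : ∀ x, algebraMap E L (F x) = x ^ p ^ n :=
    IsPurelyInseparable.algebraMap_iterateFrobenius E p le_rfl
  let φ : integralClosure P L →+* integralClosure P E :=
    (F.comp (integralClosure P L).val.toRingHom).codRestrict (integralClosure P E) fun x =>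
      (isIntegral_algebraMap_iff (algebraMap E L).injective).mp (hF x ▸ x.2.pow _)
  have hφ : Function.Injective φ := fun _ _ hxy =>
    Subtype.ext (F.injective (congrArg Subtype.val hxy))
  have hfin : ((algebraMap P (integralClosure P E)).comp (iterateFrobenius P p n)).Finite :=
    (RingHom.finite_algebraMap.mpr inferInstance).comp (hfrob n)
  refine finite_of_injective_of_comp_eq hfin hφ (RingHom.ext fun a => Subtype.ext ?_)
  refine (algebraMap E L).injective ?_
  change algebraMap E L (F (algebraMap P L a)) = algebraMap E L (algebraMap P E _)
  rw [hF, ← IsScalarTower.algebraMap_apply, iterateFrobenius_def, map_pow]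

theorem finite_integralClosure_mvPolynomial (k : Type*) [Field k] [PerfectField k] (σ : Type*)
    [Finite σ] (L : Type*) [Field L] [Algebra (MvPolynomial σ k) L]
    [Algebra (FractionRing (MvPolynomial σ k)) L]
    [IsScalarTower (MvPolynomial σ k) (FractionRing (MvPolynomial σ k)) L]
    [FiniteDimensional (FractionRing (MvPolynomial σ k)) L] :
    Module.Finite (MvPolynomial σ k) (integralClosure (MvPolynomial σ k) L) := by
  let P := MvPolynomial σ k
  let K := FractionRing P
  let E := separableClosure K L
  obtain ⟨p, _⟩ := ExpChar.exists k
  have : ExpChar P p := expChar_of_injective_algebraMap (algebraMap k P).injective p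
  have : ExpChar K p := expChar_of_injective_algebraMap (IsFractionRing.injective P K) p
  have : ExpChar E p := expChar_of_injective_algebraMap (algebraMap K E).injective p
  have : IsScalarTower P E L := .of_algebraMap_eq' <| by
    rw [IsScalarTower.algebraMap_eq P K L, IsScalarTower.algebraMap_eq P K E,
      IsScalarTower.algebraMap_eq K E L, RingHom.comp_assoc]
  have : Module.Finite P (integralClosure P E) := IsIntegralClosure.finite P K E _
  exact finite_integralClosure_of_isPurelyInseparable (E := E) p
    (finite_iterateFrobenius_mvPolynomial p)

theorem finite_integralClosure_of_finiteType (k D L : Type*) [Field k] [PerfectField k]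
    [CommRing D] [IsDomain D] [Algebra k D] [Algebra.FiniteType k D] [Field L] [Algebra D L]
    [IsFractionRing D L] :
    Module.Finite D (integralClosure D L) := by
  obtain ⟨r, g, hg, hgfin⟩ := exists_finite_inj_algHom_of_fg k D
  let P := MvPolynomial (Fin r) k
  let : Algebra P D := g.toRingHom.toAlgebra
  have : Module.Finite P D := hgfin
  have : FaithfulSMul P D := (faithfulSMul_iff_algebraMap_injective P D).mpr hg
  let : Algebra P L := ((algebraMap D L).comp (algebraMap P D)).toAlgebra
  have : IsScalarTower P D L := .of_algebraMap_eq' rfl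
  have : FaithfulSMul P L := (faithfulSMul_iff_algebraMap_injective P L).mpr
    ((IsFractionRing.injective D L).comp hg)
  let : Algebra (FractionRing P) L := FractionRing.liftAlgebra P L
  have : IsScalarTower P (FractionRing P) L := FractionRing.isScalarTower_liftAlgebra P L
  have : FiniteDimensional (FractionRing P) L := .of_isLocalization P D (nonZeroDivisors P)
  exact (finite_integralClosure_iff P D L).mp (finite_integralClosure_mvPolynomial k (Fin r) L)

lemma isFractionRing_of_isLocalization_of_isFractionRing {R S K : Type*} [CommRing R] [CommRing S]
    [Field K] [Algebra R S] [Algebra R K] [Algebra S K] [IsScalarTower R S K] [FaithfulSMul R K]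
    (M : Submonoid R) [IsLocalization M S] [IsFractionRing S K] : IsFractionRing R K := by
  refine IsFractionRing.of_field _ _ fun z => ?_
  obtain ⟨a, b, hb, rfl⟩ := IsFractionRing.div_surjective S z
  obtain ⟨x, m, rfl⟩ := IsLocalization.exists_mk'_eq M a
  obtain ⟨y, n, rfl⟩ := IsLocalization.exists_mk'_eq M b
  have hunit : ∀ m : M, algebraMap R K m ≠ 0 := fun m => by
    rw [IsScalarTower.algebraMap_apply R S K]
    exact ((IsLocalization.map_units S m).map _).ne_zero
  have hmul : ∀ (x : R) (m : M),
      algebraMap S K (IsLocalization.mk' S x m) * algebraMap R K m = algebraMap R K x := by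
    intro x m
    rw [IsScalarTower.algebraMap_apply R S K, IsScalarTower.algebraMap_apply R S K, ← map_mul,
      IsLocalization.mk'_spec]
  refine ⟨x * n, y * m, ?_⟩
  rw [map_mul, map_mul, ← hmul x m, ← hmul y n]
  have := (algebraMap S K).domain_nontrivial
  have hy := IsFractionRing.to_map_ne_zero_of_mem_nonZeroDivisors (K := K) hb
  have := hunit m
  have := hunit n
  field_simp

theorem finite_integralClosure_of_essFiniteType (k A L : Type*) [Field k] [PerfectField k]
    [CommRing A] [IsDomain A] [Algebra k A] [Algebra.EssFiniteType k A] [Field L] [Algebra A L]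
    [IsFractionRing A L] :
    Module.Finite A (integralClosure A L) := by
  let D := Algebra.EssFiniteType.subalgebra k A
  let M := Algebra.EssFiniteType.submonoid k A
  have : IsFractionRing D L := isFractionRing_of_isLocalization_of_isFractionRing (S := A) M
  have := finite_integralClosure_of_finiteType k D L
  exact finite_integralClosure_of_isLocalization (R := D) M

section TotalFractionRing

variable {A : Type*} [CommRing A]

lemma algebraMap_fractionRing_quotient_eq_zero_iff {p : Ideal A} {a : A} :
    algebraMap A (FractionRing (A ⧸ p)) a = 0 ↔ a ∈ p := by
  rw [IsScalarTower.algebraMap_apply A (A ⧸ p), IsFractionRing.to_map_eq_zero_iff,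
    Ideal.Quotient.algebraMap_eq, Ideal.Quotient.eq_zero_iff_mem]

/-- The projection of the total ring of fractions of `A` to its factor at a minimal prime. -/
def fractionRingToQuotient (p : minimalPrimes A) :
    FractionRing A →ₐ[A] FractionRing (A ⧸ p.1) :=
  have : p.1.IsPrime := p.2.1.1
  IsLocalization.liftAlgHom (M := nonZeroDivisors A) (f := Algebra.ofId A _) fun y =>
    isUnit_iff_ne_zero.mpr fun h => Set.disjoint_left.mp
      (Ideal.disjoint_nonZeroDivisors_of_mem_minimalPrimes p.2)
      (algebraMap_fractionRing_quotient_eq_zero_iff.mp h) y.2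

lemma eq_zero_of_forall_fractionRingToQuotient_eq_zero [IsReduced A] {x : FractionRing A}
    (hx : ∀ p, fractionRingToQuotient p x = 0) : x = 0 := by
  obtain ⟨a, s, rfl⟩ := IsLocalization.exists_mk'_eq (nonZeroDivisors A) x
  have ha : a ∈ sInf (minimalPrimes A) := by
    refine Ideal.mem_sInf.mpr fun {p} hp => algebraMap_fractionRing_quotient_eq_zero_iff.mp ?_
    have hspec := congrArg (fractionRingToQuotient ⟨p, hp⟩)
      (IsLocalization.mk'_spec (FractionRing A) a s)
    rwa [map_mul, hx, zero_mul, AlgHom.commutes, eq_comm] at hspec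
  rw [minimalPrimes, Ideal.sInf_minimalPrimes] at ha
  have ha0 : a = 0 := IsNilpotent.eq_zero ha
  rw [ha0, IsLocalization.mk'_zero]

theorem finite_integralClosure_fractionRing (k A : Type*) [Field k] [PerfectField k] [CommRing A]
    [Algebra k A] [Algebra.EssFiniteType k A] [IsNoetherianRing A] [IsReduced A] :
    Module.Finite A (integralClosure A (FractionRing A)) := by
  have : Finite (minimalPrimes A) := minimalPrimes.finite_of_isNoetherianRing A
  have : ∀ p : minimalPrimes A, Module.Finite A (integralClosure A (FractionRing (A ⧸ p.1))) := by
    intro p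
    have : p.1.IsPrime := p.2.1.1
    exact (finite_integralClosure_iff A (A ⧸ p.1) _).mpr
      (finite_integralClosure_of_essFiniteType k (A ⧸ p.1) _)
  exact finite_integralClosure_of_forall_eq_zero fractionRingToQuotient
    fun _ hx => eq_zero_of_forall_fractionRingToQuotient_eq_zero hx

end TotalFractionRing

end FiniteIntegralClosure

/-! ### The local ring of a curve at a closed point -/

section CurveGerm

theorem exists_polynomial_of_finite_integralClosure {k : Type u} [Field k] [IsAlgClosed k]
    {A : Type u} [CommRing A] [Algebra k A] [IsLocalRing A] [IsNoetherianRing A] [IsReduced A]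
    [∀ d, Module.Finite k (A ⧸ IsLocalRing.maximalIdeal A ^ d)]
    [Module.Finite A (integralClosure A (FractionRing A))] (hdim : ringKrullDim A = 1) :
    ∃ P : Polynomial (K0 k),
      (PowerSeries.mk fun d => (idealVariety k (A ⧸ IsLocalRing.maximalIdeal A ^ d) d).cls) *
        (1 - PowerSeries.X) ^ Nat.card (MaximalSpectrum (integralClosure A (FractionRing A))) =
          (P : PowerSeries (K0 k)) := by
  have : IsNoetherianRing (integralClosure A (FractionRing A)) := IsNoetherianRing.of_finite A _
  have := finite_maximalSpectrum A (integralClosure A (FractionRing A))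
  have := Fintype.ofFinite (MaximalSpectrum (integralClosure A (FractionRing A)))
  obtain ⟨c, hc⟩ := exists_isCurveNormalization k hdim
  obtain ⟨t, γ, H⟩ := hc.exists_isUniformizingSystem
  rw [Nat.card_eq_fintype_card]
  exact H.exists_polynomial

lemma essFiniteType_stalk (R : Type u) [CommRing R] (p : PrimeSpectrum R) :
    Algebra.EssFiniteType R ((Spec.structureSheaf R).presheaf.stalk p) :=
  .of_isLocalization _ p.asIdeal.primeCompl

lemma essFiniteType_preimage_fromSpecStalk (R : CommRingCat.{u}) (y : Spec R) :
    (Spec.preimage ((Spec R).fromSpecStalk y)).hom.EssFiniteType := by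
  have heq : Spec.preimage ((Spec R).fromSpecStalk y) = StructureSheaf.toStalk R y :=
    Spec.map_injective ((Spec.map_preimage _).trans (Spec.fromSpecStalk_eq' _ _))
  rw [heq]
  exact essFiniteType_stalk R y

lemma essFiniteType_localRingAt {k : Type u} [Field k] {X : Scheme.{u}}
    (f : X ⟶ Spec (CommRingCat.of k)) [LocallyOfFiniteType f] (x : X) :
    Algebra.EssFiniteType k (LocalRingAt f x) := by
  have hfactor : Spec.preimage (X.fromSpecStalk x ≫ f) =
      Spec.preimage ((Spec (CommRingCat.of k)).fromSpecStalk (f x)) ≫ f.stalkMap x := by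
    apply Spec.map_injective
    rw [Spec.map_comp, Spec.map_preimage, Spec.map_preimage,
      Scheme.SpecMap_stalkMap_fromSpecStalk]
  have hess : (Spec.preimage (X.fromSpecStalk x ≫ f)).hom.EssFiniteType := by
    rw [hfactor]
    exact (essFiniteType_preimage_fromSpecStalk _ _).comp (LocallyOfFiniteType.stalkMap f x)
  exact hess

end CurveGerm

end HilbZeta

end

theorem theorem2p3 {k : Type u} [Field k] [IsAlgClosed k] {X : Scheme.{u}}
    (f : X ⟶ Spec (CommRingCat.of k)) [LocallyOfFiniteType f] [IsReduced X]
    (x : X) (hx : IsClosed {x}) (hdim : ringKrullDim (X.presheaf.stalk x) = 1) :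
    ∃ P : Polynomial (HilbZeta.K0 k),
      HilbZeta.punctualHilbertZeta f x hx * (1 - PowerSeries.X) ^ HilbZeta.numBranches x =
        (P : PowerSeries (HilbZeta.K0 k)) := by
  let A := HilbZeta.LocalRingAt f x
  have : IsLocallyNoetherian X := LocallyOfFiniteType.isLocallyNoetherian f
  have : IsNoetherianRing A := inferInstanceAs (IsNoetherianRing (X.presheaf.stalk x))
  have : _root_.IsReduced A := inferInstanceAs (_root_.IsReduced (X.presheaf.stalk x))
  have : ∀ d, Module.Finite k (A ⧸ IsLocalRing.maximalIdeal A ^ d) :=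
    HilbZeta.finite_neighbourhood f x hx
  have : Algebra.EssFiniteType k A := HilbZeta.essFiniteType_localRingAt f x
  have : Module.Finite A (integralClosure A (FractionRing A)) :=
    HilbZeta.finite_integralClosure_fractionRing k A
  exact HilbZeta.exists_polynomial_of_finite_integralClosure (A := A) hdim
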